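/- Let $K$ be a field of characteristic $0$. A meander with $n$ nodes is a pair $\frac{\lambda}{\mu}$ of compositions $\lambda,\mu$ of $n$. Its seaweed algebra $\mathfrak p_n\frac{\lambda}{\mu}\subseteq\mathfrak{gl}_n(K)$ consists of the matrices whose nonzero entries above the diagonal lie in the diagonal blocks of sizes given by $\lambda$, and whose nonzero entries below the diagonal lie in the diagonal blocks of sizes given by $\mu$. The index of the meander is the index of this Lie algebra $\mathfrak g=\mathfrak p_n\frac{\lambda}{\mu}$, that is, $\min_{f\in\mathfrak g^*}\dim\{x\in\mathfrak g : f([x,y])=0 \text{ for all } y\in\mathfrak g\}$. A meander with $n\ge 1$ nodes is indecomposable if it is not of the form $\frac{\lambda_1|\lambda_2}{\mu_1|\mu_2}$ with $\frac{\lambda_1}{\mu_1}$, $\frac{\lambda_2}{\mu_2}$ meanders with fewer than $n$ nodes, where $|$ denotes concatenation. For a set $J$ of positive integers, let $a^J_{n,k}$ (respectively $i^J_{n,k}$) be the number of meanders (respectively indecomposable meanders) $\frac{\lambda}{\mu}$ with $n$ nodes and index $k$ such that all parts of $\lambda$ and $\mu$ lie in $J$, and let $A_J(x,y)=\sum_{n,k\ge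 0}a^J_{n,k}x^ny^k$ as a formal power series (with $a^J_{0,0}=1$ from the empty meander). Theorem. (1) $$A_{\{3,4\}}(x,y)=\frac{1-x^2-x^3y-x^4+x^6}{(1-x^3y^3-x^4y^4)(1-x^2-x^3y-x^4+x^6)-2x^7y+2x^9y}.$$ (2) For $J=\{3,4\}$ and for $J=\{1,4\}$, for all $n>10$ and $k\ge 0$ (with $i^J_{m,-1}=0$), $$i^{J}_{n,k}=i^{J}_{n-2,k}+i^{J}_{n-3,k-1}+i^{J}_{n-4,k}-i^{J}_{n-6,k}.$$ Moreover the two sequences agree up to a shift of $n$ by $6$: $i^{\{3,4\}}_{n,k}=i^{\{1,4\}}_{n-6,k}$ for all $n>10$ and $k\ge 0$. (3) For every integer $c\ge 1$, $A_{\{3c,4c\}}(x,y)=A_{\{3,4\}}(x^c,y^c)$. -/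

import Mathlib

attribute [local instance 100] LieRing.ofAssociativeRing

/-! ### The index of a Lie algebra -/

/-- The stabilizer of a linear form `f` on a Lie algebra `L` under the coadjoint action:
all `x` with `f ⁅x, y⁆ = 0` for every `y`. -/
def coadjointStabilizer (K L : Type*) [Field K] [LieRing L] [LieAlgebra K L]
    (f : Module.Dual K L) : Submodule K L where
  carrier := {x | ∀ y : L, f ⁅x, y⁆ = 0}
  zero_mem' := by intro y; simp
  add_mem' := by
    intro a b ha hb y
    rw [add_lie, map_add, ha y, hb y, add_zero]
  smul_mem' := by
    intro r a ha y
    rw [smul_lie, map_smul, ha y, smul_zero]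

/-- The index of a Lie algebra: the minimal dimension of the stabilizer of a linear form. -/
noncomputable def lieIndex (K L : Type*) [Field K] [LieRing L] [LieAlgebra K L] : ℕ :=
  sInf (Set.range fun f : Module.Dual K L => Module.finrank K (coadjointStabilizer K L f))

/-! ### Seaweed algebras -/

/-- `Composition.index` (the number of the block containing a position) is monotone. -/
theorem composition_index_mono {n : ℕ} (c : Composition n) {i j : Fin n} (h : i ≤ j) :
    c.index i ≤ c.index j := by
  by_contra hlt
  rw [not_le] at hlt
  have h1 := c.lt_sizeUpTo_index_succ j
  have h2 := c.sizeUpTo_index_le i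
  have h3 : c.sizeUpTo (c.index j).succ ≤ c.sizeUpTo (c.index i) :=
    c.monotone_sizeUpTo (by simpa using hlt)
  have h4 : (i : ℕ) ≤ j := h
  omega

/-- Positions between two positions of the same block lie in that block. -/
theorem composition_index_between {n : ℕ} (c : Composition n) {i k j : Fin n}
    (hik : i ≤ k) (hkj : k ≤ j) (h : c.index i = c.index j) :
    c.index i = c.index k ∧ c.index k = c.index j := by
  have h1 := composition_index_mono c hik
  have h2 := composition_index_mono c hkj
  have h3 : c.index i = c.index k := le_antisymm h1 (h ▸ h2)
  exact ⟨h3, h3 ▸ h⟩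

/-- The positions `(i, j)` where a matrix of the seaweed algebra of `lam` over `mu` may be nonzero:
on or above the diagonal inside a diagonal block of `lam`, or on or below the diagonal inside a
diagonal block of `mu`. -/
def SeaweedPos {n : ℕ} (lam mu : Composition n) (i j : Fin n) : Prop :=
  (i ≤ j ∧ lam.index i = lam.index j) ∨ (j ≤ i ∧ mu.index i = mu.index j)

theorem SeaweedPos.comp {n : ℕ} {lam mu : Composition n} {i k j : Fin n}
    (h1 : SeaweedPos lam mu i k) (h2 : SeaweedPos lam mu k j) : SeaweedPos lam mu i j := by
  rcases h1 with ⟨a, ha⟩ | ⟨a, ha⟩ <;> rcases h2 with ⟨b, hb⟩ | ⟨b, hb⟩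
  · exact Or.inl ⟨a.trans b, ha.trans hb⟩
  · rcases le_total i j with c | c
    · exact Or.inl ⟨c, (composition_index_between lam c b ha).1⟩
    · exact Or.inr ⟨c, ((composition_index_between mu c a hb.symm).1.symm)⟩
  · rcases le_total i j with c | c
    · exact Or.inl ⟨c, (composition_index_between lam a c hb).2⟩
    · exact Or.inr ⟨c, (composition_index_between mu b c ha.symm).2.symm⟩
  · exact Or.inr ⟨b.trans a, ha.trans hb⟩

theorem seaweedPos_mul {K : Type*} [Field K] {n : ℕ} {lam mu : Composition n}
    {A B : Matrix (Fin n) (Fin n) K}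
    (hA : ∀ i j, A i j ≠ 0 → SeaweedPos lam mu i j)
    (hB : ∀ i j, B i j ≠ 0 → SeaweedPos lam mu i j) (i j : Fin n)
    (h : (A * B) i j ≠ 0) : SeaweedPos lam mu i j := by
  rw [Matrix.mul_apply] at h
  obtain ⟨k, -, hk⟩ := Finset.exists_ne_zero_of_sum_ne_zero h
  exact (hA i k (left_ne_zero_of_mul hk)).comp (hB k j (right_ne_zero_of_mul hk))

/-- The seaweed algebra of the pair of compositions `lam`, `mu` of `n`, a Lie subalgebra of
`𝔤𝔩ₙ(K)`: the matrices whose nonzero entries above the diagonal lie in the diagonal blocks of sizes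
given by `lam`, and whose nonzero entries below the diagonal lie in the diagonal blocks of sizes
given by `mu`. -/
def seaweed (K : Type*) [Field K] {n : ℕ} (lam mu : Composition n) :
    LieSubalgebra K (Matrix (Fin n) (Fin n) K) where
  carrier := {A | ∀ i j, A i j ≠ 0 → SeaweedPos lam mu i j}
  zero_mem' := by intro i j h; exact absurd rfl h
  add_mem' := by
    intro A B hA hB i j h
    by_cases h0 : A i j = 0
    · refine hB i j fun h1 => h ?_
      rw [Matrix.add_apply, h0, h1, add_zero]
    · exact hA i j h0
  smul_mem' := by
    intro r A hA i j h
    refine hA i j fun h0 => h ?_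
    rw [Matrix.smul_apply, h0, smul_zero]
  lie_mem' := by
    intro A B hA hB i j h
    rw [Ring.lie_def, Matrix.sub_apply] at h
    by_cases h0 : (A * B) i j = 0
    · refine seaweedPos_mul hB hA i j fun h1 => h ?_
      rw [h0, h1, sub_zero]
    · exact seaweedPos_mul hA hB i j h0

/-! ### Meanders and their enumeration -/

/-- A meander with `n` nodes, given by its upper and its lower composition of `n`. -/
abbrev Meander (n : ℕ) := Composition n × Composition n

/-- The index of a meander: the index of the associated seaweed algebra. -/
noncomputable def meanderIndex (K : Type*) [Field K] {n : ℕ} (M : Meander n) : ℕ :=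
  lieIndex K (seaweed K M.1 M.2)

/-- All parts of both compositions of the meander belong to `J`. -/
def MeanderPartsIn (J : Set ℕ) {n : ℕ} (M : Meander n) : Prop :=
  (∀ b ∈ M.1.blocks, b ∈ J) ∧ (∀ b ∈ M.2.blocks, b ∈ J)

/-- `M` is the direct sum of `M₁` and `M₂`: both compositions are the concatenations. -/
def IsMeanderSum {m p n : ℕ} (M₁ : Meander m) (M₂ : Meander p) (M : Meander n) : Prop :=
  M.1.blocks = M₁.1.blocks ++ M₂.1.blocks ∧ M.2.blocks = M₁.2.blocks ++ M₂.2.blocks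

/-- A nonempty meander that is not the direct sum of two strictly smaller meanders. -/
def MeanderIndecomposable {n : ℕ} (M : Meander n) : Prop :=
  0 < n ∧ ¬ ∃ m p : ℕ, m < n ∧ p < n ∧
    ∃ (M₁ : Meander m) (M₂ : Meander p), IsMeanderSum M₁ M₂ M

/-- The number `a_{n,k}^J` of meanders with `n` nodes, parts in `J` and index `k`. -/
noncomputable def meanderCount (K : Type*) [Field K] (J : Set ℕ) (n k : ℕ) : ℕ :=
  {M : Meander n | MeanderPartsIn J M ∧ meanderIndex K M = k}.ncard

/-- The number `i_{n,k}^J` of indecomposable meanders with `n` nodes, parts in `J` and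
index `k`. -/
noncomputable def indecMeanderCount (K : Type*) [Field K] (J : Set ℕ) (n k : ℕ) : ℕ :=
  {M : Meander n | MeanderIndecomposable M ∧ MeanderPartsIn J M ∧ meanderIndex K M = k}.ncard

/-- The generating function `A_J(x, y) = ∑ a_{n,k}^J xⁿ yᵏ`, a formal power series in the variables
`x` (number `0`) and `y` (number `1`). -/
noncomputable def meanderGenFun (K : Type*) [Field K] (J : Set ℕ) : MvPowerSeries (Fin 2) ℤ :=
  fun d => (meanderCount K J (d 0) (d 1) : ℤ)

/-- The recurrence `i_{n,k} = i_{n-2,k} + i_{n-3,k-1} + i_{n-4,k} - i_{n-6,k}` for `n > 10`,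
with `i_{n-3,-1} = 0`. -/
def SatisfiesMeanderRecurrence (i : ℕ → ℕ → ℕ) : Prop :=
  ∀ n k : ℕ, 10 < n →
    (i n k : ℤ) = i (n - 2) k + (if k = 0 then 0 else (i (n - 3) (k - 1) : ℤ))
      + i (n - 4) k - i (n - 6) k

/-! The index is the least dimension of the radical of a form `f ⁅x, y⁆`, and for seaweed algebras
it obeys a Euclidean-type reduction of the first blocks `a` and `b` of the two compositions. Say `a
≤ b`; let `A` be the first `a` nodes and `B` the next `b - a`. Matrices with rows in `B` and columns
in `A` form an ideal with zero multiplication. A generic linear form can be conjugated so that on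
this ideal it adds up the entries along a matching of `min a (b - a)` nodes of `A` with nodes of
`B`. The ideal is then isotropic and meets the radical trivially, so symplectic reduction
(`finrank_radicalOn_eq_of_reduction`) replaces the algebra by the orthogonal of the ideal modulo the
ideal. That quotient is again a matrix algebra of a preorder, with the matched nodes of `A` deleted
(`IsArcMatching.relIndex_eq`). Non-generic forms only have larger stabilizers, by semicontinuity
along a line.

For compositions this turns `a :: l` over `b :: m` into `l` over `(b - 2 * a) :: a :: m` if `2 * a ≤
b`, and into `(2 * a - b) :: l` over `a :: m` if `b ≤ 2 * a`. Two equal first blocks `a` split off a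
copy of `𝔤𝔩ₐ`, of index `a`. All these steps are homogeneous in the block sizes, which gives the
scaling statement (`listIndex_map_mul`, `balancedSeries_image_mul`).

For parts in `{3, 4}` or `{1, 4}` a partially read meander is described, as far as the index is
concerned, by which side is ahead and by a reduced overhang, and only the overhangs `[1]`, `[1, 1]`,
`[2, 1]` occur. Reading one more block is a transition between these three states, weighted by a
monomial in `x` and `y`. The counting series therefore solve a 3 by 3 linear system, and for both
sets of parts elimination produces the factor `1 - x² - x³y - x⁴ + x⁶`. This common factor is the
source of the common recurrence.

The transitions are proved for an abstract condition on pairs of lists (`IsOverhangCond`,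
`IsBalancedCond`). With no condition, a closed overhang is followed by an arbitrary meander; with
indecomposability, it must be followed by nothing. The same linear algebra thus yields `A_J` and the
indecomposable series. For the latter, the series for `{3, 4}` and `x⁶` times the series for `{1,
4}` differ by a polynomial of degree 10 in `x`, which explains the shift by 6 and the bound `n >
10`. -/

/-! ### Radicals of bilinear forms -/

section Radical

variable {K M M' : Type*} [Field K] [AddCommGroup M] [Module K M] [AddCommGroup M'] [Module K M']

/-- The radical of the restriction of a bilinear form to a subspace. -/
def radicalOn (V : Submodule K M) (β : M →ₗ[K] M →ₗ[K] K) : Submodule K M where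
  carrier := {x | x ∈ V ∧ ∀ y ∈ V, β x y = 0}
  zero_mem' := ⟨V.zero_mem, by simp⟩
  add_mem' := by
    rintro a b ⟨ha, ha'⟩ ⟨hb, hb'⟩
    exact ⟨V.add_mem ha hb, fun y hy => by simp [ha' y hy, hb' y hy]⟩
  smul_mem' := by
    rintro r a ⟨ha, ha'⟩
    exact ⟨V.smul_mem r ha, fun y hy => by simp [ha' y hy]⟩

/-- A functional on `V` that vanishes on the orthogonal of a subspace `a` is represented by an
element of `a`. -/
theorem exists_mem_eq_of_vanish_orthogonal [FiniteDimensional K M] {V a : Submodule K M}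
    (β : M →ₗ[K] M →ₗ[K] K) (g : M →ₗ[K] K)
    (hg : ∀ y ∈ V, (∀ z ∈ a, β z y = 0) → g y = 0) :
    ∃ z ∈ a, ∀ y ∈ V, g y = β z y := by
  -- `Φ` sends `y` to `β · y` on `a`. A functional vanishing on `ker Φ` lies in the range of the
  -- dual map of `Φ`, and `a` is its own double dual.
  let Φ : V →ₗ[K] Module.Dual K a := ((β.domRestrict a).flip).domRestrict V
  have hmem : g.domRestrict V ∈ (LinearMap.ker Φ).dualAnnihilator := by
    rw [Submodule.mem_dualAnnihilator]
    rintro ⟨y, hy⟩ hker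
    refine hg y hy fun z hz => ?_
    exact LinearMap.congr_fun (LinearMap.mem_ker.1 hker) ⟨z, hz⟩
  rw [← LinearMap.range_dualMap_eq_dualAnnihilator_ker] at hmem
  obtain ⟨θ, hθ⟩ := hmem
  obtain ⟨z, rfl⟩ := (Module.evalEquiv K a).surjective θ
  refine ⟨z, z.2, fun y hy => ?_⟩
  exact (LinearMap.congr_fun hθ ⟨y, hy⟩).symm

/-- Reduction of a skew form by an isotropic subspace `a` that meets the radical trivially: the
radical has the dimension of the radical of the form induced on the orthogonal of `a` modulo `a`. -/
theorem finrank_radicalOn_eq_of_reduction [FiniteDimensional K M] [FiniteDimensional K M']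
    {V a : Submodule K M} {V' : Submodule K M'} {β : M →ₗ[K] M →ₗ[K] K} {β' : M' →ₗ[K] M' →ₗ[K] K}
    (j : M' →ₗ[K] M) (skew : ∀ x y, β x y = -β y x) (haV : a ≤ V)
    (hrad : ∀ z ∈ a, (∀ y ∈ V, β z y = 0) → z = 0)
    (hjV : ∀ w ∈ V', j w ∈ V) (hjperp : ∀ w ∈ V', ∀ z ∈ a, β (j w) z = 0)
    (hsurj : ∀ x ∈ V, (∀ z ∈ a, β x z = 0) → ∃ w ∈ V', x - j w ∈ a)
    (hinj : ∀ w ∈ V', j w ∈ a → w = 0)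
    (hform : ∀ w ∈ V', ∀ w' ∈ V', β (j w) (j w') = β' w w') :
    Module.finrank K (radicalOn V β) = Module.finrank K (radicalOn V' β') := by
  -- Each of the two radicals has the same sum with `a` and meets `a` trivially, so their dimensions
  -- agree.
  have hsup : radicalOn V β ⊔ a = (radicalOn V' β').map j ⊔ a := by
    apply le_antisymm
    · refine sup_le (fun x hx => ?_) le_sup_right
      obtain ⟨w, hw, hz⟩ := hsurj x hx.1 fun z hz => hx.2 z (haV hz)
      rw [← sub_add_cancel x (j w), add_comm]
      refine Submodule.add_mem_sup ⟨w, ⟨hw, fun w' hw' => ?_⟩, rfl⟩ hz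
      have h1 := hx.2 (j w') (hjV w' hw')
      have h2 : β (x - j w) (j w') = 0 := by rw [skew, hjperp w' hw' _ hz, neg_zero]
      rw [map_sub, LinearMap.sub_apply, h1, zero_sub, neg_eq_zero] at h2
      rw [← hform w hw w' hw', h2]
    · refine sup_le ?_ le_sup_right
      rintro _ ⟨w, hw, rfl⟩
      -- `j w` need not be in the radical of `β`: it is orthogonal only to the orthogonal of `a`.
      -- Subtracting the element of `a` that represents `β (j w)` on `V` repairs this.
      obtain ⟨z, hz, hzy⟩ := exists_mem_eq_of_vanish_orthogonal (V := V) (a := a) β (β (j w))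
        (fun y hy hy' => by
          obtain ⟨w', hw', hz'⟩ := hsurj y hy fun z hz => by rw [skew, hy' z hz, neg_zero]
          have h1 := hjperp w hw.1 _ hz'
          rw [map_sub, hform w hw.1 w' hw', hw.2 w' hw', sub_zero] at h1
          exact h1)
      rw [← sub_add_cancel (j w) z]
      refine Submodule.add_mem_sup ⟨V.sub_mem (hjV w hw.1) (haV hz), fun y hy => ?_⟩ hz
      rw [map_sub, LinearMap.sub_apply, hzy y hy, sub_self]
  have d1 : Disjoint (radicalOn V β) a := by
    rw [Submodule.disjoint_def]
    exact fun x hx hxa => hrad x hxa hx.2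
  have d2 : Disjoint ((radicalOn V' β').map j) a := by
    rw [Submodule.disjoint_def]
    rintro _ ⟨w, hw, rfl⟩ hwa
    rw [hinj w hw.1 hwa, map_zero]
  have e1 := Submodule.finrank_sup_add_finrank_inf_eq (radicalOn V β) a
  have e2 := Submodule.finrank_sup_add_finrank_inf_eq ((radicalOn V' β').map j) a
  rw [d1.eq_bot, finrank_bot] at e1
  rw [d2.eq_bot, finrank_bot] at e2
  rw [hsup] at e1
  have e3 : Module.finrank K ((radicalOn V' β').map j) = Module.finrank K (radicalOn V' β') := by
    have hi : Function.Injective (j.domRestrict (radicalOn V' β')) := by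
      rw [injective_iff_map_eq_zero]
      rintro ⟨w, hw⟩ h0
      have h0' : j w = 0 := h0
      exact Subtype.ext (hinj w hw.1 (h0' ▸ a.zero_mem))
    rw [← LinearMap.finrank_range_of_inj hi, LinearMap.range_domRestrict]
  omega

/-- Lower semicontinuity of the rank along a line. -/
theorem finite_setOf_finrank_ker_lt [FiniteDimensional K M] [FiniteDimensional K M']
    (f g : M →ₗ[K] M') :
    {t : K | Module.finrank K (LinearMap.ker f) <
      Module.finrank K (LinearMap.ker (f + t • g))}.Finite := by
  obtain ⟨s, hs⟩ := f.rangeRestrict.exists_rightInverse_of_surjective f.range_rangeRestrict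
  obtain ⟨p, hp⟩ := (LinearMap.range f).subtype.exists_leftInverse_of_injective
    (Submodule.ker_subtype _)
  -- Compressed to the range of `f`, the map `f + t • g` becomes `1 + t • G`. This is injective
  -- unless `-t⁻¹` is one of the finitely many eigenvalues of `G`, and injectivity bounds the rank
  -- from below.
  let G : Module.End K (LinearMap.range f) := p ∘ₗ g ∘ₗ s
  refine ((Module.End.finite_hasEigenvalue G).image fun μ => -μ⁻¹).subset fun t ht => ?_
  by_contra hcon
  have hpf : ∀ u, p (f (s u)) = u := fun u => by
    have h1 : f.rangeRestrict (s u) = u := LinearMap.congr_fun hs u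
    have h2 : f (s u) = (LinearMap.range f).subtype u := congrArg Subtype.val h1
    rw [h2]
    exact LinearMap.congr_fun hp u
  have hinj : Function.Injective (p ∘ₗ (f + t • g) ∘ₗ s) := by
    rw [injective_iff_map_eq_zero]
    intro u hu
    by_contra hu0
    have h1 : u + t • G u = 0 := by
      have : p ((f + t • g) (s u)) = u + t • G u := by
        simp [hpf, G]
      rw [← this]
      exact hu
    have ht0 : t ≠ 0 := by
      rintro rfl
      simp at h1
      exact hu0 h1
    refine hcon ⟨-t⁻¹, ?_, by simp⟩
    refine Module.End.hasEigenvalue_of_hasEigenvector (x := u) ⟨?_, hu0⟩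
    rw [Module.End.mem_eigenspace_iff]
    have h2 : t • G u = -u := by rw [eq_neg_iff_add_eq_zero, add_comm]; exact h1
    rw [neg_smul, ← smul_neg, ← h2, smul_smul, inv_mul_cancel₀ ht0, one_smul]
  have h1 : Module.finrank K (LinearMap.range f) ≤
      Module.finrank K (LinearMap.range (f + t • g)) := by
    have h2 := LinearMap.finrank_range_of_inj hinj
    rw [← h2, LinearMap.range_comp]
    exact (Submodule.finrank_map_le _ _).trans
      (Submodule.finrank_mono (LinearMap.range_comp_le_range _ _))
  have h3 := f.finrank_range_add_finrank_ker
  have h4 := (f + t • g).finrank_range_add_finrank_ker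
  have ht' : Module.finrank K (LinearMap.ker f) <
      Module.finrank K (LinearMap.ker (f + t • g)) := ht
  omega

end Radical

/-! ### The index of an incidence algebra -/

section RelIndex

variable {K : Type*} [Field K] {ι : Type*}

/-- The matrices supported on a relation. -/
def suppMat (K : Type*) [Field K] {ι : Type*} (R : ι → ι → Prop) :
    Submodule K (Matrix ι ι K) where
  carrier := {x | ∀ i j, x i j ≠ 0 → R i j}
  zero_mem' := fun i j h => absurd rfl h
  add_mem' := by
    intro a b ha hb i j h
    by_cases h0 : a i j = 0
    · exact hb i j fun h1 => h (by simp [h0, h1])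
    · exact ha i j h0
  smul_mem' := fun r a ha i j h => ha i j fun h0 => h (by simp [h0])

theorem suppMat_apply_eq_zero {R : ι → ι → Prop} {x : Matrix ι ι K} (hx : x ∈ suppMat K R)
    {i j : ι} (h : ¬ R i j) : x i j = 0 := by
  by_contra h0
  exact h (hx i j h0)

theorem suppMat_mono {R S : ι → ι → Prop} (h : ∀ i j, R i j → S i j) :
    suppMat K R ≤ suppMat K S := fun _ hx i j h0 => h i j (hx i j h0)

theorem single_mem_suppMat [DecidableEq ι] {R : ι → ι → Prop} {i j : ι} (h : R i j) (c : K) :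
    Matrix.single i j c ∈ suppMat K R := by
  intro p q hpq
  rw [Matrix.single_apply] at hpq
  by_cases hh : i = p ∧ j = q
  · rwa [← hh.1, ← hh.2]
  · simp [hh] at hpq

variable [Fintype ι]

theorem mul_mem_suppMat {R S T : ι → ι → Prop} (h : ∀ i j k, R i j → S j k → T i k)
    {x y : Matrix ι ι K} (hx : x ∈ suppMat K R) (hy : y ∈ suppMat K S) :
    x * y ∈ suppMat K T := by
  intro i k hik
  rw [Matrix.mul_apply] at hik
  obtain ⟨j, -, hj⟩ := Finset.exists_ne_zero_of_sum_ne_zero hik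
  exact h i j k (hx i j (left_ne_zero_of_mul hj)) (hy j k (right_ne_zero_of_mul hj))

theorem mul_eq_zero_of_suppMat {R S : ι → ι → Prop} (h : ∀ i j k, R i j → ¬ S j k)
    {x y : Matrix ι ι K} (hx : x ∈ suppMat K R) (hy : y ∈ suppMat K S) : x * y = 0 := by
  have h1 : x * y ∈ suppMat K fun _ _ : ι => False :=
    mul_mem_suppMat (fun i j k hij hjk => h i j k hij hjk) hx hy
  ext i k
  exact suppMat_apply_eq_zero h1 id

theorem suppMat_eq_sum [DecidableEq ι] (x : Matrix ι ι K) :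
    x = ∑ i, ∑ j, x i j • Matrix.single i j (1 : K) := by
  conv_lhs => rw [Matrix.matrix_eq_sum_single x]
  simp [Matrix.smul_single]

/-- Linear maps agreeing on the matrix units of a relation agree on the matrices it supports. -/
theorem eqOn_suppMat [DecidableEq ι] {N : Type*} [AddCommGroup N] [Module K N]
    {R : ι → ι → Prop} {f g : Matrix ι ι K →ₗ[K] N}
    (h : ∀ i j, R i j → f (Matrix.single i j 1) = g (Matrix.single i j 1))
    {x : Matrix ι ι K} (hx : x ∈ suppMat K R) : f x = g x := by
  rw [suppMat_eq_sum x]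
  simp only [map_sum, map_smul]
  refine Finset.sum_congr rfl fun i _ => Finset.sum_congr rfl fun j _ => ?_
  by_cases hij : R i j
  · rw [h i j hij]
  · rw [suppMat_apply_eq_zero hx hij, zero_smul, zero_smul]

/-- The form `(x, y) ↦ f (x y - y x)`. -/
def commForm (f : Matrix ι ι K →ₗ[K] K) : Matrix ι ι K →ₗ[K] Matrix ι ι K →ₗ[K] K :=
  (LinearMap.mul K (Matrix ι ι K) - (LinearMap.mul K (Matrix ι ι K)).flip).compr₂ f

@[simp] theorem commForm_apply (f : Matrix ι ι K →ₗ[K] K) (x y : Matrix ι ι K) :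
    commForm f x y = f (x * y - y * x) := rfl

theorem commForm_skew (f : Matrix ι ι K →ₗ[K] K) (x y : Matrix ι ι K) :
    commForm f x y = -commForm f y x := by
  simp

/-- The stabilizer of a linear form in the algebra of matrices supported on a relation. -/
def relStab (R : ι → ι → Prop) (f : Matrix ι ι K →ₗ[K] K) : Submodule K (Matrix ι ι K) :=
  radicalOn (suppMat K R) (commForm f)

theorem mem_relStab {R : ι → ι → Prop} {f : Matrix ι ι K →ₗ[K] K} {x : Matrix ι ι K} :
    x ∈ relStab R f ↔ x ∈ suppMat K R ∧ ∀ y ∈ suppMat K R, f (x * y - y * x) = 0 := Iff.rfl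

/-- The index of the algebra of matrices supported on a relation. -/
noncomputable def relIndex (K : Type*) [Field K] {ι : Type*} [Fintype ι]
    (R : ι → ι → Prop) : ℕ :=
  sInf (Set.range fun f : Matrix ι ι K →ₗ[K] K => Module.finrank K (relStab R f))

theorem relIndex_le (R : ι → ι → Prop) (f : Matrix ι ι K →ₗ[K] K) :
    relIndex K R ≤ Module.finrank K (relStab R f) := Nat.sInf_le ⟨f, rfl⟩

theorem exists_finrank_relStab_eq (K : Type*) [Field K] {ι : Type*} [Fintype ι]
    (R : ι → ι → Prop) :
    ∃ f : Matrix ι ι K →ₗ[K] K, Module.finrank K (relStab R f) = relIndex K R :=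
  Nat.sInf_mem (s := Set.range fun f : Matrix ι ι K →ₗ[K] K => Module.finrank K (relStab R f))
    ⟨_, 0, rfl⟩

theorem le_relIndex {R : ι → ι → Prop} {c : ℕ}
    (h : ∀ f : Matrix ι ι K →ₗ[K] K, c ≤ Module.finrank K (relStab R f)) : c ≤ relIndex K R := by
  obtain ⟨f, hf⟩ := exists_finrank_relStab_eq K R
  exact hf ▸ h f

theorem finite_setOf_finrank_relStab_lt (R : ι → ι → Prop) (f g : Matrix ι ι K →ₗ[K] K) :
    {t : K | Module.finrank K (relStab R f) <
      Module.finrank K (relStab R (f + t • g))}.Finite := by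
  let β : (Matrix ι ι K →ₗ[K] K) → (suppMat K R →ₗ[K] Module.Dual K (suppMat K R)) :=
    fun f => (commForm f).domRestrict₁₂ (suppMat K R) (suppMat K R)
  have key : ∀ f, Module.finrank K (LinearMap.ker (β f)) = Module.finrank K (relStab R f) := by
    intro f
    have : (LinearMap.ker (β f)).map (suppMat K R).subtype = relStab R f := by
      ext x
      constructor
      · rintro ⟨⟨x, hx⟩, hk, rfl⟩
        exact ⟨hx, fun y hy => LinearMap.congr_fun (LinearMap.mem_ker.1 hk) ⟨y, hy⟩⟩
      · rintro ⟨hx, hk⟩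
        refine ⟨⟨x, hx⟩, LinearMap.mem_ker.2 (LinearMap.ext fun y => hk y y.2), rfl⟩
    rw [← this]
    exact (Submodule.finrank_map_subtype_eq _ _).symm
  have h := finite_setOf_finrank_ker_lt (β f) (β g)
  refine h.subset fun t ht => ?_
  have hadd : β f + t • β g = β (f + t • g) := by
    refine LinearMap.ext fun x => LinearMap.ext fun y => ?_
    simp only [β, LinearMap.add_apply, LinearMap.smul_apply, LinearMap.domRestrict₁₂_apply,
      commForm_apply]
  change Module.finrank K _ < Module.finrank K _
  rw [hadd, key, key]
  exact ht

theorem relStab_smul (R : ι → ι → Prop) (f : Matrix ι ι K →ₗ[K] K) {s : K} (hs : s ≠ 0) :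
    relStab R (s • f) = relStab R f := by
  ext x
  simp [mem_relStab, hs]

/-- Conjugation by an invertible element of the algebra does not enlarge stabilizers. -/
theorem finrank_relStab_conj_le [DecidableEq ι] {R : ι → ι → Prop}
    (htrans : ∀ i j k, R i j → R j k → R i k)
    {c c' : Matrix ι ι K} (hc : c ∈ suppMat K R) (hc' : c' ∈ suppMat K R) (h1 : c' * c = 1)
    (f f' : Matrix ι ι K →ₗ[K] K) (hf' : ∀ x, f' x = f (c * x * c')) :
    Module.finrank K (relStab R f') ≤ Module.finrank K (relStab R f) := by
  have h2 : c * c' = 1 := mul_eq_one_comm.1 h1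
  have hm : ∀ {x y : Matrix ι ι K}, x ∈ suppMat K R → y ∈ suppMat K R → x * y ∈ suppMat K R :=
    fun hx hy => mul_mem_suppMat htrans hx hy
  let φ : Matrix ι ι K →ₗ[K] Matrix ι ι K := LinearMap.mulRight K c ∘ₗ LinearMap.mulLeft K c'
  refine (Submodule.finrank_mono ?_).trans (Submodule.finrank_map_le φ (relStab R f))
  intro x hx
  refine ⟨c * x * c', ⟨hm (hm hc hx.1) hc', fun y hy => ?_⟩, ?_⟩
  · have := hx.2 (c' * y * c) (hm (hm hc' hy) hc)
    rw [commForm_apply, hf'] at this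
    rw [commForm_apply, ← this]
    congr 1
    simp only [mul_sub, sub_mul]
    congr 1
    · calc c * x * c' * y = c * x * c' * y * (c * c') := by rw [h2, mul_one]
        _ = _ := by simp only [mul_assoc]
    · calc y * (c * x * c') = (c * c') * y * (c * x * c') := by rw [h2, one_mul]
        _ = _ := by simp only [mul_assoc]
  · change c' * (c * x * c') * c = x
    calc c' * (c * x * c') * c = (c' * c) * x * (c' * c) := by simp only [mul_assoc]
      _ = x := by rw [h1, one_mul, mul_one]

end RelIndex

/-! ### Contraction of a matching -/

section Contraction

variable {K : Type*} [Field K] {ι : Type*}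

/-- `A` and `B` are sets of points of a preorder `R` with `A` a class all of whose points lie below
`B`, such that the matrices supported on `B × A` form an ideal; `τ` and `ρ` are mutually inverse
matchings of a subset of `A` with a subset of `B`, one of them exhausting its side. -/
structure IsArcMatching (R : ι → ι → Prop) (A B : ι → Prop) (τ ρ : ι → ι) : Prop where
  refl : ∀ i, R i i
  trans : ∀ i j k, R i j → R j k → R i k
  disj : ∀ i, A i → ¬ B i
  relAA : ∀ i j, A i → A j → R i j
  relBA : ∀ i j, B i → A j → R i j
  colA : ∀ i j, R i j → A j → A i ∨ B i
  colB : ∀ i j, R i j → B j → B i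
  rowA : ∀ i j, R i j → A i → A j
  memA : ∀ i, τ i ≠ i → A i
  memB : ∀ i, ρ i ≠ i → B i
  left_inv : ∀ i, τ i ≠ i → ρ (τ i) = i
  right_inv : ∀ i, ρ i ≠ i → τ (ρ i) = i
  relQS : ∀ i j, ρ i ≠ i → B j → ρ j = j → R i j
  full : (∀ i, A i → τ i ≠ i) ∨ (∀ j, B j → ρ j ≠ j)

theorem IsArcMatching.of_tau_ne {R : ι → ι → Prop} {A B : ι → Prop} {τ ρ : ι → ι}
    (h : IsArcMatching R A B τ ρ) {i : ι} (hi : τ i ≠ i) :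
    A i ∧ ¬ B i ∧ B (τ i) ∧ ¬ A (τ i) ∧ ρ (τ i) = i ∧ τ (τ i) = τ i ∧ ρ i = i := by
  have h1 := h.memA i hi
  have h2 := h.disj i h1
  have h3 := h.left_inv i hi
  have h4 : B (τ i) := h.memB (τ i) (by rw [h3]; exact Ne.symm hi)
  have h5 : ¬ A (τ i) := fun h5 => h.disj _ h5 h4
  exact ⟨h1, h2, h4, h5, h3, not_imp_comm.1 (h.memA _) h5, not_imp_comm.1 (h.memB _) h2⟩

theorem IsArcMatching.of_rho_ne {R : ι → ι → Prop} {A B : ι → Prop} {τ ρ : ι → ι}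
    (h : IsArcMatching R A B τ ρ) {i : ι} (hi : ρ i ≠ i) :
    B i ∧ ¬ A i ∧ A (ρ i) ∧ ¬ B (ρ i) ∧ τ (ρ i) = i ∧ ρ (ρ i) = ρ i ∧ τ i = i := by
  have h1 := h.memB i hi
  have h2 : ¬ A i := fun h2 => h.disj i h2 h1
  have h3 := h.right_inv i hi
  have h4 : A (ρ i) := h.memA (ρ i) (by rw [h3]; exact Ne.symm hi)
  have h5 := h.disj _ h4
  exact ⟨h1, h2, h4, h5, h3, not_imp_comm.1 (h.memB _) h5, not_imp_comm.1 (h.memA _) h2⟩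

/-- The relation left after the matched points of `A` have been removed. -/
def contractRel (R : ι → ι → Prop) (B : ι → Prop) (τ ρ : ι → ι) (i j : ι) : Prop :=
  R i j ∧ τ i = i ∧ τ j = j ∧ ¬ (ρ i ≠ i ∧ B j ∧ ρ j = j)

open Classical in
/-- Copies the matched points of `B` back onto `A`. -/
noncomputable def unfoldMat (K : Type*) [Field K] {ι : Type*} (A : ι → Prop) (τ : ι → ι) :
    Matrix ι ι K →ₗ[K] Matrix ι ι K where
  toFun w := Matrix.of fun i k => if A i ↔ A k then w (τ i) (τ k) else 0
  map_add' x y := by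
    ext i k
    by_cases h : A i ↔ A k <;> simp [h]
  map_smul' c x := by
    ext i k
    by_cases h : A i ↔ A k <;> simp [h]

open Classical in
theorem unfoldMat_apply (A : ι → Prop) (τ : ι → ι) (w : Matrix ι ι K) (i k : ι) :
    unfoldMat K A τ w i k = if A i ↔ A k then w (τ i) (τ k) else 0 := rfl

open Classical in
/-- A left inverse of `unfoldMat` that vanishes on the matrices supported on `B × A`. -/
noncomputable def foldMat (K : Type*) [Field K] {ι : Type*} (A : ι → Prop) (τ ρ : ι → ι) :
    Matrix ι ι K →ₗ[K] Matrix ι ι K where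
  toFun x := Matrix.of fun i k =>
    if τ i = i ∧ τ k = k ∧ (A k → A (ρ i)) then (if A k then x (ρ i) k else x i k) else 0
  map_add' x y := by
    ext i k
    simp only [Matrix.of_apply, Matrix.add_apply]
    split_ifs <;> simp
  map_smul' c x := by
    ext i k
    simp only [Matrix.of_apply, Matrix.smul_apply]
    split_ifs <;> simp

open Classical in
theorem foldMat_apply (A : ι → Prop) (τ ρ : ι → ι) (x : Matrix ι ι K) (i k : ι) :
    foldMat K A τ ρ x i k =
      if τ i = i ∧ τ k = k ∧ (A k → A (ρ i)) then (if A k then x (ρ i) k else x i k) else 0 :=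
  rfl

variable {R : ι → ι → Prop} {A B : ι → Prop} {τ ρ : ι → ι}

/-- The dropped pairs go from matched to unmatched nodes of `B`. A composite of this kind would have
its middle node in `B` too (`colB`), and one of its two factors would already be dropped. -/
theorem IsArcMatching.contractRel_trans (h : IsArcMatching R A B τ ρ) (i j k : ι)
    (h1 : contractRel R B τ ρ i j) (h2 : contractRel R B τ ρ j k) :
    contractRel R B τ ρ i k := by
  obtain ⟨a1, a2, a3, a4⟩ := h1
  obtain ⟨b1, b2, b3, b4⟩ := h2
  refine ⟨h.trans _ _ _ a1 b1, a2, b3, ?_⟩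
  have := h.colB j k b1
  grind +splitImp

theorem IsArcMatching.unfoldMat_mem (h : IsArcMatching R A B τ ρ) {w : Matrix ι ι K}
    (hw : w ∈ suppMat K (contractRel R B τ ρ)) : unfoldMat K A τ w ∈ suppMat K R := by
  intro i k hik
  rw [unfoldMat_apply] at hik
  split_ifs at hik with hA
  · have h1 := (hw _ _ hik).1
    have h2 := h.relAA i k
    have h3 := h.memA i
    have h4 := h.memA k
    grind +splitImp
  · exact absurd rfl hik

theorem IsArcMatching.foldMat_unfoldMat (h : IsArcMatching R A B τ ρ) {w : Matrix ι ι K}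
    (hw : w ∈ suppMat K (contractRel R B τ ρ)) : foldMat K A τ ρ (unfoldMat K A τ w) = w := by
  ext i k
  have hik := hw i k
  have h0 : ¬ contractRel R B τ ρ i k → w i k = 0 := suppMat_apply_eq_zero hw
  rw [foldMat_apply, unfoldMat_apply, unfoldMat_apply]
  unfold contractRel at h0
  have a1 := h.of_tau_ne (i := i)
  have a2 := h.of_tau_ne (i := k)
  have a3 := h.of_rho_ne (i := i)
  have a4 := h.rowA i k
  have a5 := h.colA i k
  have a8 : A k → τ k = k → B i → ρ i ≠ i := by
    have := h.full
    grind +splitImp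
  clear hik
  grind +splitImp

theorem IsArcMatching.foldMat_eq_zero (h : IsArcMatching R A B τ ρ) {z : Matrix ι ι K}
    (hz : z ∈ suppMat K fun i j => B i ∧ A j) : foldMat K A τ ρ z = 0 := by
  ext i k
  rw [foldMat_apply]
  split_ifs with h1 h2
  · exact suppMat_apply_eq_zero hz fun h3 => h.disj _ (h1.2.2 h2) h3.1
  · exact suppMat_apply_eq_zero hz fun h3 => h2 h3.2
  · rfl

variable [Fintype ι]

open Classical in
/-- The linear form that adds up the entries at the arcs of the matching. -/
noncomputable def arcForm (K : Type*) [Field K] {ι : Type*} [Fintype ι] (τ : ι → ι) :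
    Matrix ι ι K →ₗ[K] K :=
  ∑ t, if τ t ≠ t then Matrix.entryLinearMap K K (τ t) t else 0

open Classical in
theorem arcForm_apply (τ : ι → ι) (x : Matrix ι ι K) :
    arcForm K τ x = ∑ t, if τ t ≠ t then x (τ t) t else 0 := by
  rw [arcForm, LinearMap.sum_apply]
  refine Finset.sum_congr rfl fun t _ => ?_
  split_ifs <;> simp

open Classical in
theorem arcForm_mul_single (τ : ι → ι) (x : Matrix ι ι K) (p r : ι) :
    arcForm K τ (x * Matrix.single p r 1) = if τ r ≠ r then x (τ r) p else 0 := by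
  rw [arcForm_apply, Finset.sum_eq_single r]
  · simp
  · intro t _ htr
    simp [Matrix.mul_single_apply_of_ne (hbj := htr)]
  · simp

open Classical in
theorem IsArcMatching.arcForm_single_mul (h : IsArcMatching R A B τ ρ) (x : Matrix ι ι K)
    (p r : ι) :
    arcForm K τ (Matrix.single p r 1 * x) = if ρ p ≠ p then x r (ρ p) else 0 := by
  rw [arcForm_apply, Finset.sum_eq_single (ρ p)]
  · by_cases hp : ρ p = p
    · rw [hp]
      by_cases h1 : τ p = p
      · simp [h1]
      · have h2 : p ≠ τ p := Ne.symm h1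
        simp [Matrix.single_mul_apply_of_ne (h := h2.symm)]
    · have h1 := h.right_inv p hp
      rw [h1, if_pos hp, if_pos (Ne.symm hp)]
      simp
  · intro t _ htr
    by_cases ht : τ t = t
    · simp [ht]
    · have h2 := h.left_inv t ht
      have h3 : τ t ≠ p := by
        rintro rfl
        exact htr h2.symm
      rw [if_pos ht, Matrix.single_mul_apply_of_ne (h := h3)]
  · simp

theorem IsArcMatching.arcForm_unfoldMat (h : IsArcMatching R A B τ ρ) (w : Matrix ι ι K) :
    arcForm K τ (unfoldMat K A τ w) = 0 := by
  classical
  rw [arcForm_apply]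
  refine Finset.sum_eq_zero fun t _ => ?_
  split_ifs with ht
  · rw [unfoldMat_apply, if_neg]
    have h1 := h.memA t ht
    have h2 := h.left_inv t ht
    have h3 := h.memB (τ t) (by grind)
    have h4 := h.disj (τ t)
    tauto
  · rfl

/-- Being multiplicative on the contracted algebra, unfolding identifies that algebra with a
complement of the ideal in its orthogonal, commutators included. -/
theorem IsArcMatching.unfoldMat_mul (h : IsArcMatching R A B τ ρ) {w w' : Matrix ι ι K}
    (hw : w ∈ suppMat K (contractRel R B τ ρ)) (hw' : w' ∈ suppMat K (contractRel R B τ ρ)) :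
    unfoldMat K A τ w * unfoldMat K A τ w' = unfoldMat K A τ (w * w') := by
  classical
  ext i l
  have hg : ∀ k, w (τ i) k * w' k (τ l) ≠ 0 →
      contractRel R B τ ρ (τ i) k ∧ contractRel R B τ ρ k (τ l) := fun k hk =>
    ⟨hw _ _ (left_ne_zero_of_mul hk), hw' _ _ (right_ne_zero_of_mul hk)⟩
  have hmem := h.memA
  rw [Matrix.mul_apply, unfoldMat_apply, Matrix.mul_apply]
  simp only [unfoldMat_apply]
  by_cases hi : A i <;> by_cases hl : A l
  · simp only [hi, hl, true_iff, iff_true, if_true]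
    have e : ∀ k, ((if A k then w (τ i) (τ k) else 0) * if A k then w' (τ k) (τ l) else 0) =
        if A k then w (τ i) (τ k) * w' (τ k) (τ l) else 0 := fun k => by split_ifs <;> simp
    simp only [e]
    rw [← Finset.sum_filter]
    refine Finset.sum_of_injOn τ ?_ (fun _ _ => by simp) ?_ (fun _ _ => rfl)
    · intro k hk k' hk' hkk
      have hk1 : A k := by simpa using hk
      have hk2 : A k' := by simpa using hk'
      have a1 := h.of_tau_ne (i := k)
      have a2 := h.of_tau_ne (i := k')
      clear hg e hmem
      grind +splitImp
    -- On the diagonal block of `A`, the product in the contracted algebra runs over all middle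
    -- nodes, while the unfolded product sees only those of the form `τ k` with `k` in `A`. The
    -- other middle nodes contribute zero, because the pairs from matched to unmatched nodes of `B`
    -- were dropped.
    · intro k _ hk
      by_contra h0
      obtain ⟨⟨b1, b2, b3, b4⟩, ⟨c1, c2, c3, c4⟩⟩ := hg k h0
      have hkA : ¬ A k := fun hkA => hk ⟨k, by simpa using hkA, b3⟩
      have hρ : ρ k = k := by
        by_contra hρ
        have := h.right_inv k hρ
        exact hk ⟨ρ k, by simpa using hmem (ρ k) (by grind), this⟩
      have d1 := h.colA _ _ c1
      have d2 := h.colB _ _ c1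
      have d3 := h.rowA _ _ b1
      have d4 := h.of_tau_ne (i := i)
      have d5 := h.of_tau_ne (i := l)
      clear hg e hmem h0 hk
      grind +splitImp
  · refine (Finset.sum_eq_zero fun k _ => ?_).trans (if_neg (by simp [hi, hl])).symm
    by_cases hk : A k <;> simp [hi, hl, hk]
  · refine (Finset.sum_eq_zero fun k _ => ?_).trans (if_neg (by simp [hi, hl])).symm
    by_cases hk : A k <;> simp [hi, hl, hk]
  · simp only [hi, hl, false_iff, iff_false, if_true]
    refine Finset.sum_congr rfl fun k _ => ?_
    have a1 := h.memA i
    have a2 := h.memA k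
    have a3 := h.memA l
    have hτi : τ i = i := by tauto
    have hτl : τ l = l := by tauto
    by_cases hk : A k
    · simp only [hk, not_true_eq_false, if_false, mul_zero]
      by_contra h0
      have := h.rowA k (τ l) (hg k (Ne.symm h0)).2.1 hk
      grind +splitImp
    · have hτk : τ k = k := by tauto
      simp [hk, hτk]

/-- The orthogonal of the ideal of matrices supported on `B × A`. -/
theorem IsArcMatching.orthogonal_apply [DecidableEq ι] (h : IsArcMatching R A B τ ρ)
    {f : Matrix ι ι K →ₗ[K] K}
    (hf : ∀ z ∈ suppMat K (fun i j => B i ∧ A j), f z = arcForm K τ z)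
    {x : Matrix ι ι K} (hx : x ∈ suppMat K R) {a b : ι} (ha : A a) (hb : B b) :
    f (x * Matrix.single b a 1 - Matrix.single b a 1 * x) =
      (if τ a ≠ a then x (τ a) b else 0) - (if ρ b ≠ b then x a (ρ b) else 0) := by
  have hz : Matrix.single b a (1 : K) ∈ suppMat K (fun i j => B i ∧ A j) :=
    single_mem_suppMat ⟨hb, ha⟩ 1
  rw [map_sub, hf, hf]
  · congr 1
    · convert arcForm_mul_single τ x b a
    · convert h.arcForm_single_mul x b a
  · exact mul_mem_suppMat (fun i j k h1 h2 => ⟨h1.1, h.rowA _ _ h2 h1.2⟩ :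
      ∀ i j k, (B i ∧ A j) → R j k → (B i ∧ A k)) hz hx
  · exact mul_mem_suppMat (fun i j k h1 h2 => ⟨h.colB _ _ h1 h2.1, h2.2⟩ :
      ∀ i j k, R i j → (B j ∧ A k) → (B i ∧ A k)) hx hz

/-- Symplectic reduction by the ideal of matrices supported on `B × A`. Orthogonality to it says
that entries at matched nodes of `B` repeat those at their partners in `A`, and that entries from
matched to unmatched nodes of `B`, and from unmatched to matched nodes of `A`, vanish. Modulo the
ideal these are exactly the unfolded matrices. -/
theorem IsArcMatching.finrank_relStab_eq (h : IsArcMatching R A B τ ρ)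
    {f : Matrix ι ι K →ₗ[K] K}
    (hf : ∀ z ∈ suppMat K (fun i j => B i ∧ A j), f z = arcForm K τ z) :
    Module.finrank K (relStab R f) =
      Module.finrank K (relStab (contractRel R B τ ρ) (f ∘ₗ unfoldMat K A τ)) := by
  classical
  have hle : suppMat K (fun i j => B i ∧ A j) ≤ suppMat K R :=
    suppMat_mono fun i j hij => h.relBA i j hij.1 hij.2
  refine finrank_radicalOn_eq_of_reduction (a := suppMat K fun i j => B i ∧ A j)
    (unfoldMat K A τ) (commForm_skew f) hle ?_ (fun w hw => h.unfoldMat_mem hw) ?_ ?_ ?_ ?_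
  · intro z hz hzy
    have key : ∀ p r, R p r →
        (if τ r ≠ r then z (τ r) p else 0) = if ρ p ≠ p then z r (ρ p) else 0 := by
      intro p r hpr
      have h0 := hzy (Matrix.single p r 1) (single_mem_suppMat hpr 1)
      rw [commForm_apply, map_sub, hf, hf, arcForm_mul_single, h.arcForm_single_mul] at h0
      · convert sub_eq_zero.1 h0
      · exact mul_mem_suppMat (S := fun i j => B i ∧ A j)
          (fun i j k h1 h2 => ⟨h.colB _ _ h1 h2.1, h2.2⟩) (single_mem_suppMat hpr 1) hz
      · exact mul_mem_suppMat (R := fun i j => B i ∧ A j)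
          (fun i j k h1 h2 => ⟨h1.1, h.rowA _ _ h2 h1.2⟩) hz (single_mem_suppMat hpr 1)
    -- Testing against matrix units inside `A × A` kills the rows of `z` at matched nodes of `B`.
    -- The remaining rows are killed by units from matched to unmatched nodes of `B` if all of `A`
    -- is matched, and do not exist if all of `B` is matched.
    have hQ : ∀ q a, ρ q ≠ q → A a → z q a = 0 := by
      intro q a hq ha
      have h1 := h.right_inv q hq
      have h2 := h.memA (ρ q) (by rw [h1]; exact Ne.symm hq)
      have h3 := key a (ρ q) (h.relAA _ _ ha h2)
      have h4 := h.memB a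
      have h5 := h.disj a ha
      grind +splitImp
    ext i k
    by_contra h0
    obtain ⟨hi, hk⟩ := hz i k h0
    have hi' : ρ i = i := by
      by_contra hi'
      exact h0 (hQ i k hi' hk)
    rcases h.full with hA | hB
    · have a1 := hA k hk
      have a2 := h.left_inv k a1
      have h3 := key (τ k) i (h.relQS _ _ (by grind) hi hi')
      have h4 := h.memA i
      have h5 := h.disj i
      simp only [Matrix.zero_apply] at h0
      grind +splitImp
    · exact hB i hi hi'
  · intro w hw z hz
    have : (commForm f (unfoldMat K A τ w)) z = (0 : Matrix ι ι K →ₗ[K] K) z := by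
      refine eqOn_suppMat (fun b a hba => ?_) hz
      rw [commForm_apply, h.orthogonal_apply hf (h.unfoldMat_mem hw) hba.2 hba.1,
        LinearMap.zero_apply, unfoldMat_apply, unfoldMat_apply]
      obtain ⟨hb, ha⟩ := hba
      have h0 : ∀ i k, ¬ contractRel R B τ ρ i k → w i k = 0 := fun i k =>
        suppMat_apply_eq_zero hw
      have h01 := h0 (τ a) b
      unfold contractRel at h01
      have a1 := h.disj a
      have a2 := h.disj b
      have a3 := h.of_tau_ne (i := b)
      have a4 := h.of_tau_ne (i := a)
      have a5 := h.of_rho_ne (i := b)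
      have a6 := h.colB a b
      have h02 := h0 a b
      unfold contractRel at h02
      clear h0 hf hle
      grind +splitImp
    exact this
  · intro x hx hxz
    have key : ∀ a b, A a → B b →
        (if τ a ≠ a then x (τ a) b else 0) = if ρ b ≠ b then x a (ρ b) else 0 := by
      intro a b ha hb
      have h0 := hxz (Matrix.single b a 1) (single_mem_suppMat ⟨hb, ha⟩ 1)
      rw [commForm_apply, h.orthogonal_apply hf hx ha hb] at h0
      exact sub_eq_zero.1 h0
    -- The preimage of `x` modulo the ideal. A column at an unmatched node of `A` has to be read at
    -- the partner `ρ i` of the row, since unfolding moved the matched rows of `A` to `B`.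
    let w : Matrix ι ι K := Matrix.of fun i k =>
      if contractRel R B τ ρ i k then (if A k then x (ρ i) k else x i k) else 0
    have hw : ∀ i k, w i k =
      if contractRel R B τ ρ i k then (if A k then x (ρ i) k else x i k) else 0 :=
      fun i k => rfl
    refine ⟨w, fun i k hik => ?_, fun i k hik => ?_⟩
    · rw [hw] at hik
      by_contra hn
      simp [hn] at hik
    · have hx0 : ∀ i k, ¬ R i k → x i k = 0 := fun i k => suppMat_apply_eq_zero hx
      rw [Matrix.sub_apply, unfoldMat_apply, hw] at hik
      by_contra hn
      apply hik
      unfold contractRel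
      have a1 := h.disj i
      have a2 := h.disj k
      by_cases hi : A i <;> by_cases hk : A k
      · have b1 := key i (τ k) hi
        have b2 := hx0 (τ i) (τ k)
        have b3 := h.of_tau_ne (i := i)
        have b4 := h.of_tau_ne (i := k)
        have b5 := h.of_rho_ne (i := i)
        clear hx0 key hxz hf hle hw
        have b12 := h.relAA i k
        have b13 := h.relBA (τ i) k
        have b14 := h.colB i (τ k)
        grind +splitImp
      · have b1 := hx0 i k
        have b2 := h.rowA i k
        grind +splitImp
      · have b1 := hx0 i k
        have b2 := h.colA i k
        grind +splitImp
      · have b1 := hx0 i k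
        have b3 := h.of_tau_ne (i := i)
        have b4 := h.of_tau_ne (i := k)
        have b5 := h.of_rho_ne (i := i)
        have b6 := key (ρ i) k
        clear hx0 key hxz hf hle hw
        grind +splitImp
  · intro w hw hwa
    rw [← h.foldMat_unfoldMat hw, h.foldMat_eq_zero hwa]
  · intro w hw w' hw'
    rw [commForm_apply, commForm_apply, h.unfoldMat_mul hw hw', h.unfoldMat_mul hw' hw,
      LinearMap.comp_apply, map_sub (unfoldMat K A τ)]

theorem relStab_congr {S : ι → ι → Prop} (htrans : ∀ i j k, S i j → S j k → S i k)
    {f g : Matrix ι ι K →ₗ[K] K} (hfg : ∀ x ∈ suppMat K S, f x = g x) :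
    relStab S f = relStab S g := by
  ext x
  refine and_congr_right fun hx => forall₂_congr fun y hy => ?_
  rw [commForm_apply, commForm_apply, hfg]
  exact Submodule.sub_mem _ (mul_mem_suppMat htrans hx hy) (mul_mem_suppMat htrans hy hx)

/-- An optimal form `f'` on the contracted algebra lifts to `arcForm + f' ∘ foldMat`. The lift
agrees with `arcForm` on the ideal and restricts to `f'` along unfolding, so this inequality needs
no genericity. -/
theorem IsArcMatching.relIndex_le (h : IsArcMatching R A B τ ρ) :
    relIndex K R ≤ relIndex K (contractRel R B τ ρ) := by
  obtain ⟨f', hf'⟩ := exists_finrank_relStab_eq K (contractRel R B τ ρ)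
  rw [← hf']
  refine (_root_.relIndex_le R (arcForm K τ + f' ∘ₗ foldMat K A τ ρ)).trans (le_of_eq ?_)
  rw [h.finrank_relStab_eq]
  · rw [relStab_congr h.contractRel_trans]
    intro w hw
    simp [h.foldMat_unfoldMat hw, h.arcForm_unfoldMat]
  · intro z hz
    simp [h.foldMat_eq_zero hz]

end Contraction

/-! ### Normal form of a generic linear form on the ideal of a matching -/

section Contraction

variable {K : Type*} [Field K] {ι : Type*}
variable {R : ι → ι → Prop} {A B : ι → Prop} {τ ρ : ι → ι}

open Classical in
/-- The matrix of `arcForm`. -/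
noncomputable def arcMat (K : Type*) [Field K] {ι : Type*} (τ : ι → ι) : Matrix ι ι K :=
  Matrix.of fun i j => if τ i ≠ i ∧ τ i = j then 1 else 0

theorem arcMat_mem (h : IsArcMatching R A B τ ρ) :
    arcMat K τ ∈ suppMat K (fun i j => A i ∧ B j) := by
  classical
  intro i j hij
  simp only [arcMat, Matrix.of_apply, ne_eq, ite_eq_right_iff, one_ne_zero, imp_false,
    not_not] at hij
  obtain ⟨h1, rfl⟩ := hij
  have := h.of_tau_ne h1
  tauto

theorem one_mem_suppMat [DecidableEq ι] (hR : ∀ i, R i i) : (1 : Matrix ι ι K) ∈ suppMat K R := by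
  intro i j hij
  rw [Matrix.one_apply] at hij
  by_cases h : i = j
  · exact h ▸ hR i
  · simp [h] at hij

variable [Fintype ι]

/-- The matrix of a linear form on the matrices supported on `B × A`. -/
theorem exists_trace_eq (f : Matrix ι ι K →ₗ[K] K) (A B : ι → Prop) :
    ∃ F ∈ suppMat K (fun i j => A i ∧ B j), ∀ z ∈ suppMat K (fun i j => B i ∧ A j),
      f z = (F * z).trace := by
  classical
  refine ⟨Matrix.of fun i j => if A i ∧ B j then f (Matrix.single j i 1) else 0,
    fun i j h => ?_, fun z hz => ?_⟩
  · by_contra hn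
    exact h (if_neg hn)
  · conv_lhs => rw [suppMat_eq_sum z]
    simp only [map_sum, map_smul, Matrix.trace, Matrix.diag_apply, Matrix.mul_apply]
    rw [Finset.sum_comm]
    refine Finset.sum_congr rfl fun i _ => Finset.sum_congr rfl fun j _ => ?_
    by_cases h : B j ∧ A i
    · rw [Matrix.of_apply, if_pos h.symm, smul_eq_mul, mul_comm]
    · rw [suppMat_apply_eq_zero hz h, zero_smul, mul_zero]

theorem arcForm_eq_trace (x : Matrix ι ι K) :
    arcForm K τ x = (arcMat K τ * x).trace := by
  classical
  rw [arcForm_apply, Matrix.trace]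
  refine Finset.sum_congr rfl fun i _ => ?_
  rw [Matrix.diag_apply, Matrix.mul_apply]
  by_cases h : τ i = i <;> simp [arcMat, h]

open Classical in
theorem mul_arcMat_transpose_mul_arcMat (h : IsArcMatching R A B τ ρ) (F : Matrix ι ι K) (i j : ι) :
    (F * ((arcMat K τ).transpose * arcMat K τ)) i j = if ρ j ≠ j then F i j else 0 := by
  have hp : ∀ k, ((arcMat K τ).transpose * arcMat K τ) k j =
      if k = j then (if ρ j ≠ j then 1 else 0) else 0 := by
    intro k
    rw [Matrix.mul_apply, Finset.sum_eq_single (ρ j)]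
    · have h1 := h.of_rho_ne (i := j)
      have h2 := h.of_tau_ne (i := j)
      simp only [arcMat, Matrix.transpose_apply, Matrix.of_apply]
      grind +splitImp
    · intro t _ ht
      have h1 := h.of_tau_ne (i := t)
      simp only [arcMat, Matrix.transpose_apply, Matrix.of_apply]
      grind +splitImp
    · simp
  rw [Matrix.mul_apply]
  simp only [hp]
  simp

open Classical in
theorem arcMat_mul_arcMat_transpose_mul (h : IsArcMatching R A B τ ρ) (F : Matrix ι ι K)
    (i j : ι) :
    (arcMat K τ * (arcMat K τ).transpose * F) i j = if τ i ≠ i then F i j else 0 := by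
  have hp : ∀ k, (arcMat K τ * (arcMat K τ).transpose) i k =
      if i = k then (if τ i ≠ i then 1 else 0) else 0 := by
    intro k
    rw [Matrix.mul_apply, Finset.sum_eq_single (τ i)]
    · have h1 := h.of_tau_ne (i := i)
      have h2 := h.of_tau_ne (i := k)
      simp only [arcMat, Matrix.transpose_apply, Matrix.of_apply]
      grind +splitImp
    · intro t _ ht
      simp only [arcMat, Matrix.transpose_apply, Matrix.of_apply]
      grind +splitImp
    · simp
  rw [Matrix.mul_apply]
  simp only [hp]
  simp

variable [DecidableEq ι]

/-- The inverse of a matrix that differs from the identity only on `A × A` has the same shape. -/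
theorem suppMat_of_mul_eq_one {N u' : Matrix ι ι K}
    (hN : N ∈ suppMat K fun i j => A i ∧ A j) (h : u' * (1 + N) = 1) :
    u' - 1 ∈ suppMat K fun i j => A i ∧ A j := by
  have h' : (1 + N) * u' = 1 := mul_eq_one_comm.1 h
  have e1 : u' - 1 = -(N * u') := by
    rw [add_mul, one_mul] at h'
    rw [← h']
    abel
  have e2 : u' - 1 = -(u' * N) := by
    rw [mul_add, mul_one] at h
    rw [← h]
    abel
  have htop : u' ∈ suppMat K fun _ _ : ι => True := fun _ _ _ => trivial
  have m1 : N * u' ∈ suppMat K fun i _ => A i :=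
    mul_mem_suppMat (fun i j k h1 _ => h1.1) hN htop
  have m2 : u' * N ∈ suppMat K fun _ j => A j :=
    mul_mem_suppMat (fun i j k _ h1 => h1.2) htop hN
  rw [← Submodule.neg_mem_iff] at m1 m2
  rw [← e1] at m1
  rw [← e2] at m2
  exact fun i j hij => ⟨m1 i j hij, m2 i j hij⟩

omit [DecidableEq ι] in
/-- A linear form that differs from `arcForm` on the matrices supported on `B × A` only outside
the matched points of `B` is conjugate to one that agrees with `arcForm` there. -/
theorem IsArcMatching.relIndex_contractRel_le_of_eq_add (h : IsArcMatching R A B τ ρ)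
    (f : Matrix ι ι K →ₗ[K] K) {G : Matrix ι ι K}
    (hG : G ∈ suppMat K fun i j => A i ∧ B j ∧ ρ j = j)
    (hf : ∀ z ∈ suppMat K (fun i j => B i ∧ A j), f z = ((arcMat K τ + G) * z).trace) :
    relIndex K (contractRel R B τ ρ) ≤ Module.finrank K (relStab R f) := by
  classical
  set F₀ := arcMat K τ with hF₀
  have hF₀m : F₀ ∈ suppMat K (fun i j => A i ∧ B j) := arcMat_mem h
  have hEm : F₀.transpose ∈ suppMat K (fun i j => ρ i ≠ i ∧ A j) := by
    intro i j hij
    rw [Matrix.transpose_apply] at hij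
    refine ⟨?_, (hF₀m j i hij).1⟩
    simp only [hF₀, arcMat, Matrix.of_apply, ne_eq, ite_eq_right_iff, one_ne_zero, imp_false,
      not_not] at hij
    obtain ⟨h1, rfl⟩ := hij
    have := h.of_tau_ne h1
    grind
  -- A square-zero element of the algebra with `F₀ * n = G`: conjugation by `1 - n` removes `G`.
  set n := F₀.transpose * G with hn
  have hnm : n ∈ suppMat K (fun i j => ρ i ≠ i ∧ (B j ∧ ρ j = j)) :=
    mul_mem_suppMat (fun i j k h1 h2 => ⟨h1.1, h2.2⟩) hEm hG
  have hnn : n * n = 0 := mul_eq_zero_of_suppMat (fun i j k h1 h2 => h2.1 h1.2.2) hnm hnm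
  have hnR : n ∈ suppMat K R := fun i j hij => by
    obtain ⟨h1, h2, h3⟩ := hnm i j hij
    exact h.relQS i j h1 h2 h3
  have hone := one_mem_suppMat (K := K) h.refl
  -- `F₀ * F₀.transpose` projects onto the matched rows. Either all of `A` is matched, or all of `B`
  -- is and then `G = 0`.
  have hF₀n : F₀ * n = G := by
    rw [hn, ← mul_assoc]
    ext i j
    rw [hF₀, arcMat_mul_arcMat_transpose_mul h]
    by_cases hij : G i j = 0
    · simp [hij]
    · rw [if_pos]
      obtain ⟨h1, h2, h3⟩ := hG i j hij
      rcases h.full with h4 | h4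
      · exact h4 i h1
      · exact absurd h3 (h4 j h2)
  have hGn : G * n = 0 := mul_eq_zero_of_suppMat (fun i j k h1 h2 => h2.1 h1.2.2) hG hnm
  let f' : Matrix ι ι K →ₗ[K] K :=
    f ∘ₗ LinearMap.mulRight K (1 + n) ∘ₗ LinearMap.mulLeft K (1 - n)
  have hf' : ∀ x, f' x = f ((1 - n) * x * (1 + n)) := fun x => rfl
  have hinv : (1 + n) * (1 - n) = 1 := by
    rw [mul_sub, add_mul, add_mul, hnn]
    simp
  refine le_trans ?_ (finrank_relStab_conj_le h.trans (Submodule.sub_mem _ hone hnR)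
    (Submodule.add_mem _ hone hnR) hinv f f' hf')
  rw [h.finrank_relStab_eq]
  · exact _root_.relIndex_le _ _
  · intro z hz
    have hzn : z * n = 0 := mul_eq_zero_of_suppMat
      (fun i j k h1 h2 => h.disj j h1.2 (h.memB j h2.1)) hz hnm
    have hnz : n * z ∈ suppMat K (fun i j => B i ∧ A j) :=
      mul_mem_suppMat (fun i j k h1 h2 => ⟨h.memB i h1.1, h2.2⟩) hnm hz
    have e1 : (1 - n) * z * (1 + n) = z - n * z := by
      rw [mul_add, mul_one, sub_mul, sub_mul, one_mul, mul_assoc n z n, hzn, mul_zero, sub_zero,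
        add_zero]
    have e2 : (F₀ + G) * (z - n * z) = F₀ * z := by
      rw [mul_sub, ← mul_assoc, add_mul F₀ G n, hF₀n, hGn, add_zero, add_mul, add_sub_cancel_right]
    rw [hf', e1, hf _ (Submodule.sub_mem _ hz hnz), e2, arcForm_eq_trace]

-- For the lower bound, an arbitrary `f` is perturbed to `f + t • arcForm` without enlarging its
-- stabilizer and then brought into normal form on the ideal by two conjugations. The first, inside
-- `A × A`, normalizes the matched columns; the second is the unipotent one of
-- `relIndex_contractRel_le_of_eq_add`. An infinite field is needed to avoid the finitely many bad
-- values of `t`.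
omit [DecidableEq ι] in
theorem IsArcMatching.relIndex_eq [Infinite K] (h : IsArcMatching R A B τ ρ) :
    relIndex K R = relIndex K (contractRel R B τ ρ) := by
  classical
  refine le_antisymm h.relIndex_le (le_relIndex fun f => ?_)
  obtain ⟨F, hFm, hF⟩ := exists_trace_eq f A B
  set F₀ := arcMat K τ with hF₀
  have hF₀m : F₀ ∈ suppMat K (fun i j => A i ∧ B j) := arcMat_mem h
  have hEm : F₀.transpose ∈ suppMat K (fun i j => B i ∧ A j) := fun i j hij =>
    (hF₀m j i hij).symm
  set N := F * F₀.transpose with hN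
  have hNm : N ∈ suppMat K (fun i j => A i ∧ A j) :=
    mul_mem_suppMat (fun i j k h1 h2 => ⟨h1.1, h2.2⟩) hFm hEm
  have hfin1 := finite_setOf_finrank_relStab_lt R f (arcForm K τ)
  have hfin2 : {t : K | (-N).charpoly.IsRoot t}.Finite :=
    Polynomial.finite_setOfPred_isRoot (Matrix.charpoly_monic _).ne_zero
  obtain ⟨t, ht⟩ := ((hfin1.union hfin2).union (Set.finite_singleton 0)).infinite_compl.nonempty
  simp only [Set.mem_compl_iff, Set.mem_union, not_or] at ht
  obtain ⟨⟨ht1, ht2⟩, ht0⟩ := ht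
  have ht0 : t ≠ 0 := ht0
  have ht1 : Module.finrank K (relStab R (f + t • arcForm K τ)) ≤
      Module.finrank K (relStab R f) := not_lt.1 ht1
  refine le_trans ?_ ht1
  rw [← relStab_smul R _ (inv_ne_zero ht0)]
  -- Up to the factor `t ^ card ι`, this determinant is the characteristic polynomial of `-N` at
  -- `t`, and the roots of that polynomial were excluded.
  have hdet : IsUnit (1 + t⁻¹ • N).det := by
    have h1 : ¬ (-N).charpoly.eval t = 0 := ht2
    rw [Matrix.eval_charpoly] at h1
    have h2 : Matrix.scalar ι t - -N = t • (1 + t⁻¹ • N) := by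
      rw [smul_add, smul_smul, mul_inv_cancel₀ ht0, one_smul, sub_neg_eq_add,
        Matrix.smul_one_eq_diagonal]
      rfl
    rw [h2, Matrix.det_smul] at h1
    exact isUnit_iff_ne_zero.2 (right_ne_zero_of_mul h1)
  set s := t⁻¹ with hs
  obtain ⟨u', hu'⟩ : ∃ u' : Matrix ι ι K, u' * (1 + s • N) = 1 :=
    ⟨_, Matrix.nonsing_inv_mul _ hdet⟩
  have hsN : s • N ∈ suppMat K (fun i j => A i ∧ A j) := Submodule.smul_mem _ _ hNm
  have hu'm := suppMat_of_mul_eq_one hsN hu'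
  have hone := one_mem_suppMat (K := K) h.refl
  have hAR : suppMat K (fun i j => A i ∧ A j) ≤ suppMat K R :=
    suppMat_mono fun i j hij => h.relAA i j hij.1 hij.2
  have huR : 1 + s • N ∈ suppMat K R := Submodule.add_mem _ hone (hAR hsN)
  have hu'R : u' ∈ suppMat K R := by
    rw [← sub_add_cancel u' 1]
    exact Submodule.add_mem _ (hAR hu'm) hone
  set f₁ : Matrix ι ι K →ₗ[K] K := s • (f + t • arcForm K τ) with hf₁
  let f' : Matrix ι ι K →ₗ[K] K :=
    f₁ ∘ₗ LinearMap.mulRight K u' ∘ₗ LinearMap.mulLeft K (1 + s • N)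
  have hf' : ∀ x, f' x = f₁ ((1 + s • N) * x * u') := fun x => rfl
  refine le_trans ?_ (finrank_relStab_conj_le h.trans huR hu'R hu' f₁ f' hf')
  -- the part of `F` outside the matched points of `B`
  let F₂ : Matrix ι ι K := F - F * (F₀.transpose * F₀)
  have hF₂m : F₂ ∈ suppMat K (fun i j => A i ∧ B j ∧ ρ j = j) := by
    intro i j hij
    have e : F₂ i j = F i j - if ρ j ≠ j then F i j else 0 := by
      rw [← mul_arcMat_transpose_mul_arcMat h F i j]
      rfl
    rw [e] at hij
    by_cases hj : ρ j = j
    · have := hFm i j (by simpa [hj] using hij)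
      exact ⟨this.1, this.2, hj⟩
    · simp [hj] at hij
  have hu'F₂ : u' * F₂ ∈ suppMat K (fun i j => A i ∧ B j ∧ ρ j = j) := by
    rw [← sub_add_cancel u' 1, add_mul, one_mul]
    exact Submodule.add_mem _ (mul_mem_suppMat (fun i j k h1 h2 => ⟨h1.1, h2.2⟩) hu'm hF₂m) hF₂m
  refine h.relIndex_contractRel_le_of_eq_add f' (Submodule.smul_mem _ s hu'F₂) fun z hz => ?_
  -- `N * F₀` is the part of `F` on the matched columns. Multiplying by the inverse `u'` therefore
  -- leaves `F₀` plus a term on unmatched columns only.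
  have hsplit : F₀ + s • F = (1 + s • N) * F₀ + s • F₂ := by
    simp only [F₂, hN, smul_sub, add_mul, one_mul, smul_mul_assoc, mul_assoc]
    abel
  have hf₁z : ∀ z ∈ suppMat K (fun i j => B i ∧ A j), f₁ z = ((F₀ + s • F) * z).trace := by
    intro z hz
    rw [hf₁, LinearMap.smul_apply, LinearMap.add_apply, LinearMap.smul_apply, hF z hz,
      arcForm_eq_trace, add_mul, Matrix.trace_add, smul_mul_assoc, Matrix.trace_smul, smul_add,
      smul_smul, inv_mul_cancel₀ ht0, one_smul, add_comm]
  have hNz : (1 + s • N) * z = z := by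
    have : s • N * z = 0 :=
      mul_eq_zero_of_suppMat (fun i j k h1 h2 => h.disj j h1.2 h2.1) hsN hz
    rw [add_mul, one_mul, this, add_zero]
  have hzu : z * u' ∈ suppMat K (fun i j => B i ∧ A j) := by
    rw [← sub_add_cancel u' 1, mul_add, mul_one]
    exact Submodule.add_mem _ (mul_mem_suppMat (fun i j k h1 h2 => ⟨h1.1, h2.2⟩) hz hu'm) hz
  rw [hf', hNz, hf₁z _ hzu, ← mul_assoc, Matrix.trace_mul_comm, ← mul_assoc, hsplit, mul_add,
    ← mul_assoc, hu', one_mul, mul_smul_comm]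

end Contraction

/-! ### Relabelling, transposition, direct sums and the full matrix algebra -/

section RelIndexOps

variable {K : Type*} [Field K] {ι ι' : Type*} [Fintype ι] [Fintype ι']

/-- Transposition reverses products, so it turns commutators into their negatives; the sign is
absorbed into `f`. Reduction by `a = ⊥` acts as transport along a linear isomorphism. -/
theorem relIndex_transpose_le (R : ι → ι → Prop) :
    relIndex K (fun i j => R j i) ≤ relIndex K R := by
  obtain ⟨f, hf⟩ := exists_finrank_relStab_eq K R
  rw [← hf]
  let T : Matrix ι ι K →ₗ[K] Matrix ι ι K := (Matrix.transposeLinearEquiv ι ι K K).toLinearMap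
  have hT : ∀ x, T x = x.transpose := fun x => rfl
  refine (relIndex_le _ ((-f) ∘ₗ T)).trans (le_of_eq ?_)
  refine finrank_radicalOn_eq_of_reduction (a := ⊥) T (commForm_skew _) bot_le ?_ ?_ ?_ ?_ ?_ ?_
  · intro z hz _
    exact (Submodule.mem_bot K).1 hz
  · exact fun w hw i j hij => hw j i hij
  · intro w _ z hz
    rw [(Submodule.mem_bot K).1 hz, map_zero]
  · intro x hx _
    refine ⟨T x, fun i j hij => hx j i hij, ?_⟩
    rw [hT, hT, Matrix.transpose_transpose, sub_self]
    exact Submodule.zero_mem _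
  · intro w _ hw
    exact (Matrix.transposeLinearEquiv ι ι K K).map_eq_zero_iff.1 ((Submodule.mem_bot K).1 hw)
  · intro w _ w' _
    simp only [commForm_apply, LinearMap.comp_apply, hT, LinearMap.neg_apply,
      Matrix.transpose_sub, Matrix.transpose_mul, Matrix.transpose_transpose]
    rw [← map_neg, neg_sub]

theorem relIndex_transpose (R : ι → ι → Prop) :
    relIndex K (fun i j => R j i) = relIndex K R :=
  le_antisymm (relIndex_transpose_le R) (relIndex_transpose_le fun i j => R j i)

/-- Extension of a matrix by zero along a map of index sets. -/
noncomputable def extendMat (K : Type*) [Field K] {ι ι' : Type*} (e : ι' → ι) :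
    Matrix ι' ι' K →ₗ[K] Matrix ι ι K where
  toFun x := Matrix.of fun i k => Function.extend (Prod.map e e) (fun p => x p.1 p.2) 0 (i, k)
  map_add' x y := by
    ext i k
    by_cases h : ∃ p, Prod.map e e p = (i, k)
    · simp [Function.extend, h]
    · simp [Function.extend_apply' _ _ _ h]
  map_smul' c x := by
    ext i k
    by_cases h : ∃ p, Prod.map e e p = (i, k)
    · simp [Function.extend, h]
    · simp [Function.extend_apply' _ _ _ h]

omit [Fintype ι] [Fintype ι'] in
theorem extendMat_apply {e : ι' → ι} (he : Function.Injective e) (x : Matrix ι' ι' K)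
    (i k : ι') : extendMat K e x (e i) (e k) = x i k :=
  (he.prodMap he).extend_apply (fun p : ι' × ι' => x p.1 p.2) 0 (i, k)

omit [Fintype ι] [Fintype ι'] in
theorem extendMat_eq_zero {e : ι' → ι} (x : Matrix ι' ι' K) {i k : ι}
    (h : ¬ (i ∈ Set.range e ∧ k ∈ Set.range e)) : extendMat K e x i k = 0 :=
  Function.extend_apply' (f := Prod.map e e) (fun p : ι' × ι' => x p.1 p.2) 0 (i, k)
    (by
      rintro ⟨⟨a, b⟩, hab⟩
      exact h ⟨⟨a, congrArg Prod.fst hab⟩, ⟨b, congrArg Prod.snd hab⟩⟩)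

/-- Points not related to any point do not contribute to the index. -/
theorem relIndex_comp_of_injective {e : ι' → ι} (he : Function.Injective e) {R : ι → ι → Prop}
    (htrans : ∀ i j k, R i j → R j k → R i k)
    (hR : ∀ i j, R i j → i ∈ Set.range e ∧ j ∈ Set.range e) :
    relIndex K (fun i j => R (e i) (e j)) = relIndex K R := by
  let D : Matrix ι ι K →ₗ[K] Matrix ι' ι' K :=
    { toFun := fun x => x.submatrix e e, map_add' := fun _ _ => rfl, map_smul' := fun _ _ => rfl }
  have hD : ∀ x i k, D x i k = x (e i) (e k) := fun _ _ _ => rfl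
  have hDE : ∀ x, D (extendMat K e x) = x := fun x => by
    ext i k
    rw [hD, extendMat_apply he]
  have hED : ∀ w ∈ suppMat K R, extendMat K e (D w) = w := fun w hw => by
    ext i k
    by_cases h : i ∈ Set.range e ∧ k ∈ Set.range e
    · obtain ⟨⟨i, rfl⟩, ⟨k, rfl⟩⟩ := h
      rw [extendMat_apply he, hD]
    · rw [extendMat_eq_zero _ h, suppMat_apply_eq_zero hw fun h' => h (hR _ _ h')]
  have hE : ∀ x ∈ suppMat K (fun i j => R (e i) (e j)), extendMat K e x ∈ suppMat K R := by
    intro x hx i k hik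
    by_cases h : i ∈ Set.range e ∧ k ∈ Set.range e
    · obtain ⟨⟨i, rfl⟩, ⟨k, rfl⟩⟩ := h
      rw [extendMat_apply he] at hik
      exact hx i k hik
    · exact absurd (extendMat_eq_zero _ h) hik
  have hmul : ∀ w ∈ suppMat K R, ∀ w' ∈ suppMat K R, D w * D w' = D (w * w') := by
    intro w hw w' hw'
    ext i k
    rw [hD, Matrix.mul_apply, Matrix.mul_apply]
    refine Finset.sum_of_injOn e he.injOn (fun _ _ => by simp) ?_ (fun _ _ => rfl)
    intro j _ hj
    by_contra h0
    obtain ⟨j', rfl⟩ := (hR _ _ (hw _ _ (left_ne_zero_of_mul h0))).2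
    exact hj ⟨j', by simp, rfl⟩
  have key : ∀ f, Module.finrank K (relStab (fun i j => R (e i) (e j)) f) =
      Module.finrank K (relStab R (f ∘ₗ D)) := by
    intro f
    refine finrank_radicalOn_eq_of_reduction (a := ⊥) D (commForm_skew _) bot_le
      ?_ ?_ ?_ ?_ ?_ ?_
    · intro z hz _
      exact (Submodule.mem_bot K).1 hz
    · exact fun w hw i j hij => hw _ _ hij
    · intro w _ z hz
      rw [(Submodule.mem_bot K).1 hz, map_zero]
    · intro x hx _
      refine ⟨extendMat K e x, hE x hx, ?_⟩
      rw [hDE, sub_self]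
      exact Submodule.zero_mem _
    · intro w hw hw0
      rw [← hED w hw, (Submodule.mem_bot K).1 hw0, map_zero]
    · intro w hw w' hw'
      rw [commForm_apply, commForm_apply, hmul w hw w' hw', hmul w' hw' w hw,
        LinearMap.comp_apply, map_sub D]
  apply le_antisymm
  · refine le_relIndex fun g => ?_
    refine (relIndex_le _ (g ∘ₗ extendMat K e)).trans (le_of_eq ?_)
    rw [key, relStab_congr htrans]
    intro x hx
    rw [LinearMap.comp_apply, LinearMap.comp_apply, hED x hx]
  · refine le_relIndex fun f => ?_
    rw [key]
    exact relIndex_le _ _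

open Classical in
/-- Keeps the rows in `P`. -/
noncomputable def rowsMat (K : Type*) [Field K] {ι : Type*} (P : ι → Prop) :
    Matrix ι ι K →ₗ[K] Matrix ι ι K where
  toFun x := Matrix.of fun i k => if P i then x i k else 0
  map_add' x y := by
    ext i k
    by_cases h : P i <;> simp [h]
  map_smul' c x := by
    ext i k
    by_cases h : P i <;> simp [h]

omit [Fintype ι] in
open Classical in
theorem rowsMat_apply (P : ι → Prop) (x : Matrix ι ι K) (i k : ι) :
    rowsMat K P x i k = if P i then x i k else 0 := rfl

omit [Fintype ι] in
theorem rowsMat_add_rowsMat_not (P : ι → Prop) (x : Matrix ι ι K) :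
    rowsMat K P x + rowsMat K (fun i => ¬ P i) x = x := by
  ext i k
  rw [Matrix.add_apply, rowsMat_apply, rowsMat_apply]
  by_cases h : P i <;> simp [h]

omit [Fintype ι] in
theorem rowsMat_mem {R : ι → ι → Prop} {x : Matrix ι ι K} (hx : x ∈ suppMat K R) (P : ι → Prop) :
    rowsMat K P x ∈ suppMat K fun i j => R i j ∧ P i := by
  intro i j hij
  rw [rowsMat_apply] at hij
  by_cases h : P i
  · exact ⟨hx i j (by simpa [h] using hij), h⟩
  · simp [h] at hij

omit [Fintype ι] in
theorem rowsMat_eq_self {R : ι → ι → Prop} {P : ι → Prop} {x : Matrix ι ι K}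
    (hx : x ∈ suppMat K fun i j => R i j ∧ P i) : rowsMat K P x = x := by
  ext i j
  rw [rowsMat_apply]
  by_cases h : P i
  · rw [if_pos h]
  · rw [if_neg h, suppMat_apply_eq_zero hx fun h' => h h'.2]

omit [Fintype ι] in
theorem rowsMat_eq_zero {R : ι → ι → Prop} {P : ι → Prop} {x : Matrix ι ι K}
    (hx : x ∈ suppMat K fun i j => R i j ∧ ¬ P i) : rowsMat K P x = 0 := by
  ext i j
  rw [rowsMat_apply]
  by_cases h : P i
  · rw [if_pos h, suppMat_apply_eq_zero hx fun h' => h'.2 h, Matrix.zero_apply]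
  · rw [if_neg h, Matrix.zero_apply]

/-- The index of the matrices supported on a disjoint union of relations is additive. -/
theorem relIndex_eq_add {R : ι → ι → Prop} (htrans : ∀ i j k, R i j → R j k → R i k)
    (P : ι → Prop) (hP : ∀ i j, R i j → (P i ↔ P j)) :
    relIndex K R = relIndex K (fun i j => R i j ∧ P i) + relIndex K (fun i j => R i j ∧ ¬ P i) := by
  have tr : ∀ Q : ι → Prop, ∀ i j k, R i j ∧ Q i → R j k ∧ Q j → R i k ∧ Q i :=
    fun Q i j k h1 h2 => ⟨htrans i j k h1.1 h2.1, h1.2⟩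
  have hle : ∀ Q : ι → Prop, suppMat K (fun i j => R i j ∧ Q i) ≤ suppMat K R :=
    fun Q => suppMat_mono fun i j h => h.1
  have cross : ∀ Q Q' : ι → Prop, (∀ i j, R i j → (Q i ↔ Q j)) → (∀ i, Q i → ¬ Q' i) →
      ∀ x ∈ suppMat K (fun i j => R i j ∧ Q i), ∀ y ∈ suppMat K (fun i j => R i j ∧ Q' i),
      x * y = 0 := fun Q Q' hQ hQQ x hx y hy =>
    mul_eq_zero_of_suppMat (fun i j k h1 h2 => hQQ j ((hQ i j h1.1).1 h1.2) h2.2) hx hy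
  have hP' : ∀ i j, R i j → (¬ P i ↔ ¬ P j) := fun i j h => not_congr (hP i j h)
  have c1 := cross P (fun i => ¬ P i) hP fun i h h' => h' h
  have c2 := cross (fun i => ¬ P i) P hP' fun i h => h
  have key : ∀ f : Matrix ι ι K →ₗ[K] K, Module.finrank K (relStab R f) =
      Module.finrank K (relStab (fun i j => R i j ∧ P i) f) +
        Module.finrank K (relStab (fun i j => R i j ∧ ¬ P i) f) := by
    intro f
    have hsup : relStab R f =
        relStab (fun i j => R i j ∧ P i) f ⊔ relStab (fun i j => R i j ∧ ¬ P i) f := by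
      apply le_antisymm
      · intro x hx
        have m1 := rowsMat_mem hx.1 P
        have m2 := rowsMat_mem hx.1 fun i => ¬ P i
        have hx' := rowsMat_add_rowsMat_not P x
        rw [← hx']
        refine Submodule.add_mem_sup ⟨m1, fun y hy => ?_⟩ ⟨m2, fun y hy => ?_⟩
        · have := hx.2 y (hle _ hy)
          rw [commForm_apply, ← hx', add_mul, mul_add, c2 _ m2 y hy, c1 y hy _ m2, add_zero,
            add_zero] at this
          exact this
        · have := hx.2 y (hle (fun i => ¬ P i) hy)
          rw [commForm_apply, ← hx', add_mul, mul_add, c1 _ m1 y hy, c2 y hy _ m1, zero_add,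
            zero_add] at this
          exact this
      · refine sup_le (fun x hx => ⟨hle _ hx.1, fun y hy => ?_⟩)
          (fun x hx => ⟨hle (fun i => ¬ P i) hx.1, fun y hy => ?_⟩)
        · have m1 := rowsMat_mem hy P
          have m2 := rowsMat_mem hy fun i => ¬ P i
          have := hx.2 _ m1
          rw [commForm_apply] at this
          rw [← rowsMat_add_rowsMat_not P y, commForm_apply, mul_add, add_mul, c1 x hx.1 _ m2,
            c2 _ m2 x hx.1, add_zero, add_zero, this]
        · have m1 := rowsMat_mem hy P
          have m2 := rowsMat_mem hy fun i => ¬ P i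
          have := hx.2 _ m2
          rw [commForm_apply] at this
          rw [← rowsMat_add_rowsMat_not P y, commForm_apply, mul_add, add_mul, c2 x hx.1 _ m1,
            c1 _ m1 x hx.1, zero_add, zero_add, this]
    have hdisj : Disjoint (relStab (fun i j => R i j ∧ P i) f)
        (relStab (fun i j => R i j ∧ ¬ P i) f) := by
      rw [Submodule.disjoint_def]
      intro x hx hx'
      rw [← rowsMat_eq_self hx.1, rowsMat_eq_zero hx'.1]
    have := Submodule.finrank_sup_add_finrank_inf_eq (relStab (fun i j => R i j ∧ P i) f)
      (relStab (fun i j => R i j ∧ ¬ P i) f)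
    rw [hdisj.eq_bot, finrank_bot, add_zero] at this
    rw [hsup, this]
  apply le_antisymm
  · obtain ⟨f₁, h₁⟩ := exists_finrank_relStab_eq K fun i j => R i j ∧ P i
    obtain ⟨f₂, h₂⟩ := exists_finrank_relStab_eq K fun i j => R i j ∧ ¬ P i
    refine (relIndex_le R (f₁ ∘ₗ rowsMat K P + f₂ ∘ₗ rowsMat K fun i => ¬ P i)).trans
      (le_of_eq ?_)
    have e₁ : relStab (fun i j => R i j ∧ P i)
        (f₁ ∘ₗ rowsMat K P + f₂ ∘ₗ rowsMat K fun i => ¬ P i) =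
          relStab (fun i j => R i j ∧ P i) f₁ := by
      refine relStab_congr (tr P) fun x hx => ?_
      have e : rowsMat K (fun i => ¬ P i) x = 0 :=
        rowsMat_eq_zero (R := R) (suppMat_mono (fun i j h => ⟨h.1, not_not.2 h.2⟩) hx)
      simp [rowsMat_eq_self hx, e]
    have e₂ : relStab (fun i j => R i j ∧ ¬ P i)
        (f₁ ∘ₗ rowsMat K P + f₂ ∘ₗ rowsMat K fun i => ¬ P i) =
          relStab (fun i j => R i j ∧ ¬ P i) f₂ := by
      refine relStab_congr (tr fun i => ¬ P i) fun x hx => ?_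
      simp [rowsMat_eq_self hx, rowsMat_eq_zero hx]
    rw [key, ← h₁, ← h₂, e₁, e₂]
  · refine le_relIndex fun f => ?_
    rw [key]
    exact Nat.add_le_add (relIndex_le _ _) (relIndex_le _ _)

/-- The index of `𝔤𝔩ₙ` is `n`. -/
theorem relIndex_true [CharZero K] (n : ℕ) : relIndex K (fun _ _ : Fin n => True) = n := by
  have hinj : Function.Injective fun i : Fin n => ((i : ℕ) : K) :=
    Nat.cast_injective.comp Fin.val_injective
  let D : Matrix (Fin n) (Fin n) K := Matrix.diagonal fun i => ((i : ℕ) : K)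
  let trf : Matrix (Fin n) (Fin n) K → (Matrix (Fin n) (Fin n) K →ₗ[K] K) := fun F =>
    Matrix.traceLinearMap (Fin n) K K ∘ₗ LinearMap.mulLeft K F
  have htrf : ∀ F x, trf F x = (F * x).trace := fun F x => rfl
  have hcomm : ∀ F x y : Matrix (Fin n) (Fin n) K,
      trf F (x * y - y * x) = ((F * x - x * F) * y).trace := by
    intro F x y
    rw [htrf, mul_sub, sub_mul, Matrix.trace_sub, Matrix.trace_sub, mul_assoc, ← mul_assoc F y x,
      Matrix.trace_mul_comm (F * y) x, mul_assoc]
  apply le_antisymm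
  · refine (relIndex_le _ (trf D)).trans ?_
    -- Under the trace form the stabilizer of `trf D` is the centralizer of `D`, which is diagonal
    -- because the entries of `D` are distinct; characteristic zero enters here.
    have hoff : ∀ x ∈ relStab (fun _ _ : Fin n => True) (trf D), ∀ i j, i ≠ j → x i j = 0 := by
      intro x hx i j hij
      have h := hx.2 (Matrix.single j i 1) (single_mem_suppMat trivial 1)
      rw [commForm_apply, hcomm, Matrix.trace_mul_comm, Matrix.trace_single_mul] at h
      rw [one_smul, Matrix.sub_apply, Matrix.diagonal_mul, Matrix.mul_diagonal, mul_comm, ← mul_sub]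
        at h
      exact (mul_eq_zero.1 h).resolve_right (sub_ne_zero.2 (hinj.ne hij))
    let φ := (Matrix.diagLinearMap (Fin n) K K).domRestrict
      (relStab (fun _ _ : Fin n => True) (trf D))
    have hφ : Function.Injective φ := by
      rw [injective_iff_map_eq_zero]
      rintro ⟨x, hx⟩ h0
      refine Subtype.ext ?_
      ext i j
      by_cases hij : i = j
      · subst hij
        exact congrFun h0 i
      · exact hoff x hx i j hij
    have := LinearMap.finrank_le_finrank_of_injective hφ
    simpa using this
  · refine le_relIndex fun f => ?_
    obtain ⟨F, -, hF⟩ := exists_trace_eq f (fun _ : Fin n => True) (fun _ => True)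
    have hF : ∀ z, f z = (F * z).trace := fun z => hF z fun _ _ _ => ⟨trivial, trivial⟩
    let M : Matrix (Fin n) (Fin n) (Polynomial K) :=
      D.map Polynomial.C + (Polynomial.X : Polynomial K) • F.map Polynomial.C
    -- `p.eval s ≠ 0` says that the all-ones vector is cyclic for `D + s • F`. At `s = 0` this is a
    -- Vandermonde determinant, so `p` is not the zero polynomial.
    let p : Polynomial K := (Matrix.of fun i k : Fin n => (M ^ (k : ℕ)).mulVec 1 i).det
    have hM : ∀ s, M.map (Polynomial.evalRingHom s) = D + s • F := by
      intro s
      ext i j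
      simp [M]
      exact mul_comm _ _
    have hp : ∀ s, p.eval s =
        (Matrix.of fun i k : Fin n => ((D + s • F) ^ (k : ℕ)).mulVec 1 i).det := by
      intro s
      rw [← Polynomial.coe_evalRingHom, RingHom.map_det]
      congr 1
      ext i k
      rw [RingHom.mapMatrix_apply, Matrix.map_apply, Matrix.of_apply, Matrix.of_apply, ← hM,
        ← RingHom.mapMatrix_apply, ← map_pow, RingHom.mapMatrix_apply, RingHom.map_mulVec]
      congr 2
      ext
      simp
    have hp0 : p ≠ 0 := by
      intro h
      have h0 := hp 0
      rw [h, Polynomial.eval_zero] at h0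
      have hV : (Matrix.of fun i k : Fin n => ((D + (0 : K) • F) ^ (k : ℕ)).mulVec 1 i) =
          Matrix.vandermonde fun i : Fin n => ((i : ℕ) : K) := by
        ext i k
        simp [D, Matrix.diagonal_pow, Matrix.mulVec_diagonal, Matrix.vandermonde_apply]
      rw [hV] at h0
      exact Matrix.det_vandermonde_ne_zero_iff.2 hinj h0.symm
    have hfin1 := finite_setOf_finrank_relStab_lt (fun _ _ : Fin n => True) f (trf D)
    have hfin2 : {t : K | p.IsRoot t⁻¹}.Finite :=
      (Polynomial.finite_setOfPred_isRoot hp0).preimage inv_injective.injOn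
    obtain ⟨t, ht⟩ := ((hfin1.union hfin2).union
      (Set.finite_singleton 0)).infinite_compl.nonempty
    simp only [Set.mem_compl_iff, Set.mem_union, not_or] at ht
    obtain ⟨⟨ht1, ht2⟩, ht0⟩ := ht
    have ht0 : t ≠ 0 := ht0
    refine le_trans ?_ (not_lt.1 ht1)
    rw [← relStab_smul _ _ (inv_ne_zero ht0)]
    set N := D + t⁻¹ • F with hN
    have hfN : t⁻¹ • (f + t • trf D) = trf N := by
      ext1 z
      rw [LinearMap.smul_apply, LinearMap.add_apply, LinearMap.smul_apply, hF, htrf, htrf, hN,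
        add_mul, Matrix.trace_add, smul_add, smul_smul, inv_mul_cancel₀ ht0, one_smul,
        smul_mul_assoc, Matrix.trace_smul, add_comm]
    rw [hfN]
    have hli : LinearIndependent K fun k : Fin n => N ^ (k : ℕ) := by
      have h1 : ¬ p.eval t⁻¹ = 0 := ht2
      rw [hp, ← hN] at h1
      have h2 := Matrix.linearIndependent_cols_of_det_ne_zero h1
      let ev : Matrix (Fin n) (Fin n) K →ₗ[K] (Fin n → K) :=
        { toFun := fun x => x.mulVec 1
          map_add' := fun x y => Matrix.add_mulVec x y 1
          map_smul' := fun c x => Matrix.smul_mulVec c x 1 }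
      exact LinearIndependent.of_comp ev h2
    -- Powers of `N` commute with `N`, and by cyclicity the first `n` of them are independent.
    have hmem : ∀ k : Fin n, N ^ (k : ℕ) ∈ relStab (fun _ _ : Fin n => True) (trf N) := by
      refine fun k => ⟨fun _ _ _ => trivial, fun y _ => ?_⟩
      rw [commForm_apply, hcomm, ← pow_succ', ← pow_succ, sub_self, zero_mul, Matrix.trace_zero]
    have hli' : LinearIndependent K fun k : Fin n =>
        (⟨N ^ (k : ℕ), hmem k⟩ : relStab (fun _ _ : Fin n => True) (trf N)) :=
      LinearIndependent.of_comp (Submodule.subtype _) hli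
    simpa using hli'.fintype_card_le_finrank

end RelIndexOps

/-! ### Meanders as pairs of lists -/

/-- The positions `i` and `j` lie in the same block of the list of block sizes `l`. -/
def SameBlock (l : List ℕ) (i j : ℕ) : Prop :=
  ∀ k, (l.take k).sum ≤ i ↔ (l.take k).sum ≤ j

theorem SameBlock.symm {l : List ℕ} {i j : ℕ} (h : SameBlock l i j) : SameBlock l j i :=
  fun k => (h k).symm

theorem SameBlock.trans {l : List ℕ} {i j k : ℕ} (h : SameBlock l i j) (h' : SameBlock l j k) :
    SameBlock l i k := fun t => (h t).trans (h' t)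

theorem SameBlock.between {l : List ℕ} {i k j : ℕ} (h : SameBlock l i j) (hik : i ≤ k)
    (hkj : k ≤ j) : SameBlock l i k :=
  fun t => ⟨fun h' => h'.trans hik, fun h' => (h t).2 (h'.trans hkj)⟩

theorem sameBlock_cons {a : ℕ} {l : List ℕ} {i j : ℕ} :
    SameBlock (a :: l) i j ↔
      (i < a ∧ j < a) ∨ (a ≤ i ∧ a ≤ j ∧ SameBlock l (i - a) (j - a)) := by
  constructor
  · intro h
    have h1 := h 1
    simp only [List.take_succ_cons, List.take_zero, List.sum_cons, List.sum_nil, add_zero] at h1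
    rcases lt_or_ge i a with hi | hi
    · exact Or.inl ⟨hi, by omega⟩
    · refine Or.inr ⟨hi, by omega, fun k => ?_⟩
      have h2 := h (k + 1)
      simp only [List.take_succ_cons, List.sum_cons] at h2
      omega
  · rintro (⟨hi, hj⟩ | ⟨hi, hj, h⟩) k
    · cases k with
      | zero => simp
      | succ k =>
        simp only [List.take_succ_cons, List.sum_cons]
        omega
    · cases k with
      | zero => simp
      | succ k =>
        have := h k
        simp only [List.take_succ_cons, List.sum_cons]
        omega

theorem sameBlock_zero_cons {l : List ℕ} {i j : ℕ} :
    SameBlock (0 :: l) i j ↔ SameBlock l i j := by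
  simp [sameBlock_cons]

/-- The preorder of the seaweed algebra of a pair of lists of block sizes. -/
def meanderRel (l m : List ℕ) (i j : ℕ) : Prop :=
  (i ≤ j ∧ SameBlock l i j) ∨ (j ≤ i ∧ SameBlock m i j)

theorem meanderRel_refl (l m : List ℕ) (i : ℕ) : meanderRel l m i i :=
  Or.inl ⟨le_rfl, fun _ => Iff.rfl⟩

theorem meanderRel_swap {l m : List ℕ} {i j : ℕ} : meanderRel m l j i ↔ meanderRel l m i j := by
  unfold meanderRel
  constructor <;> rintro (⟨h, h'⟩ | ⟨h, h'⟩)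
  · exact Or.inr ⟨h, h'.symm⟩
  · exact Or.inl ⟨h, h'.symm⟩
  · exact Or.inr ⟨h, h'.symm⟩
  · exact Or.inl ⟨h, h'.symm⟩

theorem meanderRel_trans {l m : List ℕ} {i k j : ℕ} (h1 : meanderRel l m i k)
    (h2 : meanderRel l m k j) : meanderRel l m i j := by
  rcases h1 with ⟨a, ha⟩ | ⟨a, ha⟩ <;> rcases h2 with ⟨b, hb⟩ | ⟨b, hb⟩
  · exact Or.inl ⟨a.trans b, ha.trans hb⟩
  · rcases le_total i j with c | c
    · exact Or.inl ⟨c, ha.between c b⟩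
    · exact Or.inr ⟨c, (hb.symm.between c a).symm⟩
  · rcases le_total i j with c | c
    · exact Or.inl ⟨c, (hb.between a c).symm.trans hb⟩
    · exact Or.inr ⟨c, ha.trans (ha.symm.between b c)⟩
  · exact Or.inr ⟨b.trans a, ha.trans hb⟩

/-- The index of the seaweed algebra on `n` nodes of a pair of lists of block sizes. -/
noncomputable def listIndex (K : Type*) [Field K] (n : ℕ) (l m : List ℕ) : ℕ :=
  relIndex K fun i j : Fin n => meanderRel l m i j

theorem listIndex_swap (K : Type*) [Field K] (n : ℕ) (l m : List ℕ) :
    listIndex K n m l = listIndex K n l m := by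
  unfold listIndex
  rw [← relIndex_transpose]
  simp only [meanderRel_swap]

theorem listIndex_zero_cons (K : Type*) [Field K] (n : ℕ) (l m : List ℕ) :
    listIndex K n (0 :: l) m = listIndex K n l m := by
  simp only [listIndex, meanderRel, sameBlock_zero_cons]

theorem listIndex_zero (K : Type*) [Field K] (l m : List ℕ) : listIndex K 0 l m = 0 := by
  have h := relIndex_le (fun i j : Fin 0 => meanderRel l m i j) (0 : _ →ₗ[K] K)
  have h' := Submodule.finrank_le (relStab (fun i j : Fin 0 => meanderRel l m i j) (0 : _ →ₗ[K] K))
  simp only [Module.finrank_matrix, Fintype.card_fin, zero_mul] at h'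
  exact Nat.le_zero.1 (h.trans h')

/-- A common first cut at `a` makes the algebra a direct product of `𝔤𝔩ₐ` and the seaweed algebra of
the remaining blocks. -/
theorem listIndex_cons_self (K : Type*) [Field K] [CharZero K] {n a : ℕ} (han : a ≤ n)
    (l m : List ℕ) :
    listIndex K n (a :: l) (a :: m) = a + listIndex K (n - a) l m := by
  unfold listIndex
  have hexp : ∀ i j : ℕ, meanderRel (a :: l) (a :: m) i j ↔
      (i < a ∧ j < a) ∨ (a ≤ i ∧ a ≤ j ∧ meanderRel l m (i - a) (j - a)) := by
    intro i j
    simp only [meanderRel, sameBlock_cons]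
    constructor
    · rintro (⟨h, h' | ⟨h1, h2, h3⟩⟩ | ⟨h, h' | ⟨h1, h2, h3⟩⟩)
      · exact Or.inl h'
      · exact Or.inr ⟨h1, h2, Or.inl ⟨by omega, h3⟩⟩
      · exact Or.inl h'
      · exact Or.inr ⟨h1, h2, Or.inr ⟨by omega, h3⟩⟩
    · rintro (h | ⟨h1, h2, ⟨h3, h4⟩ | ⟨h3, h4⟩⟩)
      · rcases le_total i j with c | c
        · exact Or.inl ⟨c, Or.inl h⟩
        · exact Or.inr ⟨c, Or.inl h⟩
      · exact Or.inl ⟨by omega, Or.inr ⟨h1, h2, h4⟩⟩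
      · exact Or.inr ⟨by omega, Or.inr ⟨h1, h2, h4⟩⟩
  rw [relIndex_eq_add (R := fun i j : Fin n => meanderRel (a :: l) (a :: m) i j)
    (fun i j k h h' => meanderRel_trans h h') (fun i : Fin n => (i : ℕ) < a)
    (fun i j h => by rcases (hexp _ _).1 h with h' | ⟨h1, h2, -⟩ <;> omega)]
  congr 1
  · rw [← relIndex_comp_of_injective (e := Fin.castLE han) (Fin.castLE_injective han)
      (fun i j k h h' => ⟨meanderRel_trans h.1 h'.1, h.2⟩)]
    · refine Eq.trans ?_ (relIndex_true (K := K) a)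
      congr 1
      ext i j
      simp only [Fin.val_castLE, Fin.is_lt, and_true, iff_true]
      exact (hexp _ _).2 (Or.inl ⟨i.2, j.2⟩)
    · rintro i j ⟨h, hi⟩
      have hj : (j : ℕ) < a := by rcases (hexp _ _).1 h with h' | ⟨h1, h2, -⟩ <;> omega
      exact ⟨⟨⟨i, hi⟩, rfl⟩, ⟨⟨j, hj⟩, rfl⟩⟩
  · let e : Fin (n - a) → Fin n := fun i => ⟨i + a, by omega⟩
    have he : Function.Injective e := fun i j h => by
      have : (i : ℕ) + a = j + a := congrArg Fin.val h
      exact Fin.ext (by omega)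
    rw [← relIndex_comp_of_injective (e := e) he
      (fun i j k h h' => ⟨meanderRel_trans h.1 h'.1, h.2⟩)]
    · congr 1
      ext i j
      simp only [e]
      rw [hexp]
      simp
    · rintro i j ⟨h, hi⟩
      have hj : a ≤ (j : ℕ) := by rcases (hexp _ _).1 h with h' | ⟨h1, h2, -⟩ <;> omega
      exact ⟨⟨⟨i - a, by omega⟩, Fin.ext (by simp [e]; omega)⟩,
        ⟨⟨j - a, by omega⟩, Fin.ext (by simp [e]; omega)⟩⟩

/-- The contraction for `A = [0, a)` and `B = [a, b)`, where translation by `b - d` matches the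
first `d` nodes with the last `d` nodes of `B`. By `hd`, one of the two sides is used up. The last
clause of `hrel` excludes the pairs dropped by `contractRel`, after renumbering the surviving nodes
by `d`. -/
theorem listIndex_contract (K : Type*) [Field K] [Infinite K] {n a b d : ℕ} (hab : a ≤ b)
    (hbn : b ≤ n) (hda : d ≤ a) (hdb : d ≤ b - a) (hd : d = a ∨ d = b - a)
    {l m l' m' : List ℕ}
    (hrel : ∀ i j, meanderRel l' m' i j ↔ meanderRel (a :: l) (b :: m) (i + d) (j + d) ∧
      ¬ (b - d ≤ i + d ∧ i + d < b ∧ a ≤ j + d ∧ j + d < b - d)) :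
    listIndex K n (a :: l) (b :: m) = listIndex K (n - d) l' m' := by
  unfold listIndex
  let τ : Fin n → Fin n := fun i =>
    if h : (i : ℕ) < d then ⟨i + (b - d), by omega⟩ else i
  let ρ : Fin n → Fin n := fun i =>
    if h : b - d ≤ (i : ℕ) ∧ (i : ℕ) < b then ⟨i - (b - d), by omega⟩ else i
  have hτ : ∀ i, (τ i : ℕ) = if (i : ℕ) < d then (i : ℕ) + (b - d) else i := fun i => by
    by_cases h : (i : ℕ) < d <;> simp [τ, h]
  have hρ : ∀ i, (ρ i : ℕ) =
      if b - d ≤ (i : ℕ) ∧ (i : ℕ) < b then (i : ℕ) - (b - d) else i := fun i => by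
    simp only [ρ]
    split_ifs <;> rfl
  have hτi : ∀ i, τ i = i ↔ d ≤ (i : ℕ) := fun i => by
    rw [Fin.ext_iff, hτ]
    split_ifs <;> omega
  have hρi : ∀ i, ρ i = i ↔ ¬ (b - d ≤ (i : ℕ) ∧ (i : ℕ) < b) ∨ d = 0 := fun i => by
    rw [Fin.ext_iff, hρ]
    split_ifs <;> omega
  have hexp : ∀ i j : ℕ, meanderRel (a :: l) (b :: m) i j →
      (i ≤ j ∧ ((i < a ∧ j < a) ∨ (a ≤ i ∧ a ≤ j))) ∨
        (j ≤ i ∧ ((i < b ∧ j < b) ∨ (b ≤ i ∧ b ≤ j))) := by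
    intro i j h
    simp only [meanderRel, sameBlock_cons] at h
    tauto
  have hdown : ∀ i j : ℕ, i < b → j ≤ i → meanderRel (a :: l) (b :: m) i j := fun i j h1 h2 =>
    Or.inr ⟨h2, sameBlock_cons.2 (Or.inl ⟨h1, by omega⟩)⟩
  have harc : IsArcMatching (fun i j : Fin n => meanderRel (a :: l) (b :: m) i j)
      (fun i => (i : ℕ) < a) (fun i => a ≤ (i : ℕ) ∧ (i : ℕ) < b) τ ρ := by
    refine ⟨fun i => meanderRel_refl _ _ _, fun i j k h h' => meanderRel_trans h h', ?_, ?_, ?_,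
      ?_, ?_, ?_, ?_, ?_, ?_, ?_, ?_, ?_⟩
    · intro i h1 h2
      omega
    · intro i j hi hj
      rcases le_total (i : ℕ) j with c | c
      · exact Or.inl ⟨c, sameBlock_cons.2 (Or.inl ⟨hi, hj⟩)⟩
      · exact hdown _ _ (by omega) c
    · intro i j hi hj
      exact hdown _ _ hi.2 (by omega)
    · intro i j h hj
      have := hexp _ _ h
      omega
    · intro i j h hj
      have := hexp _ _ h
      omega
    · intro i j h hj
      have := hexp _ _ h
      omega
    · intro i hi
      rw [ne_eq, hτi] at hi
      omega
    · intro i hi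
      rw [ne_eq, hρi] at hi
      omega
    · intro i hi
      rw [ne_eq, hτi] at hi
      rw [Fin.ext_iff, hρ, hτ]
      split_ifs <;> omega
    · intro i hi
      rw [ne_eq, hρi] at hi
      rw [Fin.ext_iff, hτ, hρ]
      split_ifs <;> omega
    · intro i j hi hj hj'
      rw [ne_eq, hρi] at hi
      rw [hρi] at hj'
      exact hdown _ _ (by omega) (by omega)
    · rcases hd with hd | hd
      · left
        intro i hi
        rw [ne_eq, hτi]
        omega
      · right
        intro i hi
        rw [ne_eq, hρi]
        omega
  rw [harc.relIndex_eq]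
  let e : Fin (n - d) → Fin n := fun i => ⟨i + d, by omega⟩
  have he : Function.Injective e := fun i j h => by
    have : (i : ℕ) + d = j + d := congrArg Fin.val h
    exact Fin.ext (by omega)
  rw [← relIndex_comp_of_injective (e := e) he harc.contractRel_trans]
  · congr 1
    ext i j
    rw [hrel]
    unfold contractRel
    have e1 : ((e i : Fin n) : ℕ) = i + d := rfl
    have e2 : ((e j : Fin n) : ℕ) = j + d := rfl
    simp only [ne_eq, hρi, hτi, e1, e2]
    exact ⟨fun h => ⟨h.1, by omega⟩, fun h => ⟨h.1, by omega, by omega, by omega⟩⟩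
  · rintro i j ⟨-, hi, hj, -⟩
    rw [hτi] at hi hj
    exact ⟨⟨⟨i - d, by omega⟩, Fin.ext (by simp [e]; omega)⟩,
      ⟨⟨j - d, by omega⟩, Fin.ext (by simp [e]; omega)⟩⟩

/-- Reduction when the first upper block is at most half the first lower block. -/
theorem listIndex_of_two_mul_le (K : Type*) [Field K] [Infinite K] {n a b : ℕ} (hab : 2 * a ≤ b)
    (hbn : b ≤ n) (l m : List ℕ) :
    listIndex K n (a :: l) (b :: m) = listIndex K (n - a) l ((b - 2 * a) :: a :: m) := by
  -- All of `A` is deleted. Dropping the pairs from matched to unmatched nodes of `B` cuts the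
  -- remaining `b - a` lower nodes into blocks `b - 2 * a` and `a`.
  refine listIndex_contract K (by omega) hbn le_rfl (by omega) (Or.inl rfl) fun i j => ?_
  simp only [meanderRel, sameBlock_cons, Nat.add_sub_cancel]
  have e : ∀ t, t + a - b = t - (b - 2 * a) - a := fun t => by omega
  rw [e i, e j]
  constructor
  · rintro (⟨h, h'⟩ | ⟨h, h' | ⟨h1, h2, h3 | ⟨h3, h4, h5⟩⟩⟩)
    · exact ⟨Or.inl ⟨by omega, Or.inr ⟨by omega, by omega, h'⟩⟩, by omega⟩
    · exact ⟨Or.inr ⟨by omega, Or.inl (by omega)⟩, by omega⟩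
    · exact ⟨Or.inr ⟨by omega, Or.inl (by omega)⟩, by omega⟩
    · exact ⟨Or.inr ⟨by omega, Or.inr ⟨by omega, by omega, h5⟩⟩, by omega⟩
  · rintro ⟨⟨h, h' | ⟨h1, h2, h3⟩⟩ | ⟨h, h' | ⟨h1, h2, h3⟩⟩, h0⟩
    · omega
    · exact Or.inl ⟨by omega, h3⟩
    · refine Or.inr ⟨by omega, ?_⟩
      by_cases hi : i < b - 2 * a
      · exact Or.inl (by omega)
      · exact Or.inr ⟨by omega, by omega, Or.inl (by omega)⟩
    · exact Or.inr ⟨by omega, Or.inr ⟨by omega, by omega, Or.inr ⟨by omega, by omega, h3⟩⟩⟩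

/-- Reduction when the first upper block is at least half the first lower block. -/
theorem listIndex_of_le_two_mul (K : Type*) [Field K] [Infinite K] {n a b : ℕ} (hab : a ≤ b)
    (hba : b ≤ 2 * a) (hbn : b ≤ n) (l m : List ℕ) :
    listIndex K n (a :: l) (b :: m) = listIndex K (n - (b - a)) ((2 * a - b) :: l) (a :: m) := by
  -- All of `B` is matched, so no pair is dropped: both first blocks just lose their first `b - a`
  -- nodes.
  refine listIndex_contract K hab hbn (by omega) le_rfl (Or.inr rfl) fun i j => ?_
  simp only [meanderRel, sameBlock_cons]
  have e1 : ∀ t, t + (b - a) - a = t - (2 * a - b) := fun t => by omega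
  have e2 : ∀ t, t + (b - a) - b = t - a := fun t => by omega
  rw [e1 i, e1 j, e2 i, e2 j]
  constructor
  · rintro (⟨h, h' | ⟨h1, h2, h3⟩⟩ | ⟨h, h' | ⟨h1, h2, h3⟩⟩)
    · exact ⟨Or.inl ⟨by omega, Or.inl (by omega)⟩, by omega⟩
    · exact ⟨Or.inl ⟨by omega, Or.inr ⟨by omega, by omega, h3⟩⟩, by omega⟩
    · exact ⟨Or.inr ⟨by omega, Or.inl (by omega)⟩, by omega⟩
    · exact ⟨Or.inr ⟨by omega, Or.inr ⟨by omega, by omega, h3⟩⟩, by omega⟩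
  · rintro ⟨⟨h, h' | ⟨h1, h2, h3⟩⟩ | ⟨h, h' | ⟨h1, h2, h3⟩⟩, h0⟩
    · exact Or.inl ⟨by omega, Or.inl (by omega)⟩
    · exact Or.inl ⟨by omega, Or.inr ⟨by omega, by omega, h3⟩⟩
    · exact Or.inr ⟨by omega, Or.inl (by omega)⟩
    · exact Or.inr ⟨by omega, Or.inr ⟨by omega, by omega, h3⟩⟩

/-- The index is homogeneous under scaling of all blocks. -/
theorem listIndex_map_mul (K : Type*) [Field K] [CharZero K] (c : ℕ) {n : ℕ} {l m : List ℕ}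
    (hl : l.sum = n) (hm : m.sum = n) :
    listIndex K (c * n) (l.map (c * ·)) (m.map (c * ·)) = c * listIndex K n l m := by
  -- The list lengths must enter the measure. Removing a zero block leaves `n` unchanged, whereas
  -- the reductions with `0 < a < b` lower `n` without increasing the total length.
  induction hN : n + l.length + m.length using Nat.strong_induction_on generalizing n l m with
  | _ N ih =>
  have key : ∀ a l b m, (a :: l).sum = n → (b :: m).sum = n → a ≤ b →
      n + (a :: l).length + (b :: m).length = N →
      listIndex K (c * n) ((a :: l).map (c * ·)) ((b :: m).map (c * ·)) =
        c * listIndex K n (a :: l) (b :: m) := by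
    intro a l b m hl hm hab hN
    simp only [List.sum_cons, List.length_cons] at hl hm hN
    simp only [List.map_cons]
    have hcab : c * a ≤ c * b := Nat.mul_le_mul_left c hab
    have hcbn : c * b ≤ c * n := Nat.mul_le_mul_left c (by omega)
    rcases Nat.eq_zero_or_pos a with rfl | ha
    · have := @ih _ (by simp only [List.length_cons]; omega) n l (b :: m)
        (by omega) (by simp only [List.sum_cons]; omega) rfl
      rw [mul_zero, listIndex_zero_cons, listIndex_zero_cons]
      exact this
    rcases hab.eq_or_lt with rfl | hlt
    · have := @ih _ (by omega) (n - a) l m (by omega) (by omega) rfl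
      rw [listIndex_cons_self K hcbn, listIndex_cons_self K (by omega), ← Nat.mul_sub, this,
        mul_add]
    rcases le_total (2 * a) b with h2 | h2
    · have := @ih _ (by simp only [List.length_cons]; omega) (n - a) l
        ((b - 2 * a) :: a :: m) (by omega) (by simp only [List.sum_cons]; omega) rfl
      have hc2 : 2 * (c * a) ≤ c * b := by
        have := Nat.mul_le_mul_left c h2
        rwa [Nat.mul_left_comm] at this
      rw [listIndex_of_two_mul_le K hc2 hcbn, listIndex_of_two_mul_le K h2 (by omega), ← this,
        ← Nat.mul_sub, Nat.mul_left_comm 2 c a, ← Nat.mul_sub]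
      rfl
    · have := @ih _ (by simp only [List.length_cons]; omega) (n - (b - a))
        ((2 * a - b) :: l) (a :: m) (by simp only [List.sum_cons]; omega)
        (by simp only [List.sum_cons]; omega) rfl
      have hc2 : c * b ≤ 2 * (c * a) := by
        have := Nat.mul_le_mul_left c h2
        rwa [Nat.mul_left_comm] at this
      rw [listIndex_of_le_two_mul K hcab hc2 hcbn, listIndex_of_le_two_mul K hab h2 (by omega),
        ← this, ← Nat.mul_sub, ← Nat.mul_sub, Nat.mul_left_comm 2 c a, ← Nat.mul_sub]
      rfl
  match l, m with
  | [], m =>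
    obtain rfl : n = 0 := hl.symm
    simp [listIndex_zero]
  | a :: l, [] =>
    obtain rfl : n = 0 := hm.symm
    simp [listIndex_zero]
  | a :: l, b :: m =>
    rcases le_total a b with hab | hab
    · exact key a l b m hl hm hab hN
    · rw [← listIndex_swap K (c * n), ← listIndex_swap K n]
      exact key b m a l hm hl hab (by omega)

/-! ### Seaweed algebras and lists -/

theorem composition_index_eq_iff_sameBlock {n : ℕ} (c : Composition n) (i j : Fin n) :
    c.index i = c.index j ↔ SameBlock c.blocks i j := by
  have hsum : ∀ k, (c.blocks.take k).sum = c.sizeUpTo k := fun k => rfl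
  constructor
  · intro h
    have aux : ∀ i j : Fin n, c.index i = c.index j → ∀ k, c.sizeUpTo k ≤ i → c.sizeUpTo k ≤ j := by
      intro i j h k hk
      have h1 := c.lt_sizeUpTo_index_succ i
      have h2 : k ≤ c.index i := by
        by_contra hlt
        have := c.monotone_sizeUpTo (Nat.add_one_le_iff.2 (not_le.1 hlt))
        rw [Fin.val_succ] at h1
        omega
      exact (c.monotone_sizeUpTo h2).trans (h ▸ c.sizeUpTo_index_le j)
    exact fun k => ⟨aux i j h k, aux j i h.symm k⟩
  · have aux : ∀ i j : Fin n, SameBlock c.blocks i j → ¬ c.index i < c.index j := by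
      intro i j h hlt
      have h1 := c.lt_sizeUpTo_index_succ i
      have h2 : c.sizeUpTo (c.index j) ≤ i := (h _).2 (c.sizeUpTo_index_le j)
      have h3 := c.monotone_sizeUpTo (Nat.add_one_le_iff.2 (Fin.lt_def.1 hlt))
      rw [Fin.val_succ] at h1
      omega
    intro h
    exact le_antisymm (not_lt.1 (aux j i h.symm)) (not_lt.1 (aux i j h))

/-- Every linear form on the subalgebra extends to all matrices, so both minima run over the same
stabilizer dimensions. -/
theorem lieIndex_seaweed (K : Type*) [Field K] {n : ℕ} (lam mu : Composition n) :
    lieIndex K (seaweed K lam mu) = listIndex K n lam.blocks mu.blocks := by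
  have hR : (fun i j : Fin n => meanderRel lam.blocks mu.blocks i j) = SeaweedPos lam mu := by
    ext i j
    simp only [SeaweedPos, meanderRel, composition_index_eq_iff_sameBlock, Fin.le_def]
  unfold listIndex lieIndex relIndex
  rw [hR]
  let ι : seaweed K lam mu →ₗ[K] Matrix (Fin n) (Fin n) K :=
    (seaweed K lam mu).toSubmodule.subtype
  have hι : Function.Injective ι := Subtype.val_injective
  have key : ∀ f : Matrix (Fin n) (Fin n) K →ₗ[K] K,
      Module.finrank K (coadjointStabilizer K (seaweed K lam mu) (f ∘ₗ ι)) =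
        Module.finrank K (relStab (SeaweedPos lam mu) f) := by
    intro f
    have hmap : (coadjointStabilizer K (seaweed K lam mu) (f ∘ₗ ι)).map ι =
        relStab (SeaweedPos lam mu) f := by
      ext x
      constructor
      · rintro ⟨⟨x, hx⟩, hst, rfl⟩
        exact ⟨hx, fun y hy => hst ⟨y, hy⟩⟩
      · rintro ⟨hx, hst⟩
        exact ⟨⟨x, hx⟩, fun y => hst y y.2, rfl⟩
    rw [← hmap]
    exact (LinearEquiv.finrank_eq (Submodule.equivMapOfInjective ι hι _))
  congr 1
  ext d
  constructor
  · rintro ⟨f, rfl⟩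
    obtain ⟨g, hg⟩ := LinearMap.exists_extend (p := (seaweed K lam mu).toSubmodule) f
    exact ⟨g, by rw [← hg]; exact (key g).symm⟩
  · rintro ⟨f, rfl⟩
    exact ⟨f ∘ₗ ι, key f⟩

/-! ### Counting series -/

section CountSeries

open MvPowerSeries

/-- The generating function of a set whose elements carry a size and an index. -/
noncomputable def countSeries {α : Type*} (W : Set α) (sz ix : α → ℕ) :
    MvPowerSeries (Fin 2) ℤ :=
  fun d => ({w ∈ W | sz w = d 0 ∧ ix w = d 1}.ncard : ℤ)

theorem coeff_countSeries {α : Type*} (W : Set α) (sz ix : α → ℕ) (d : Fin 2 →₀ ℕ) :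
    coeff d (countSeries W sz ix) = ({w ∈ W | sz w = d 0 ∧ ix w = d 1}.ncard : ℤ) := rfl

theorem X_pow_mul_X_pow_eq_monomial (s q : ℕ) :
    (X 0 ^ s * X 1 ^ q : MvPowerSeries (Fin 2) ℤ) =
      monomial (Finsupp.single 0 s + Finsupp.single 1 q) 1 := by
  rw [X_pow_eq, X_pow_eq, monomial_mul_monomial, mul_one]

theorem coeff_X_pow_mul_X_pow_mul (s q : ℕ) (φ : MvPowerSeries (Fin 2) ℤ) (d : Fin 2 →₀ ℕ) :
    coeff d (X 0 ^ s * X 1 ^ q * φ) =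
      if s ≤ d 0 ∧ q ≤ d 1 then
        coeff (d - (Finsupp.single 0 s + Finsupp.single 1 q)) φ else 0 := by
  have hle : Finsupp.single (0 : Fin 2) s + Finsupp.single 1 q ≤ d ↔ s ≤ d 0 ∧ q ≤ d 1 := by
    rw [Finsupp.le_def, Fin.forall_fin_two]
    simp
  rw [X_pow_mul_X_pow_eq_monomial, coeff_monomial_mul, one_mul]
  simp only [hle]

/-- Finiteness of the level sets is essential, since `ncard` is 0 on infinite sets. -/
theorem countSeries_union {α : Type*} {W W' : Set α} {sz ix : α → ℕ} (h : Disjoint W W')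
    (hf : ∀ n, {w ∈ W | sz w = n}.Finite) (hf' : ∀ n, {w ∈ W' | sz w = n}.Finite) :
    countSeries (W ∪ W') sz ix = countSeries W sz ix + countSeries W' sz ix := by
  ext d
  rw [map_add, coeff_countSeries, coeff_countSeries, coeff_countSeries, ← Nat.cast_add,
    ← Set.ncard_union_eq (h.mono (Set.sep_subset _ _) (Set.sep_subset _ _))
      ((hf (d 0)).subset fun w hw => ⟨hw.1, hw.2.1⟩)
      ((hf' (d 0)).subset fun w hw => ⟨hw.1, hw.2.1⟩)]
  congr 2
  ext w
  simp only [Set.mem_ofPred_eq, Set.mem_union]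
  tauto

/-- Transport of a counting series along an injective map that shifts size and index. -/
theorem countSeries_image {α β : Type*} {W : Set α} {W' : Set β} {sz ix : α → ℕ} {sz' ix' : β → ℕ}
    {s q : ℕ} (e : β → α) (he : Function.Injective e) (hW : e '' W' = W)
    (hsz : ∀ w ∈ W', sz (e w) = s + sz' w) (hix : ∀ w ∈ W', ix (e w) = q + ix' w) :
    countSeries W sz ix = X 0 ^ s * X 1 ^ q * countSeries W' sz' ix' := by
  subst hW
  ext d
  rw [coeff_X_pow_mul_X_pow_mul, coeff_countSeries]
  split_ifs with hd
  · rw [coeff_countSeries, ← Set.ncard_image_of_injective _ he]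
    congr 2
    ext w
    simp only [Set.mem_ofPred_eq, Set.mem_image]
    constructor
    · rintro ⟨⟨v, hv, rfl⟩, h1, h2⟩
      refine ⟨v, ⟨hv, ?_, ?_⟩, rfl⟩
      · have := hsz v hv
        simp
        omega
      · have := hix v hv
        simp
        omega
    · rintro ⟨v, ⟨hv, h1, h2⟩, rfl⟩
      refine ⟨⟨v, hv, rfl⟩, ?_, ?_⟩
      · rw [hsz v hv, h1]
        simp
        omega
      · rw [hix v hv, h2]
        simp
        omega
  · have hempty : {w | w ∈ e '' W' ∧ sz w = d 0 ∧ ix w = d 1} = ∅ := by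
      rw [Set.eq_empty_iff_forall_notMem]
      rintro _ ⟨⟨v, hv, rfl⟩, h1, h2⟩
      have := hsz v hv
      have := hix v hv
      omega
    rw [hempty, Set.ncard_empty, Nat.cast_zero]

theorem countSeries_singleton {α : Type*} {w : α} {sz ix : α → ℕ} (h : sz w = 0)
    (h' : ix w = 0) : countSeries {w} sz ix = 1 := by
  ext d
  rw [coeff_countSeries, coeff_one]
  split_ifs with hd
  · subst hd
    have : {v | v ∈ ({w} : Set α) ∧ sz v = (0 : Fin 2 →₀ ℕ) 0 ∧ ix v = (0 : Fin 2 →₀ ℕ) 1} =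
        {w} := by
      ext v
      constructor
      · exact fun hv => hv.1
      · rintro rfl
        exact ⟨rfl, h, h'⟩
    rw [this, Set.ncard_singleton, Nat.cast_one]
  · have : {v | v ∈ ({w} : Set α) ∧ sz v = d 0 ∧ ix v = d 1} = ∅ := by
      rw [Set.eq_empty_iff_forall_notMem]
      rintro v ⟨rfl, h1, h2⟩
      apply hd
      ext i
      fin_cases i
      · exact h1.symm.trans h
      · exact h2.symm.trans h'
    rw [this, Set.ncard_empty, Nat.cast_zero]

end CountSeries

/-! ### Pairs of lists with an overhang -/

section Overhang

open MvPowerSeries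

/-- All entries of both lists lie in `J`. -/
def PartsIn (J : Set ℕ) (w : List ℕ × List ℕ) : Prop :=
  (∀ b ∈ w.1, b ∈ J) ∧ (∀ b ∈ w.2, b ∈ J)

theorem finite_setOf_list_sum_eq (n : ℕ) : {l : List ℕ | (∀ b ∈ l, 0 < b) ∧ l.sum = n}.Finite := by
  refine (Set.finite_range fun c : Composition n => c.blocks).subset ?_
  rintro l ⟨hl, hs⟩
  exact ⟨⟨l, fun {b} hb => hl b hb, hs⟩, rfl⟩

theorem finite_setOf_pair {J : Set ℕ} (hJ : ∀ b ∈ J, 0 < b) {W : Set (List ℕ × List ℕ)}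
    (hW : ∀ w ∈ W, PartsIn J w ∧ w.2.sum ≤ w.1.sum) (n : ℕ) : {w ∈ W | w.1.sum = n}.Finite := by
  refine ((finite_setOf_list_sum_eq n).prod
    ((Set.finite_Iic n).biUnion fun k _ => finite_setOf_list_sum_eq k)).subset ?_
  rintro w ⟨hw, hn⟩
  obtain ⟨hp, hle⟩ := hW w hw
  refine ⟨⟨fun b hb => hJ b (hp.1 b hb), hn⟩, ?_⟩
  rw [Set.mem_iUnion₂]
  exact ⟨w.2.sum, hn ▸ hle, fun b hb => hJ b (hp.2 b hb), rfl⟩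

/-- A condition `P d l m` on pairs of lists with `l` starting `d` nodes behind `m`, compatible with
removing the first entry of `l`; once both lists reach the same node the condition becomes `Q`. -/
structure IsOverhangCond (P : ℕ → List ℕ → List ℕ → Prop) (Q : List ℕ → List ℕ → Prop) :
    Prop where
  swap : ∀ d p l m, 0 < d → d < p → (P d (p :: l) m ↔ P (p - d) m l)
  keep : ∀ d p l m, 0 < p → p < d → (P d (p :: l) m ↔ P (d - p) l m)
  close : ∀ d l m, 0 < d → (P d (d :: l) m ↔ Q l m)

variable (K : Type*) [Field K] (J : Set ℕ) (P : ℕ → List ℕ → List ℕ → Prop)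

/-- The pairs of lists `(l, m)` with entries in `J` such that `l` and `o ++ m` have the same sum
and satisfy the condition `P`. -/
def overhangSet (o : List ℕ) : Set (List ℕ × List ℕ) :=
  {w | PartsIn J w ∧ w.1.sum = o.sum + w.2.sum ∧ P o.sum w.1 w.2}

/-- The counting series of the pairs `(l, o ++ m)`. -/
noncomputable def overhangSeries (o : List ℕ) : MvPowerSeries (Fin 2) ℤ :=
  countSeries (overhangSet J P o) (fun w => w.1.sum)
    fun w => listIndex K w.1.sum w.1 (o ++ w.2)

/-- The part of `overhangSet` with first entry `p`. -/
def overhangHead (o : List ℕ) (p : ℕ) : Set (List ℕ × List ℕ) :=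
  {w | w ∈ overhangSet J P o ∧ ∃ l, w.1 = p :: l}

/-- The counting series of `overhangHead`. -/
noncomputable def headSeries (o : List ℕ) (p : ℕ) : MvPowerSeries (Fin 2) ℤ :=
  countSeries (overhangHead J P o p) (fun w => w.1.sum)
    fun w => listIndex K w.1.sum w.1 (o ++ w.2)

/-- The pairs of lists of the same sum that satisfy `Q`. -/
def balancedSet (Q : List ℕ → List ℕ → Prop) : Set (List ℕ × List ℕ) :=
  {w | PartsIn J w ∧ w.1.sum = w.2.sum ∧ Q w.1 w.2}

/-- The counting series of `balancedSet`. -/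
noncomputable def balancedSeries (Q : List ℕ → List ℕ → Prop) : MvPowerSeries (Fin 2) ℤ :=
  countSeries (balancedSet J Q) (fun w => w.1.sum) fun w => listIndex K w.1.sum w.1 w.2

variable {J P}

theorem partsIn_cons_left {p : ℕ} {l m : List ℕ} :
    PartsIn J (p :: l, m) ↔ p ∈ J ∧ PartsIn J (l, m) := by
  simp only [PartsIn, List.forall_mem_cons]
  tauto

theorem partsIn_cons_right {p : ℕ} {l m : List ℕ} :
    PartsIn J (l, p :: m) ↔ p ∈ J ∧ PartsIn J (l, m) := by
  simp only [PartsIn, List.forall_mem_cons]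
  tauto

theorem partsIn_swap {l m : List ℕ} : PartsIn J (l, m) ↔ PartsIn J (m, l) := and_comm

theorem overhangSeries_eq_add {a b : ℕ} (ha : 0 < a) (hb : 0 < b) (hab : a ≠ b) {o : List ℕ}
    (ho : 0 < o.sum) :
    overhangSeries K {a, b} P o = headSeries K {a, b} P o a + headSeries K {a, b} P o b := by
  have hJ : ∀ c ∈ ({a, b} : Set ℕ), 0 < c := by
    rintro c (rfl | rfl) <;> assumption
  have hU : overhangSet {a, b} P o =
      overhangHead {a, b} P o a ∪ overhangHead {a, b} P o b := by
    ext ⟨l, m⟩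
    constructor
    · intro hw
      match l, hw with
      | [], hw =>
        have := hw.2.1
        simp only [List.sum_nil] at this
        omega
      | c :: l, hw =>
        rcases hw.1.1 c (by simp) with h | h
        · exact Or.inl ⟨hw, l, by rw [h]⟩
        · exact Or.inr ⟨hw, l, by rw [Set.mem_singleton_iff.1 h]⟩
    · rintro (hw | hw) <;> exact hw.1
  have hfin : ∀ c n, {w ∈ overhangHead {a, b} P o c | w.1.sum = n}.Finite := fun c =>
    finite_setOf_pair hJ fun w hw => ⟨hw.1.1, by have := hw.1.2.1; omega⟩
  rw [overhangSeries, hU, countSeries_union _ (hfin a) (hfin b)]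
  · rfl
  · rw [Set.disjoint_left]
    rintro ⟨l, m⟩ ⟨-, l₁, h₁⟩ ⟨-, l₂, h₂⟩
    have h₁ : l = a :: l₁ := h₁
    have h₂ : l = b :: l₂ := h₂
    rw [h₁] at h₂
    exact hab (List.cons.inj h₂).1

variable {Q : List ℕ → List ℕ → Prop}

/-- The block `p` reaches beyond the overhang: the other list is now the one behind, by `p - o.sum`
nodes, so the two lists exchange roles. Only `o.sum` nodes have been completed, hence that power of
`x`. The hypothesis `hix` supplies the reduction of the index. -/
theorem headSeries_swap (h : IsOverhangCond P Q) {o o' : List ℕ} {p q : ℕ} (hp : p ∈ J)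
    (ho : 0 < o.sum) (hop : o.sum + o'.sum = p) (ho' : 0 < o'.sum)
    (hix : ∀ l m, p + l.sum = o.sum + m.sum → listIndex K (o.sum + m.sum) (p :: l) (o ++ m) =
      q + listIndex K m.sum m (o' ++ l)) :
    headSeries K J P o p = X 0 ^ o.sum * X 1 ^ q * overhangSeries K J P o' := by
  have hP : ∀ l m, P o.sum (p :: l) m ↔ P o'.sum m l := fun l m => by
    rw [h.swap _ _ _ _ ho (by omega)]
    have : p - o.sum = o'.sum := by omega
    rw [this]
  have hsum : ∀ w ∈ overhangSet J P o', p + w.2.sum = o.sum + w.1.sum := fun w hw => by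
    have := hw.2.1
    omega
  refine countSeries_image (fun w => (p :: w.2, w.1)) ?_ ?_ ?_ ?_
  · rintro ⟨l, m⟩ ⟨l', m'⟩ h'
    simp only [Prod.mk.injEq, List.cons.injEq, true_and] at h'
    rw [h'.1, h'.2]
  · ext ⟨l, m⟩
    constructor
    · rintro ⟨w, hw, hw'⟩
      obtain ⟨rfl, rfl⟩ := Prod.mk.inj hw'
      refine ⟨⟨partsIn_cons_left.2 ⟨hp, partsIn_swap.1 hw.1⟩, ?_, (hP _ _).2 hw.2.2⟩, _, rfl⟩
      simp only [List.sum_cons]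
      exact hsum w hw
    · rintro ⟨⟨h1, h2, h3⟩, l, rfl⟩
      refine ⟨(m, l), ⟨partsIn_swap.1 (partsIn_cons_left.1 h1).2, ?_, (hP _ _).1 h3⟩, rfl⟩
      simp only [List.sum_cons] at h2 ⊢
      omega
  · intro w hw
    simp only [List.sum_cons]
    exact hsum w hw
  · intro w hw
    simp only [List.sum_cons]
    rw [hsum w hw]
    exact hix _ _ (hsum w hw)

/-- The block `p` falls short of the overhang, so the same list stays behind. -/
theorem headSeries_keep (h : IsOverhangCond P Q) {o o' : List ℕ} {p q : ℕ} (hp : p ∈ J)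
    (hp0 : 0 < p) (hop : p + o'.sum = o.sum) (ho' : 0 < o'.sum)
    (hix : ∀ l m, p + l.sum = o.sum + m.sum → listIndex K (p + l.sum) (p :: l) (o ++ m) =
      q + listIndex K l.sum l (o' ++ m)) :
    headSeries K J P o p = X 0 ^ p * X 1 ^ q * overhangSeries K J P o' := by
  have hP : ∀ l m, P o.sum (p :: l) m ↔ P o'.sum l m := fun l m => by
    rw [h.keep _ _ _ _ hp0 (by omega)]
    have : o.sum - p = o'.sum := by omega
    rw [this]
  refine countSeries_image (fun w => (p :: w.1, w.2)) ?_ ?_ ?_ ?_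
  · rintro ⟨l, m⟩ ⟨l', m'⟩ h'
    simp only [Prod.mk.injEq, List.cons.injEq, true_and] at h'
    rw [h'.1, h'.2]
  · ext ⟨l, m⟩
    constructor
    · rintro ⟨w, hw, hw'⟩
      obtain ⟨rfl, rfl⟩ := Prod.mk.inj hw'
      refine ⟨⟨partsIn_cons_left.2 ⟨hp, hw.1⟩, ?_, (hP _ _).2 hw.2.2⟩, _, rfl⟩
      have := hw.2.1
      simp only [List.sum_cons]
      omega
    · rintro ⟨⟨h1, h2, h3⟩, l, rfl⟩
      refine ⟨(l, m), ⟨(partsIn_cons_left.1 h1).2, ?_, (hP _ _).1 h3⟩, rfl⟩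
      simp only [List.sum_cons] at h2 ⊢
      omega
  · intro w _
    simp only [List.sum_cons]
  · intro w hw
    have := hw.2.1
    simp only [List.sum_cons]
    exact hix _ _ (by omega)

/-- The block `p` exactly fills the overhang: both lists reach a common cut and a balanced pair
remains. -/
theorem headSeries_close (h : IsOverhangCond P Q) {o : List ℕ} {p q : ℕ} (hp : p ∈ J)
    (hp0 : 0 < p) (hop : p = o.sum)
    (hix : ∀ l m, l.sum = m.sum → listIndex K (p + l.sum) (p :: l) (o ++ m) =
      q + listIndex K l.sum l m) :
    headSeries K J P o p = X 0 ^ p * X 1 ^ q * balancedSeries K J Q := by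
  have hP : ∀ l m, P o.sum (p :: l) m ↔ Q l m := fun l m => by
    rw [← hop]
    exact h.close _ _ _ hp0
  refine countSeries_image (fun w => (p :: w.1, w.2)) ?_ ?_ ?_ ?_
  · rintro ⟨l, m⟩ ⟨l', m'⟩ h'
    simp only [Prod.mk.injEq, List.cons.injEq, true_and] at h'
    rw [h'.1, h'.2]
  · ext ⟨l, m⟩
    constructor
    · rintro ⟨w, hw, hw'⟩
      obtain ⟨rfl, rfl⟩ := Prod.mk.inj hw'
      refine ⟨⟨partsIn_cons_left.2 ⟨hp, hw.1⟩, ?_, (hP _ _).2 hw.2.2⟩, _, rfl⟩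
      have := hw.2.1
      simp only [List.sum_cons]
      omega
    · rintro ⟨⟨h1, h2, h3⟩, l, rfl⟩
      refine ⟨(l, m), ⟨(partsIn_cons_left.1 h1).2, ?_, (hP _ _).1 h3⟩, rfl⟩
      simp only [List.sum_cons] at h2 ⊢
      omega
  · intro w _
    simp only [List.sum_cons]
  · intro w hw
    simp only [List.sum_cons]
    exact hix _ _ hw.2.1

end Overhang

section Balanced

open MvPowerSeries

variable (K : Type*) [Field K] {J : Set ℕ} {P : ℕ → List ℕ → List ℕ → Prop}
  {Q Q₀ : List ℕ → List ℕ → Prop}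

/-- A condition `Q₀` on nonempty pairs of lists that becomes `P` or `Q` once the first entries
have been removed. -/
structure IsBalancedCond (P : ℕ → List ℕ → List ℕ → Prop) (Q Q₀ : List ℕ → List ℕ → Prop) :
    Prop where
  not_nil : ¬ Q₀ [] []
  same : ∀ p l m, 0 < p → (Q₀ (p :: l) (p :: m) ↔ Q l m)
  lt : ∀ p q l m, 0 < p → p < q → (Q₀ (p :: l) (q :: m) ↔ P (q - p) l m)
  gt : ∀ p q l m, 0 < q → q < p → (Q₀ (p :: l) (q :: m) ↔ P (p - q) m l)

/-- The balanced pairs with first entries `p` and `q`. -/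
def balancedHead (J : Set ℕ) (Q₀ : List ℕ → List ℕ → Prop) (p q : ℕ) : Set (List ℕ × List ℕ) :=
  {w | w ∈ balancedSet J Q₀ ∧ ∃ l m, w = (p :: l, q :: m)}

theorem countSeries_balancedHead_self [CharZero K] (h : IsBalancedCond P Q Q₀) {p : ℕ} (hp : p ∈ J)
    (hp0 : 0 < p) :
    countSeries (balancedHead J Q₀ p p) (fun w => w.1.sum)
      (fun w => listIndex K w.1.sum w.1 w.2) = X 0 ^ p * X 1 ^ p * balancedSeries K J Q := by
  refine countSeries_image (fun w => (p :: w.1, p :: w.2)) ?_ ?_ ?_ ?_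
  · rintro ⟨l, m⟩ ⟨l', m'⟩ h'
    simp only [Prod.mk.injEq, List.cons.injEq, true_and] at h'
    rw [h'.1, h'.2]
  · ext w
    constructor
    · rintro ⟨⟨l, m⟩, ⟨h1, h2, h3⟩, rfl⟩
      refine ⟨⟨partsIn_cons_left.2 ⟨hp, partsIn_cons_right.2 ⟨hp, h1⟩⟩, ?_,
        (h.same _ _ _ hp0).2 h3⟩, _, _, rfl⟩
      simp only [List.sum_cons]
      exact congrArg _ h2
    · rintro ⟨⟨h1, h2, h3⟩, l, m, rfl⟩
      refine ⟨(l, m), ⟨(partsIn_cons_right.1 (partsIn_cons_left.1 h1).2).2, ?_,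
        (h.same _ _ _ hp0).1 h3⟩, rfl⟩
      simp only [List.sum_cons] at h2 ⊢
      omega
  · intro w _
    simp only [List.sum_cons]
  · intro w _
    simp only [List.sum_cons]
    rw [listIndex_cons_self K (by omega), Nat.add_sub_cancel_left]

theorem countSeries_balancedHead_lt (h : IsBalancedCond P Q Q₀) {p q : ℕ} (hp : p ∈ J)
    (hq : q ∈ J) (hp0 : 0 < p) (hpq : p < q) {o : List ℕ} (ho : p + o.sum = q)
    (hix : ∀ l m, p + l.sum = q + m.sum → listIndex K (p + l.sum) (p :: l) (q :: m) =
      listIndex K l.sum l (o ++ m)) :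
    countSeries (balancedHead J Q₀ p q) (fun w => w.1.sum)
      (fun w => listIndex K w.1.sum w.1 w.2) = X 0 ^ p * X 1 ^ 0 * overhangSeries K J P o := by
  have hP : ∀ l m, Q₀ (p :: l) (q :: m) ↔ P o.sum l m := fun l m => by
    rw [h.lt _ _ _ _ hp0 hpq]
    have : q - p = o.sum := by omega
    rw [this]
  refine countSeries_image (fun w => (p :: w.1, q :: w.2)) ?_ ?_ ?_ ?_
  · rintro ⟨l, m⟩ ⟨l', m'⟩ h'
    simp only [Prod.mk.injEq, List.cons.injEq, true_and] at h'
    rw [h'.1, h'.2]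
  · ext w
    constructor
    · rintro ⟨⟨l, m⟩, ⟨h1, h2, h3⟩, rfl⟩
      refine ⟨⟨partsIn_cons_left.2 ⟨hp, partsIn_cons_right.2 ⟨hq, h1⟩⟩, ?_,
        (hP _ _).2 h3⟩, _, _, rfl⟩
      simp only [List.sum_cons] at h2 ⊢
      omega
    · rintro ⟨⟨h1, h2, h3⟩, l, m, rfl⟩
      refine ⟨(l, m), ⟨(partsIn_cons_right.1 (partsIn_cons_left.1 h1).2).2, ?_,
        (hP _ _).1 h3⟩, rfl⟩
      simp only [List.sum_cons] at h2 ⊢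
      omega
  · intro w _
    simp only [List.sum_cons]
  · intro w hw
    have := hw.2.1
    simp only [List.sum_cons]
    rw [hix _ _ (by omega), zero_add]

theorem countSeries_balancedHead_gt (h : IsBalancedCond P Q Q₀) {p q : ℕ} (hp : p ∈ J)
    (hq : q ∈ J) (hp0 : 0 < p) (hpq : p < q) {o : List ℕ} (ho : p + o.sum = q)
    (hix : ∀ l m, p + l.sum = q + m.sum → listIndex K (p + l.sum) (p :: l) (q :: m) =
      listIndex K l.sum l (o ++ m)) :
    countSeries (balancedHead J Q₀ q p) (fun w => w.1.sum)
      (fun w => listIndex K w.1.sum w.1 w.2) = X 0 ^ p * X 1 ^ 0 * overhangSeries K J P o := by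
  have hP : ∀ l m, Q₀ (q :: m) (p :: l) ↔ P o.sum l m := fun l m => by
    rw [h.gt _ _ _ _ hp0 hpq]
    have : q - p = o.sum := by omega
    rw [this]
  refine countSeries_image (fun w => (q :: w.2, p :: w.1)) ?_ ?_ ?_ ?_
  · rintro ⟨l, m⟩ ⟨l', m'⟩ h'
    simp only [Prod.mk.injEq, List.cons.injEq, true_and] at h'
    rw [h'.1, h'.2]
  · ext w
    constructor
    · rintro ⟨⟨l, m⟩, ⟨h1, h2, h3⟩, rfl⟩
      refine ⟨⟨partsIn_cons_left.2 ⟨hq, partsIn_cons_right.2 ⟨hp, partsIn_swap.1 h1⟩⟩, ?_,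
        (hP _ _).2 h3⟩, _, _, rfl⟩
      simp only [List.sum_cons] at h2 ⊢
      omega
    · rintro ⟨⟨h1, h2, h3⟩, l, m, rfl⟩
      refine ⟨(m, l), ⟨partsIn_swap.1 (partsIn_cons_right.1 (partsIn_cons_left.1 h1).2).2, ?_,
        (hP _ _).1 h3⟩, rfl⟩
      simp only [List.sum_cons] at h2 ⊢
      omega
  · intro w hw
    have := hw.2.1
    simp only [List.sum_cons]
    omega
  · intro w hw
    have := hw.2.1
    simp only [List.sum_cons]
    have e : q + w.2.sum = p + w.1.sum := by omega
    rw [e, listIndex_swap, hix _ _ (by omega), zero_add]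

/-- Split by the two first entries. Equal entries split off a full matrix algebra; the two mixed
cases have the same series, because the index is invariant under exchanging the compositions, whence
the factor 2. -/
theorem balancedSeries_eq [CharZero K] (h : IsBalancedCond P Q Q₀) {a b : ℕ} (ha : 0 < a)
    (hab : a < b) {o : List ℕ} (ho : a + o.sum = b)
    (hix : ∀ l m, a + l.sum = b + m.sum → listIndex K (a + l.sum) (a :: l) (b :: m) =
      listIndex K l.sum l (o ++ m)) :
    balancedSeries K {a, b} Q₀ =
      (X 0 ^ a * X 1 ^ a + X 0 ^ b * X 1 ^ b) * balancedSeries K {a, b} Q +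
        2 * X 0 ^ a * overhangSeries K {a, b} P o := by
  have hJ : ∀ c ∈ ({a, b} : Set ℕ), 0 < c := by
    rintro c (rfl | rfl) <;> omega
  have haJ : a ∈ ({a, b} : Set ℕ) := Or.inl rfl
  have hbJ : b ∈ ({a, b} : Set ℕ) := Or.inr rfl
  have hU : balancedSet {a, b} Q₀ =
      (balancedHead {a, b} Q₀ a a ∪ balancedHead {a, b} Q₀ b b) ∪
        (balancedHead {a, b} Q₀ a b ∪ balancedHead {a, b} Q₀ b a) := by
    ext ⟨l, m⟩
    constructor
    · intro hw
      match l, m, hw with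
      | [], [], hw => exact absurd hw.2.2 h.not_nil
      | [], d :: m, hw =>
        have h1 := hw.2.1
        have h2 := hJ d (hw.1.2 d (by simp))
        simp only [List.sum_nil, List.sum_cons] at h1
        omega
      | c :: l, [], hw =>
        have h1 := hw.2.1
        have h2 := hJ c (hw.1.1 c (by simp))
        simp only [List.sum_nil, List.sum_cons] at h1
        omega
      | c :: l, d :: m, hw =>
        have hc := hw.1.1 c (by simp)
        have hd := hw.1.2 d (by simp)
        have key : ∀ c' d', c = c' → d = d' → (c :: l, d :: m) ∈ balancedHead {a, b} Q₀ c' d' := by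
          rintro _ _ rfl rfl
          exact ⟨hw, _, _, rfl⟩
        rcases hc with hc | hc <;> rcases hd with hd | hd
        · exact Or.inl (Or.inl (key _ _ hc hd))
        · exact Or.inr (Or.inl (key _ _ hc hd))
        · exact Or.inr (Or.inr (key _ _ hc hd))
        · exact Or.inl (Or.inr (key _ _ hc hd))
    · rintro ((hw | hw) | (hw | hw)) <;> exact hw.1
  have hdisj : ∀ p q p' q', (p ≠ p' ∨ q ≠ q') →
      Disjoint (balancedHead {a, b} Q₀ p q) (balancedHead {a, b} Q₀ p' q') := by
    intro p q p' q' hne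
    rw [Set.disjoint_left]
    rintro _ ⟨-, l, m, rfl⟩ ⟨-, l', m', h'⟩
    simp only [Prod.mk.injEq, List.cons.injEq] at h'
    tauto
  have hfin : ∀ W ⊆ balancedSet {a, b} Q₀, ∀ n,
      {w ∈ W | w.1.sum = n}.Finite := fun W hW =>
    finite_setOf_pair hJ fun w hw => ⟨(hW hw).1, (hW hw).2.1.ge⟩
  have hsub : ∀ p q, balancedHead {a, b} Q₀ p q ⊆ balancedSet {a, b} Q₀ := fun p q w hw => hw.1
  rw [balancedSeries, hU, countSeries_union _ (hfin _ (Set.union_subset (hsub _ _) (hsub _ _)))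
    (hfin _ (Set.union_subset (hsub _ _) (hsub _ _))),
    countSeries_union (hdisj _ _ _ _ (by omega)) (hfin _ (hsub _ _)) (hfin _ (hsub _ _)),
    countSeries_union (hdisj _ _ _ _ (by omega)) (hfin _ (hsub _ _)) (hfin _ (hsub _ _)),
    countSeries_balancedHead_self K h haJ ha, countSeries_balancedHead_self K h hbJ (by omega),
    countSeries_balancedHead_lt K h haJ hbJ ha hab ho hix,
    countSeries_balancedHead_gt K h haJ hbJ ha hab ho hix]
  · ring
  · rw [Set.disjoint_union_left, Set.disjoint_union_right, Set.disjoint_union_right]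
    refine ⟨⟨?_, ?_⟩, ⟨?_, ?_⟩⟩ <;> exact hdisj _ _ _ _ (by omega)

/-! ### Unrestricted and indecomposable pairs -/

theorem isOverhangCond_true : IsOverhangCond (fun _ _ _ => True) fun _ _ => True :=
  ⟨fun _ _ _ _ _ _ => Iff.rfl, fun _ _ _ _ _ _ => Iff.rfl, fun _ _ _ _ => Iff.rfl⟩

theorem isBalancedCond_ne_nil :
    IsBalancedCond (fun _ _ _ => True) (fun _ _ => True) fun l _ => l ≠ [] :=
  ⟨by simp, by simp, by simp, by simp⟩

/-- With `l` starting `d` nodes behind `m`, the two lists have no common cut before the end. -/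
def NoCut (d : ℕ) (l m : List ℕ) : Prop :=
  ∀ l₁ l₂ m₁ m₂ : List ℕ, l = l₁ ++ l₂ → m = m₁ ++ m₂ → l₁.sum = d + m₁.sum →
    l₂ = [] ∧ m₂ = []

/-- The two lists are nonempty and have no common cut before the end. -/
def IndecPair (l m : List ℕ) : Prop :=
  l ≠ [] ∧ ∀ l₁ l₂ m₁ m₂ : List ℕ, l = l₁ ++ l₂ → m = m₁ ++ m₂ → l₁.sum = m₁.sum →
    l₁ = [] ∨ (l₂ = [] ∧ m₂ = [])

theorem noCut_cons_iff {d p : ℕ} {l m : List ℕ} (hd : 0 < d) :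
    NoCut d (p :: l) m ↔ ∀ l₁ l₂ m₁ m₂ : List ℕ, l = l₁ ++ l₂ → m = m₁ ++ m₂ →
      p + l₁.sum = d + m₁.sum → l₂ = [] ∧ m₂ = [] := by
  constructor
  · intro h l₁ l₂ m₁ m₂ h1 h2 h3
    exact h (p :: l₁) l₂ m₁ m₂ (by rw [h1]; rfl) h2 h3
  · intro h l₁ l₂ m₁ m₂ h1 h2 h3
    match l₁, h1, h3 with
    | [], _, h3 =>
      simp only [List.sum_nil] at h3
      omega
    | c :: l₁, h1, h3 =>
      obtain ⟨rfl, h1'⟩ := List.cons.inj h1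
      exact h l₁ l₂ m₁ m₂ h1' h2 h3

/-- Filling the overhang exactly creates a common cut, which indecomposability permits only at the
very end. -/
theorem isOverhangCond_noCut : IsOverhangCond NoCut fun l m => l = [] ∧ m = [] := by
  refine ⟨?_, ?_, ?_⟩
  · intro d p l m hd hdp
    rw [noCut_cons_iff hd]
    constructor
    · intro h m₁ m₂ l₁ l₂ hm hl hs
      exact (h l₁ l₂ m₁ m₂ hl hm (by omega)).symm
    · intro h l₁ l₂ m₁ m₂ hl hm hs
      exact (h m₁ m₂ l₁ l₂ hm hl (by omega)).symm
  · intro d p l m _ hpd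
    rw [noCut_cons_iff (by omega)]
    constructor
    · intro h l₁ l₂ m₁ m₂ hl hm hs
      exact h l₁ l₂ m₁ m₂ hl hm (by omega)
    · intro h l₁ l₂ m₁ m₂ hl hm hs
      exact h l₁ l₂ m₁ m₂ hl hm (by omega)
  · intro d l m hd
    rw [noCut_cons_iff hd]
    constructor
    · intro h
      exact h [] l [] m rfl rfl rfl
    · rintro ⟨rfl, rfl⟩ l₁ l₂ m₁ m₂ hl hm _
      exact ⟨(List.append_eq_nil_iff.1 hl.symm).2, (List.append_eq_nil_iff.1 hm.symm).2⟩

theorem indecPair_cons_iff {p q : ℕ} {l m : List ℕ} (hp : 0 < p) :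
    IndecPair (p :: l) (q :: m) ↔ ∀ l₁ l₂ m₁ m₂ : List ℕ, l = l₁ ++ l₂ → m = m₁ ++ m₂ →
      p + l₁.sum = q + m₁.sum → l₂ = [] ∧ m₂ = [] := by
  constructor
  · rintro ⟨-, h⟩ l₁ l₂ m₁ m₂ h1 h2 h3
    exact (h (p :: l₁) l₂ (q :: m₁) m₂ (by rw [h1]; rfl) (by rw [h2]; rfl) h3).resolve_left
      (List.cons_ne_nil _ _)
  · refine fun h => ⟨List.cons_ne_nil _ _, fun l₁ l₂ m₁ m₂ h1 h2 h3 => ?_⟩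
    match l₁, m₁, h1, h2, h3 with
    | [], _, _, _, _ => exact Or.inl rfl
    | c :: l₁, [], h1, _, h3 =>
      obtain ⟨rfl, -⟩ := List.cons.inj h1
      simp only [List.sum_cons, List.sum_nil] at h3
      omega
    | c :: l₁, d :: m₁, h1, h2, h3 =>
      obtain ⟨rfl, h1'⟩ := List.cons.inj h1
      obtain ⟨rfl, h2'⟩ := List.cons.inj h2
      exact Or.inr (h l₁ l₂ m₁ m₂ h1' h2' h3)

theorem isBalancedCond_indecPair :
    IsBalancedCond NoCut (fun l m => l = [] ∧ m = []) IndecPair := by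
  refine ⟨fun h => h.1 rfl, ?_, ?_, ?_⟩
  · intro p l m hp
    rw [indecPair_cons_iff hp]
    constructor
    · intro h
      exact h [] l [] m rfl rfl rfl
    · rintro ⟨rfl, rfl⟩ l₁ l₂ m₁ m₂ hl hm _
      exact ⟨(List.append_eq_nil_iff.1 hl.symm).2, (List.append_eq_nil_iff.1 hm.symm).2⟩
  · intro p q l m hp hpq
    rw [indecPair_cons_iff hp]
    constructor
    · intro h l₁ l₂ m₁ m₂ hl hm hs
      exact h l₁ l₂ m₁ m₂ hl hm (by omega)
    · intro h l₁ l₂ m₁ m₂ hl hm hs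
      exact h l₁ l₂ m₁ m₂ hl hm (by omega)
  · intro p q l m hq hqp
    rw [indecPair_cons_iff (by omega)]
    constructor
    · intro h m₁ m₂ l₁ l₂ hm hl hs
      exact (h l₁ l₂ m₁ m₂ hl hm (by omega)).symm
    · intro h l₁ l₂ m₁ m₂ hl hm hs
      exact (h m₁ m₂ l₁ l₂ hm hl (by omega)).symm

theorem balancedSeries_nil (J : Set ℕ) :
    balancedSeries K J (fun l m => l = [] ∧ m = []) = 1 := by
  have : balancedSet J (fun l m => l = [] ∧ m = []) = {([], [])} := by
    ext ⟨l, m⟩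
    constructor
    · rintro ⟨-, -, h1, h2⟩
      exact Prod.ext h1 h2
    · intro h
      obtain ⟨rfl, rfl⟩ := Prod.mk.inj h
      exact ⟨⟨by simp, by simp⟩, rfl, rfl, rfl⟩
  rw [balancedSeries, this]
  exact countSeries_singleton rfl (listIndex_zero K _ _)

theorem balancedSeries_true {J : Set ℕ} (hJ : ∀ b ∈ J, 0 < b) :
    balancedSeries K J (fun _ _ => True) = 1 + balancedSeries K J fun l _ => l ≠ [] := by
  have hU : balancedSet J (fun _ _ => True) =
      balancedSet J (fun l m => l = [] ∧ m = []) ∪ balancedSet J fun l _ => l ≠ [] := by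
    ext ⟨l, m⟩
    constructor
    · rintro ⟨h1, h2, -⟩
      by_cases hl : l = []
      · refine Or.inl ⟨h1, h2, hl, ?_⟩
        match m, h1, h2 with
        | [], _, _ => rfl
        | c :: m, h1, h2 =>
          have := hJ c (h1.2 c (by simp))
          simp only [hl, List.sum_nil, List.sum_cons] at h2
          omega
      · exact Or.inr ⟨h1, h2, hl⟩
    · rintro (⟨h1, h2, -⟩ | ⟨h1, h2, -⟩) <;> exact ⟨h1, h2, trivial⟩
  have hfin : ∀ Q : List ℕ → List ℕ → Prop, ∀ n, {w ∈ balancedSet J Q | w.1.sum = n}.Finite :=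
    fun Q => finite_setOf_pair hJ fun w hw => ⟨hw.1, hw.2.1.ge⟩
  rw [← balancedSeries_nil K J, balancedSeries, hU, countSeries_union _ (hfin _) (hfin _)]
  · rfl
  · rw [Set.disjoint_left]
    exact fun w h1 h2 => h2.2.2 h1.2.2.1

/-! ### Meanders and pairs of lists -/

theorem meanderCount_eq {J : Set ℕ} (hJ : ∀ b ∈ J, 0 < b) (d : Fin 2 →₀ ℕ) :
    (meanderCount K J (d 0) (d 1) : ℤ) =
      coeff d (balancedSeries K J fun _ _ => True) := by
  rw [balancedSeries, coeff_countSeries, meanderCount]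
  have hinj : Function.Injective fun M : Meander (d 0) => (M.1.blocks, M.2.blocks) := by
    rintro ⟨a, b⟩ ⟨a', b'⟩ h
    exact Prod.ext (Composition.ext (Prod.mk.inj h).1) (Composition.ext (Prod.mk.inj h).2)
  rw [← Set.ncard_image_of_injective _ hinj]
  congr 2
  ext ⟨l, m⟩
  constructor
  · rintro ⟨M, ⟨h1, h2⟩, h3⟩
    obtain ⟨rfl, rfl⟩ := Prod.mk.inj h3
    refine ⟨⟨h1, by rw [M.1.blocks_sum, M.2.blocks_sum], trivial⟩, M.1.blocks_sum, ?_⟩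
    rw [← h2, meanderIndex, lieIndex_seaweed]
    simp only [M.1.blocks_sum]
  · rintro ⟨⟨h1, h2, -⟩, h3, h4⟩
    have h3 : l.sum = d 0 := h3
    have h2 : l.sum = m.sum := h2
    refine ⟨(⟨l, fun {b} hb => hJ b (h1.1 b hb), h3⟩,
      ⟨m, fun {b} hb => hJ b (h1.2 b hb), h2 ▸ h3⟩), ⟨h1, ?_⟩, rfl⟩
    have h4 : listIndex K l.sum l m = d 1 := h4
    rw [meanderIndex, lieIndex_seaweed]
    rwa [h3] at h4

/-- Blocks are positive, so a summand is strictly smaller exactly when the complementary summand is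
nonempty. -/
theorem meanderIndecomposable_iff {n : ℕ} (M : Meander n) :
    MeanderIndecomposable M ↔ IndecPair M.1.blocks M.2.blocks := by
  have hs1 := M.1.blocks_sum
  have hs2 := M.2.blocks_sum
  have hnil : ∀ l : List ℕ, (∀ b ∈ l, 0 < b) → l.sum = 0 → l = [] := by
    intro l hl h0
    match l with
    | [] => rfl
    | c :: l =>
      have := hl c (by simp)
      simp only [List.sum_cons] at h0
      omega
  constructor
  · rintro ⟨hn, h⟩
    refine ⟨fun h0 => by rw [h0] at hs1; simp only [List.sum_nil] at hs1; omega,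
      fun l₁ l₂ m₁ m₂ hl hm hs => ?_⟩
    have hl0 : ∀ b ∈ l₁ ++ l₂, 0 < b := fun b hb => M.1.blocks_pos (hl ▸ hb)
    have hm0 : ∀ b ∈ m₁ ++ m₂, 0 < b := fun b hb => M.2.blocks_pos (hm ▸ hb)
    simp only [List.mem_append] at hl0 hm0
    rw [hl, List.sum_append] at hs1
    rw [hm, List.sum_append] at hs2
    by_contra hcon
    rw [not_or] at hcon
    have hl1 : l₁.sum ≠ 0 := fun h0 => hcon.1 (hnil _ (fun b hb => hl0 b (Or.inl hb)) h0)
    have hl2 : l₂.sum ≠ 0 := fun h0 => hcon.2 ⟨hnil _ (fun b hb => hl0 b (Or.inr hb)) h0,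
      hnil _ (fun b hb => hm0 b (Or.inr hb)) (by omega)⟩
    exact h ⟨l₁.sum, l₂.sum, by omega, by omega,
      (⟨l₁, fun {b} hb => hl0 b (Or.inl hb), rfl⟩, ⟨m₁, fun {b} hb => hm0 b (Or.inl hb), hs.symm⟩),
      (⟨l₂, fun {b} hb => hl0 b (Or.inr hb), rfl⟩,
        ⟨m₂, fun {b} hb => hm0 b (Or.inr hb), by omega⟩), hl, hm⟩
  · rintro ⟨hne, h⟩
    refine ⟨?_, ?_⟩
    · by_contra hn
      exact hne (hnil _ (fun b hb => M.1.blocks_pos hb) (by omega))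
    · rintro ⟨m, p, hm, hp, M₁, M₂, h1, h2⟩
      have e1 := M₁.1.blocks_sum
      have e2 := M₂.1.blocks_sum
      rw [h1, List.sum_append, e1, e2] at hs1
      rcases h _ _ _ _ h1 h2 (by rw [M₁.1.blocks_sum, M₁.2.blocks_sum]) with h3 | ⟨h3, -⟩
      · rw [h3, List.sum_nil] at e1
        omega
      · rw [h3, List.sum_nil] at e2
        omega

theorem indecMeanderCount_eq {J : Set ℕ} (hJ : ∀ b ∈ J, 0 < b) (d : Fin 2 →₀ ℕ) :
    (indecMeanderCount K J (d 0) (d 1) : ℤ) = coeff d (balancedSeries K J IndecPair) := by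
  rw [balancedSeries, coeff_countSeries, indecMeanderCount]
  have hinj : Function.Injective fun M : Meander (d 0) => (M.1.blocks, M.2.blocks) := by
    rintro ⟨a, b⟩ ⟨a', b'⟩ h
    exact Prod.ext (Composition.ext (Prod.mk.inj h).1) (Composition.ext (Prod.mk.inj h).2)
  rw [← Set.ncard_image_of_injective _ hinj]
  congr 2
  ext ⟨l, m⟩
  constructor
  · rintro ⟨M, ⟨h0, h1, h2⟩, h3⟩
    obtain ⟨rfl, rfl⟩ := Prod.mk.inj h3
    refine ⟨⟨h1, by rw [M.1.blocks_sum, M.2.blocks_sum], (meanderIndecomposable_iff M).1 h0⟩,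
      M.1.blocks_sum, ?_⟩
    rw [← h2, meanderIndex, lieIndex_seaweed]
    simp only [M.1.blocks_sum]
  · rintro ⟨⟨h1, h2, h0⟩, h3, h4⟩
    have h3 : l.sum = d 0 := h3
    have h2 : l.sum = m.sum := h2
    refine ⟨(⟨l, fun {b} hb => hJ b (h1.1 b hb), h3⟩,
      ⟨m, fun {b} hb => hJ b (h1.2 b hb), h2 ▸ h3⟩),
      ⟨(meanderIndecomposable_iff _).2 h0, h1, ?_⟩, rfl⟩
    have h4 : listIndex K l.sum l m = d 1 := h4
    rw [meanderIndex, lieIndex_seaweed]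
    rwa [h3] at h4

end Balanced

/-! ### The blocks 1, 3 and 4 -/

section Rules

variable (K : Type*) [Field K] [CharZero K]

/-- This and the next two rules restate the reductions with the new sizes as variables, so that
chains of rewrites avoid truncated subtraction. -/
theorem listIndex_double {n a b k c : ℕ} (hk : n = k + a) (hc : b = 2 * a + c) (hbn : b ≤ n)
    (l m : List ℕ) : listIndex K n (a :: l) (b :: m) = listIndex K k l (c :: a :: m) := by
  have := CharZero.infinite K
  subst hk hc
  rw [listIndex_of_two_mul_le K (by omega) hbn, Nat.add_sub_cancel, Nat.add_sub_cancel_left]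

theorem listIndex_shrink {n a b k c : ℕ} (hk : n + a = k + b) (hab : a ≤ b) (hc : 2 * a = b + c)
    (hbn : b ≤ n) (l m : List ℕ) :
    listIndex K n (a :: l) (b :: m) = listIndex K k (c :: l) (a :: m) := by
  have := CharZero.infinite K
  rw [listIndex_of_le_two_mul K hab (by omega) hbn]
  congr 2 <;> omega

theorem listIndex_cancel {n a k : ℕ} (hk : n = k + a) (l m : List ℕ) :
    listIndex K n (a :: l) (a :: m) = a + listIndex K k l m := by
  subst hk
  rw [listIndex_cons_self K (by omega), Nat.add_sub_cancel]

omit [CharZero K] in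
theorem listIndex_cons_zero (n : ℕ) (l m : List ℕ) :
    listIndex K n l (0 :: m) = listIndex K n l m := by
  rw [← listIndex_swap, listIndex_zero_cons, listIndex_swap]

/-- From here to `listIndex_four_two_one`, a block 3 or 4 is read against one of the overhangs
`[1]`, `[1, 1]`, `[2, 1]`. The leading summand, even when it is 0, is the exponent of `y` in the
transition. -/
theorem listIndex_three_one {n k : ℕ} (hk : n = k + 1) (h : 3 ≤ n) (l m : List ℕ) :
    listIndex K n (3 :: l) (1 :: m) = 0 + listIndex K k m (1 :: 1 :: l) := by
  rw [← listIndex_swap, listIndex_double K hk (c := 1) rfl h, zero_add]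

theorem listIndex_four_one {n k : ℕ} (hk : n = k + 1) (h : 4 ≤ n) (l m : List ℕ) :
    listIndex K n (4 :: l) (1 :: m) = 0 + listIndex K k m (2 :: 1 :: l) := by
  rw [← listIndex_swap, listIndex_double K hk (c := 2) rfl h, zero_add]

theorem listIndex_three_one_one {n k : ℕ} (hk : n = k + 2) (h : 3 ≤ n) (l m : List ℕ) :
    listIndex K n (3 :: l) (1 :: 1 :: m) = 1 + listIndex K k m (1 :: l) := by
  rw [← listIndex_swap, listIndex_double K (k := k + 1) hk (c := 1) rfl h,
    listIndex_cancel K rfl]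

theorem listIndex_four_one_one {n k : ℕ} (hk : n = k + 2) (h : 4 ≤ n) (l m : List ℕ) :
    listIndex K n (4 :: l) (1 :: 1 :: m) = 0 + listIndex K k m (1 :: 1 :: l) := by
  rw [← listIndex_swap, listIndex_double K (k := k + 1) hk (c := 2) rfl h,
    listIndex_double K (k := k) rfl (c := 0) rfl (by omega), listIndex_cons_zero, zero_add]

theorem listIndex_three_two_one {n k : ℕ} (hk : n = k + 3) (l m : List ℕ) :
    listIndex K n (3 :: l) (2 :: 1 :: m) = 1 + listIndex K k l m := by
  rw [← listIndex_swap, listIndex_shrink K (k := k + 2) (by omega) (by omega) (c := 1) rfl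
      (by omega), listIndex_double K (n := k + 2) (a := 1) (b := 2) (k := k + 1) (c := 0) rfl rfl
      (by omega), listIndex_cons_zero,
    listIndex_cancel K rfl, listIndex_swap]

theorem listIndex_four_two_one {n k : ℕ} (hk : n = k + 3) (h : 4 ≤ n) (l m : List ℕ) :
    listIndex K n (4 :: l) (2 :: 1 :: m) = 0 + listIndex K k m (1 :: l) := by
  rw [← listIndex_swap, listIndex_double K (k := k + 1) hk (c := 0) rfl h, listIndex_cons_zero,
    listIndex_double K (k := k) rfl (c := 0) rfl (by omega), listIndex_cons_zero, zero_add]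

/-- The first blocks pass through `3, 4`, then `2, 3`, then `1, 2`, leaving the initial overhang
`[1]` for the parts 3 and 4. -/
theorem listIndex_three_four {n k : ℕ} (hk : n = k + 3) (h : 4 ≤ n) (l m : List ℕ) :
    listIndex K n (3 :: l) (4 :: m) = listIndex K k l (1 :: m) := by
  rw [listIndex_shrink K (k := k + 2) (by omega) (by omega) (c := 2) rfl h,
    listIndex_shrink K (k := k + 1) (by omega) (by omega) (c := 1) rfl (by omega),
    listIndex_double K (k := k) rfl (c := 0) rfl (by omega), listIndex_cons_zero]

theorem listIndex_one_two_one {n k : ℕ} (hk : n = k + 1) (h : 2 ≤ n) (l m : List ℕ) :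
    listIndex K n (1 :: l) (2 :: 1 :: m) = 0 + listIndex K k l (1 :: 1 :: m) := by
  rw [listIndex_double K hk (c := 0) rfl h, listIndex_cons_zero, zero_add]

theorem listIndex_one_four {n k : ℕ} (hk : n = k + 1) (h : 4 ≤ n) (l m : List ℕ) :
    listIndex K n (1 :: l) (4 :: m) = listIndex K k l (2 :: 1 :: m) :=
  listIndex_double K hk (c := 2) rfl h l m

end Rules

/-! ### The linear systems for the overhang series -/

section Series

open MvPowerSeries

variable (K : Type*) [Field K] [CharZero K] {P : ℕ → List ℕ → List ℕ → Prop}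
  {Q Q₀ : List ℕ → List ℕ → Prop}

/-- With `S₁`, `S₂`, `S₃` the series of `[1]`, `[1, 1]`, `[2, 1]` and `B` the balanced series, the
system is `S₁ = x S₂ + x S₃`, `S₂ = x²y S₁ + x² S₂`, `S₃ = x³y B + x³ S₁`; now eliminate `S₂` and
`S₃`. -/
theorem overhangSeries_three_four (h : IsOverhangCond P Q) :
    overhangSeries K {3, 4} P [1] * (1 - X 0 ^ 2 - X 0 ^ 3 * X 1 - X 0 ^ 4 + X 0 ^ 6) =
      X 0 ^ 4 * X 1 * (1 - X 0 ^ 2) * balancedSeries K {3, 4} Q := by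
  have h3 : 3 ∈ ({3, 4} : Set ℕ) := by simp
  have h4 : 4 ∈ ({3, 4} : Set ℕ) := by simp
  have e1 := overhangSeries_eq_add K (P := P) (a := 3) (b := 4) (o := [1]) (by simp) (by simp)
    (by simp) (by simp)
  have e2 := overhangSeries_eq_add K (P := P) (a := 3) (b := 4) (o := [1, 1]) (by simp) (by simp)
    (by simp) (by simp)
  have e3 := overhangSeries_eq_add K (P := P) (a := 3) (b := 4) (o := [2, 1]) (by simp) (by simp)
    (by simp) (by simp)
  rw [headSeries_swap K h h3 (o := [1]) (o' := [1, 1]) (by simp) rfl (by simp)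
      (fun l m hs => listIndex_three_one K (by simp at hs ⊢; omega) (by simp at hs ⊢; omega) l m),
    headSeries_swap K h h4 (o := [1]) (o' := [2, 1]) (by simp) rfl (by simp)
      (fun l m hs => listIndex_four_one K (by simp at hs ⊢; omega) (by simp at hs ⊢; omega) l m)]
    at e1
  rw [headSeries_swap K h h3 (o := [1, 1]) (o' := [1]) (by simp) rfl (by simp)
      (fun l m hs => listIndex_three_one_one K (by simp at hs ⊢; omega) (by simp at hs ⊢; omega)
        l m),
    headSeries_swap K h h4 (o := [1, 1]) (o' := [1, 1]) (by simp) rfl (by simp)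
      (fun l m hs => listIndex_four_one_one K (by simp at hs ⊢; omega) (by simp at hs ⊢; omega)
        l m)] at e2
  rw [headSeries_close K h h3 (o := [2, 1]) (by simp) rfl
      (fun l m hs => listIndex_three_two_one K (by omega) l m),
    headSeries_swap K h h4 (o := [2, 1]) (o' := [1]) (by simp) rfl (by simp)
      (fun l m hs => listIndex_four_two_one K (by simp at hs ⊢; omega) (by simp at hs ⊢; omega)
        l m)] at e3
  simp only [List.sum_cons, List.sum_nil] at e1 e2 e3
  linear_combination (1 - X 0 ^ 2) * e1 + X 0 * e2 + X 0 * (1 - X 0 ^ 2) * e3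

/-- Here `S₁ = xy B + x S₃`, `S₂ = xy S₁ + x² S₂`, `S₃ = x S₂ + x³ S₁`. The closing transition now
leaves `[1]` instead of `[2, 1]`, but elimination gives the same factor. -/
theorem overhangSeries_one_four (h : IsOverhangCond P Q) :
    overhangSeries K {1, 4} P [2, 1] * (1 - X 0 ^ 2 - X 0 ^ 3 * X 1 - X 0 ^ 4 + X 0 ^ 6) =
      (X 0 ^ 2 * X 1 + X 0 ^ 3 - X 0 ^ 5) * X 0 * X 1 * balancedSeries K {1, 4} Q := by
  have h1 : 1 ∈ ({1, 4} : Set ℕ) := by simp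
  have h4 : 4 ∈ ({1, 4} : Set ℕ) := by simp
  have e1 := overhangSeries_eq_add K (P := P) (a := 1) (b := 4) (o := [1]) (by simp) (by simp)
    (by simp) (by simp)
  have e2 := overhangSeries_eq_add K (P := P) (a := 1) (b := 4) (o := [1, 1]) (by simp) (by simp)
    (by simp) (by simp)
  have e3 := overhangSeries_eq_add K (P := P) (a := 1) (b := 4) (o := [2, 1]) (by simp) (by simp)
    (by simp) (by simp)
  rw [headSeries_close K h h1 (o := [1]) (by simp) rfl
      (fun l m hs => listIndex_cancel K (by omega) l m),
    headSeries_swap K h h4 (o := [1]) (o' := [2, 1]) (by simp) rfl (by simp)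
      (fun l m hs => listIndex_four_one K (by simp at hs ⊢; omega) (by simp at hs ⊢; omega) l m)]
    at e1
  rw [headSeries_keep K h h1 (o := [1, 1]) (o' := [1]) (by simp) rfl (by simp)
      (fun l m hs => listIndex_cancel K (by omega) l (1 :: m)),
    headSeries_swap K h h4 (o := [1, 1]) (o' := [1, 1]) (by simp) rfl (by simp)
      (fun l m hs => listIndex_four_one_one K (by simp at hs ⊢; omega) (by simp at hs ⊢; omega)
        l m)] at e2
  rw [headSeries_keep K h h1 (o := [2, 1]) (o' := [1, 1]) (by simp) rfl (by simp)
      (fun l m hs => listIndex_one_two_one K (by omega) (by simp at hs ⊢; omega) l m),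
    headSeries_swap K h h4 (o := [2, 1]) (o' := [1]) (by simp) rfl (by simp)
      (fun l m hs => listIndex_four_two_one K (by simp at hs ⊢; omega) (by simp at hs ⊢; omega)
        l m)] at e3
  simp only [List.sum_cons, List.sum_nil] at e1 e2 e3
  linear_combination (X 0 ^ 2 * X 1 + X 0 ^ 3 * (1 - X 0 ^ 2)) * e1 + X 0 * e2 +
    (1 - X 0 ^ 2) * e3

theorem balancedSeries_three_four (h : IsOverhangCond P Q) (h₀ : IsBalancedCond P Q Q₀) :
    balancedSeries K {3, 4} Q₀ * (1 - X 0 ^ 2 - X 0 ^ 3 * X 1 - X 0 ^ 4 + X 0 ^ 6) =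
      ((X 0 ^ 3 * X 1 ^ 3 + X 0 ^ 4 * X 1 ^ 4) *
          (1 - X 0 ^ 2 - X 0 ^ 3 * X 1 - X 0 ^ 4 + X 0 ^ 6) +
        2 * X 0 ^ 7 * X 1 - 2 * X 0 ^ 9 * X 1) * balancedSeries K {3, 4} Q := by
  have e := balancedSeries_eq K h₀ (a := 3) (b := 4) (by simp) (by simp) (o := [1]) rfl
    (fun l m hs => listIndex_three_four K (by omega) (by omega) l m)
  linear_combination (1 - X 0 ^ 2 - X 0 ^ 3 * X 1 - X 0 ^ 4 + X 0 ^ 6) * e +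
    2 * X 0 ^ 3 * overhangSeries_three_four K h

theorem balancedSeries_one_four (h : IsOverhangCond P Q) (h₀ : IsBalancedCond P Q Q₀) :
    balancedSeries K {1, 4} Q₀ * (1 - X 0 ^ 2 - X 0 ^ 3 * X 1 - X 0 ^ 4 + X 0 ^ 6) =
      ((X 0 * X 1 + X 0 ^ 4 * X 1 ^ 4) *
          (1 - X 0 ^ 2 - X 0 ^ 3 * X 1 - X 0 ^ 4 + X 0 ^ 6) +
        2 * (X 0 ^ 4 * X 1 ^ 2 + X 0 ^ 5 * X 1 - X 0 ^ 7 * X 1)) *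
          balancedSeries K {1, 4} Q := by
  have e := balancedSeries_eq K h₀ (a := 1) (b := 4) (by simp) (by simp) (o := [2, 1]) rfl
    (fun l m hs => listIndex_one_four K (by omega) (by omega) l m)
  linear_combination (1 - X 0 ^ 2 - X 0 ^ 3 * X 1 - X 0 ^ 4 + X 0 ^ 6) * e +
    2 * X 0 * overhangSeries_one_four K h

end Series

/-! ### Generating functions -/

section GeneratingFunctions

open MvPowerSeries

theorem coeff_X_pow_mul_X_pow_of_lt {s : ℕ} (q : ℕ) {d : Fin 2 →₀ ℕ} (h : s < d 0) :
    coeff d (X 0 ^ s * X 1 ^ q : MvPowerSeries (Fin 2) ℤ) = 0 := by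
  rw [X_pow_mul_X_pow_eq_monomial, coeff_monomial, if_neg]
  rintro rfl
  simp at h

theorem isUnit_one_sub_X_pow :
    IsUnit (1 - X 0 ^ 2 - X 0 ^ 3 * X 1 - X 0 ^ 4 + X 0 ^ 6 : MvPowerSeries (Fin 2) ℤ) := by
  rw [isUnit_iff_constantCoeff]
  simp

/-- The recurrence is the coefficient form of multiplication by the common factor; it holds beyond
the `x`-degree of the numerator `R`. -/
theorem satisfiesMeanderRecurrence_of_mul_eq {i : ℕ → ℕ → ℕ} {I R : MvPowerSeries (Fin 2) ℤ}
    (hi : ∀ d : Fin 2 →₀ ℕ, (i (d 0) (d 1) : ℤ) = coeff d I)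
    (hI : I * (1 - X 0 ^ 2 - X 0 ^ 3 * X 1 - X 0 ^ 4 + X 0 ^ 6) = R)
    (hR : ∀ d : Fin 2 →₀ ℕ, 10 < d 0 → coeff d R = 0) : SatisfiesMeanderRecurrence i := by
  intro n k hn
  have hI' : I = X 0 ^ 2 * X 1 ^ 0 * I + X 0 ^ 3 * X 1 ^ 1 * I + X 0 ^ 4 * X 1 ^ 0 * I -
      X 0 ^ 6 * X 1 ^ 0 * I + R := by
    linear_combination hI
  have hshift : ∀ s q : ℕ, s ≤ n →
      coeff (Finsupp.single 0 n + Finsupp.single 1 k) (X 0 ^ s * X 1 ^ q * I) =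
        if q ≤ k then (i (n - s) (k - q) : ℤ) else 0 := by
    intro s q hs
    rw [coeff_X_pow_mul_X_pow_mul, ← hi]
    simp [hs]
  have e := congrArg (coeff (Finsupp.single 0 n + Finsupp.single 1 k)) hI'
  rw [map_add, map_sub, map_add, map_add, hshift _ _ (by omega), hshift _ _ (by omega),
    hshift _ _ (by omega), hshift _ _ (by omega), hR _ (by simpa using hn), ← hi] at e
  rcases Nat.eq_zero_or_pos k with rfl | hk
  · simpa using e
  · simpa [hk.ne', Nat.one_le_iff_ne_zero] using e

variable (K : Type*) [Field K] [CharZero K]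

omit [CharZero K] in
theorem meanderGenFun_eq_balancedSeries {J : Set ℕ} (hJ : ∀ b ∈ J, 0 < b) :
    meanderGenFun K J = balancedSeries K J fun _ _ => True := by
  ext d
  exact meanderCount_eq K hJ d

theorem meanderGenFun_three_four_mul :
    meanderGenFun K {3, 4} *
        ((1 - X 0 ^ 3 * X 1 ^ 3 - X 0 ^ 4 * X 1 ^ 4) *
          (1 - X 0 ^ 2 - X 0 ^ 3 * X 1 - X 0 ^ 4 + X 0 ^ 6) -
            2 * X 0 ^ 7 * X 1 + 2 * X 0 ^ 9 * X 1) =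
      1 - X 0 ^ 2 - X 0 ^ 3 * X 1 - X 0 ^ 4 + X 0 ^ 6 := by
  have hJ : ∀ b ∈ ({3, 4} : Set ℕ), 0 < b := by simp
  have e1 := balancedSeries_true K hJ
  have e2 := balancedSeries_three_four K isOverhangCond_true isBalancedCond_ne_nil
  rw [meanderGenFun_eq_balancedSeries K hJ]
  linear_combination (1 - X 0 ^ 2 - X 0 ^ 3 * X 1 - X 0 ^ 4 + X 0 ^ 6) * e1 + e2

theorem indecSeries_three_four_mul :
    balancedSeries K {3, 4} IndecPair *
        (1 - X 0 ^ 2 - X 0 ^ 3 * X 1 - X 0 ^ 4 + X 0 ^ 6) =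
      (X 0 ^ 3 * X 1 ^ 3 + X 0 ^ 4 * X 1 ^ 4) *
          (1 - X 0 ^ 2 - X 0 ^ 3 * X 1 - X 0 ^ 4 + X 0 ^ 6) +
        2 * X 0 ^ 7 * X 1 - 2 * X 0 ^ 9 * X 1 := by
  rw [balancedSeries_three_four K isOverhangCond_noCut isBalancedCond_indecPair,
    balancedSeries_nil, mul_one]

theorem indecSeries_one_four_mul :
    balancedSeries K {1, 4} IndecPair *
        (1 - X 0 ^ 2 - X 0 ^ 3 * X 1 - X 0 ^ 4 + X 0 ^ 6) =
      (X 0 * X 1 + X 0 ^ 4 * X 1 ^ 4) *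
          (1 - X 0 ^ 2 - X 0 ^ 3 * X 1 - X 0 ^ 4 + X 0 ^ 6) +
        2 * (X 0 ^ 4 * X 1 ^ 2 + X 0 ^ 5 * X 1 - X 0 ^ 7 * X 1) := by
  rw [balancedSeries_one_four K isOverhangCond_noCut isBalancedCond_indecPair,
    balancedSeries_nil, mul_one]

theorem satisfiesMeanderRecurrence_three_four :
    SatisfiesMeanderRecurrence (indecMeanderCount K {3, 4}) := by
  refine satisfiesMeanderRecurrence_of_mul_eq (indecMeanderCount_eq K (by simp))
    (indecSeries_three_four_mul K) fun d hd => ?_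
  have e : ((X 0 ^ 3 * X 1 ^ 3 + X 0 ^ 4 * X 1 ^ 4) *
      (1 - X 0 ^ 2 - X 0 ^ 3 * X 1 - X 0 ^ 4 + X 0 ^ 6) +
        2 * X 0 ^ 7 * X 1 - 2 * X 0 ^ 9 * X 1 : MvPowerSeries (Fin 2) ℤ) =
      X 0 ^ 3 * X 1 ^ 3 + X 0 ^ 4 * X 1 ^ 4 - X 0 ^ 5 * X 1 ^ 3 - X 0 ^ 6 * X 1 ^ 4
        - X 0 ^ 6 * X 1 ^ 4 - X 0 ^ 7 * X 1 ^ 5 - X 0 ^ 7 * X 1 ^ 3 - X 0 ^ 8 * X 1 ^ 4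
        + X 0 ^ 9 * X 1 ^ 3 + X 0 ^ 10 * X 1 ^ 4 + X 0 ^ 7 * X 1 ^ 1 + X 0 ^ 7 * X 1 ^ 1
        - X 0 ^ 9 * X 1 ^ 1 - X 0 ^ 9 * X 1 ^ 1 := by ring
  rw [e]
  simp (disch := omega) only [map_add, map_sub, coeff_X_pow_mul_X_pow_of_lt, add_zero, sub_zero]

theorem satisfiesMeanderRecurrence_one_four :
    SatisfiesMeanderRecurrence (indecMeanderCount K {1, 4}) := by
  refine satisfiesMeanderRecurrence_of_mul_eq (indecMeanderCount_eq K (by simp))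
    (indecSeries_one_four_mul K) fun d hd => ?_
  have e : ((X 0 * X 1 + X 0 ^ 4 * X 1 ^ 4) *
      (1 - X 0 ^ 2 - X 0 ^ 3 * X 1 - X 0 ^ 4 + X 0 ^ 6) +
        2 * (X 0 ^ 4 * X 1 ^ 2 + X 0 ^ 5 * X 1 - X 0 ^ 7 * X 1) : MvPowerSeries (Fin 2) ℤ) =
      X 0 ^ 1 * X 1 ^ 1 - X 0 ^ 3 * X 1 ^ 1 + X 0 ^ 4 * X 1 ^ 2 + X 0 ^ 5 * X 1 ^ 1
        - X 0 ^ 7 * X 1 ^ 1 + X 0 ^ 4 * X 1 ^ 4 - X 0 ^ 6 * X 1 ^ 4 - X 0 ^ 7 * X 1 ^ 5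
        - X 0 ^ 8 * X 1 ^ 4 + X 0 ^ 10 * X 1 ^ 4 := by ring
  rw [e]
  simp (disch := omega) only [map_add, map_sub, coeff_X_pow_mul_X_pow_of_lt, add_zero, sub_zero]

theorem indecSeries_three_four_eq :
    balancedSeries K {3, 4} IndecPair =
      X 0 ^ 6 * X 1 ^ 0 * balancedSeries K {1, 4} IndecPair + X 0 ^ 3 * X 1 ^ 3 +
        X 0 ^ 4 * X 1 ^ 4 + X 0 ^ 7 * X 1 ^ 1 - X 0 ^ 10 * X 1 ^ 4 := by
  -- After multiplication by the common factor this is a polynomial identity between the two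
  -- numerators.
  refine isUnit_one_sub_X_pow.mul_right_cancel ?_
  linear_combination indecSeries_three_four_mul K - X 0 ^ 6 * indecSeries_one_four_mul K

theorem indecMeanderCount_three_four_eq {n : ℕ} (k : ℕ) (hn : 10 < n) :
    indecMeanderCount K {3, 4} n k = indecMeanderCount K {1, 4} (n - 6) k := by
  have e1 := indecMeanderCount_eq K (J := {3, 4}) (by simp)
    (Finsupp.single 0 n + Finsupp.single 1 k)
  have e2 := indecMeanderCount_eq K (J := {1, 4}) (by simp)
    (Finsupp.single 0 n + Finsupp.single 1 k - (Finsupp.single 0 6 + Finsupp.single 1 0))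
  have hlt : ∀ {s : ℕ}, s ≤ 10 → s < (Finsupp.single 0 n + Finsupp.single 1 k : Fin 2 →₀ ℕ) 0 := by
    intro s hs
    simp
    omega
  rw [indecSeries_three_four_eq, map_sub, map_add, map_add, map_add, coeff_X_pow_mul_X_pow_mul,
    ← e2, coeff_X_pow_mul_X_pow_of_lt _ (hlt (by norm_num)),
    coeff_X_pow_mul_X_pow_of_lt _ (hlt (by norm_num)),
    coeff_X_pow_mul_X_pow_of_lt _ (hlt (by norm_num)),
    coeff_X_pow_mul_X_pow_of_lt _ (hlt (by norm_num)),
    if_pos ⟨(hlt (by norm_num)).le, Nat.zero_le _⟩] at e1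
  simpa using e1

theorem list_sum_map_mul_left (c : ℕ) (l : List ℕ) : (l.map (c * ·)).sum = c * l.sum := by
  induction l with
  | nil => rfl
  | cons b l ih => simp [ih, mul_add]

theorem balancedSet_image_mul {J : Set ℕ} {c : ℕ} (hc : c ≠ 0) :
    balancedSet ((c * ·) '' J) (fun _ _ => True) =
      (fun w => (w.1.map (c * ·), w.2.map (c * ·))) '' balancedSet J fun _ _ => True := by
  have hrange : ∀ l : List ℕ, (∀ b ∈ l, b ∈ (c * ·) '' J) →
      ∃ l' : List ℕ, (∀ b ∈ l', b ∈ J) ∧ l'.map (c * ·) = l := by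
    intro l
    induction l with
    | nil => exact fun _ => ⟨[], by simp, rfl⟩
    | cons b l ih =>
      intro h
      obtain ⟨b', hb', rfl⟩ := h b (by simp)
      obtain ⟨l', hl', rfl⟩ := ih fun x hx => h x (by simp [hx])
      exact ⟨b' :: l', by simpa using ⟨hb', hl'⟩, rfl⟩
  ext ⟨l, m⟩
  constructor
  · rintro ⟨⟨hl, hm⟩, hs, -⟩
    obtain ⟨l, hl', rfl⟩ := hrange l hl
    obtain ⟨m, hm', rfl⟩ := hrange m hm
    refine ⟨(l, m), ⟨⟨hl', hm'⟩, ?_, trivial⟩, rfl⟩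
    simpa [list_sum_map_mul_left, hc] using hs
  · rintro ⟨⟨l, m⟩, ⟨⟨hl, hm⟩, hs, -⟩, h⟩
    obtain ⟨rfl, rfl⟩ := Prod.mk.inj h
    refine ⟨⟨?_, ?_⟩, ?_, trivial⟩
    · intro b hb
      obtain ⟨a, ha, rfl⟩ := List.mem_map.1 hb
      exact ⟨a, hl a ha, rfl⟩
    · intro b hb
      obtain ⟨a, ha, rfl⟩ := List.mem_map.1 hb
      exact ⟨a, hm a ha, rfl⟩
    · simpa [list_sum_map_mul_left, hc] using hs

/-- Scaling all blocks by `c` multiplies both size and index by `c`, so only exponents divisible by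
`c` survive, in `x` and in `y` alike. -/
theorem balancedSeries_image_mul (J : Set ℕ) {c : ℕ} (hc : c ≠ 0) :
    balancedSeries K ((c * ·) '' J) (fun _ _ => True) =
      expand c hc (balancedSeries K J fun _ _ => True) := by
  have hinj : Function.Injective
      fun w : List ℕ × List ℕ => (w.1.map (c * ·), w.2.map (c * ·)) :=
    (List.map_injective_iff.2 (mul_right_injective₀ hc)).prodMap
      (List.map_injective_iff.2 (mul_right_injective₀ hc))
  ext d
  rw [balancedSeries, coeff_countSeries, balancedSet_image_mul hc]
  have hS : {w | w ∈ (fun w : List ℕ × List ℕ => (w.1.map (c * ·), w.2.map (c * ·))) ''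
        balancedSet J (fun _ _ => True) ∧ w.1.sum = d 0 ∧ listIndex K w.1.sum w.1 w.2 = d 1} =
      (fun w : List ℕ × List ℕ => (w.1.map (c * ·), w.2.map (c * ·))) ''
        {w | w ∈ balancedSet J (fun _ _ => True) ∧ c * w.1.sum = d 0 ∧
          c * listIndex K w.1.sum w.1 w.2 = d 1} := by
    ext w
    constructor
    · rintro ⟨⟨v, hv, rfl⟩, h0, h1⟩
      rw [list_sum_map_mul_left] at h0
      rw [list_sum_map_mul_left, listIndex_map_mul K c rfl hv.2.1.symm] at h1
      exact ⟨v, ⟨hv, h0, h1⟩, rfl⟩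
    · rintro ⟨v, ⟨hv, h0, h1⟩, rfl⟩
      refine ⟨⟨v, hv, rfl⟩, ?_, ?_⟩
      · rw [list_sum_map_mul_left, h0]
      · rw [list_sum_map_mul_left, listIndex_map_mul K c rfl hv.2.1.symm, h1]
  rw [hS, Set.ncard_image_of_injective _ hinj]
  by_cases hd : ∀ i, c ∣ d i
  · obtain ⟨e, rfl⟩ : ∃ e : Fin 2 →₀ ℕ, d = c • e := by
      choose e he using hd
      exact ⟨Finsupp.equivFunOnFinite.symm e, Finsupp.ext fun i => he i⟩
    rw [coeff_expand_smul, balancedSeries, coeff_countSeries]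
    simp [hc]
  · rw [not_forall] at hd
    obtain ⟨i, hi⟩ := hd
    rw [coeff_expand_of_not_dvd c hc _ hi, Nat.cast_eq_zero]
    convert Set.ncard_empty (List ℕ × List ℕ)
    rw [Set.eq_empty_iff_forall_notMem]
    rintro w ⟨-, h0, h1⟩
    fin_cases i
    · exact hi ⟨_, h0.symm⟩
    · exact hi ⟨_, h1.symm⟩

theorem meanderGenFun_mul_three_mul_four {c : ℕ} (hc : c ≠ 0) :
    meanderGenFun K {3 * c, 4 * c} = expand c hc (meanderGenFun K {3, 4}) := by
  have hJ : ({3 * c, 4 * c} : Set ℕ) = (c * ·) '' {3, 4} := by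
    simp [Set.image_pair, mul_comm]
  rw [meanderGenFun_eq_balancedSeries K (by simpa using Nat.pos_of_ne_zero hc),
    meanderGenFun_eq_balancedSeries K (by simp), hJ, balancedSeries_image_mul]

end GeneratingFunctions

theorem mainTheorem9 (K : Type*) [Field K] [CharZero K] :
    (∀ x y N D : MvPowerSeries (Fin 2) ℤ,
      x = MvPowerSeries.X 0 → y = MvPowerSeries.X 1 →
      N = 1 - x ^ 2 - x ^ 3 * y - x ^ 4 + x ^ 6 →
      D = (1 - x ^ 3 * y ^ 3 - x ^ 4 * y ^ 4) * (1 - x ^ 2 - x ^ 3 * y - x ^ 4 + x ^ 6)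
        - 2 * x ^ 7 * y + 2 * x ^ 9 * y →
      IsUnit D ∧ meanderGenFun K {3, 4} * D = N) ∧
    SatisfiesMeanderRecurrence (indecMeanderCount K {3, 4}) ∧
    SatisfiesMeanderRecurrence (indecMeanderCount K {1, 4}) ∧
    (∀ n k : ℕ, 10 < n →
      indecMeanderCount K {3, 4} n k = indecMeanderCount K {1, 4} (n - 6) k) ∧
    (∀ (c : ℕ) (hc : c ≠ 0),
      meanderGenFun K {3 * c, 4 * c} = MvPowerSeries.expand c hc (meanderGenFun K {3, 4})) := by
  refine ⟨?_, satisfiesMeanderRecurrence_three_four K, satisfiesMeanderRecurrence_one_four K,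
    fun n k hn => indecMeanderCount_three_four_eq K k hn,
    fun c hc => meanderGenFun_mul_three_mul_four K hc⟩
  rintro x y N D rfl rfl rfl rfl
  refine ⟨?_, meanderGenFun_three_four_mul K⟩
  rw [MvPowerSeries.isUnit_iff_constantCoeff]
  simp
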